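/- Let $k$ be an algebraically closed field of characteristic $0$, let $(X,\Lambda_0)$ be a nonsingular Poisson variety over $k$ (an integral, separated, smooth $k$-scheme of finite type whose structure sheaf carries a $k$-bilinear Poisson bracket), and let $(F,\nabla)$ be a Poisson vector bundle on it: a locally free sheaf of finite rank with a flat Poisson connection, i.e. a $k$-bilinear bracket $\{-,-\}:\mathcal O_X\otimes_k F\to F$ with $\{fg,s\}=f\{g,s\}+g\{f,s\}$, $\{f,gs\}=\{f,g\}s+g\{f,s\}$ and $\{f,\{g,s\}\}=\{\{f,g\},s\}+\{g,\{f,s\}\}$. For a local $k$-algebra $A$ with residue field $k$, a deformation of $(F,\nabla)$ over $A$ is a Poisson vector bundle on $X\times\operatorname{Spec}A$ with $A$-bilinear connection (for the $A$-linear extension of $\Lambda_0$), together with an identification of its restriction to $X$ with $(F,\nabla)$; isomorphisms of deformations are isomorphisms of Poisson modules inducing the identity on $F$, and $\mathrm{Def}_{(F,\nabla)}(A)$ is the set of isomorphism classes. The sheaf $\mathscr{H}om(F,F)$ has the flat Poisson connection $\{f,\phi\}(s)=\{f,\phi(s)\}-\phi(\{f,s\})$, which gives the complex $$\mathscr{H}om(F,F)^\bullet:\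 \mathscr{H}om(F,F)\xrightarrow{v_0}T_X\otimes\mathscr{H}om(F,F)\xrightarrow{v_1}\wedge^2T_X\otimes\mathscr{H}om(F,F)\to\cdots,$$ where $v_p(D)(f_0,\dots,f_p)=\sum_i(-1)^i\{f_i,D(\dots\widehat{f_i}\dots)\}+\sum_{i<j}(-1)^{i+j}D(\{f_i,f_j\},\dots\widehat{f_i}\dots\widehat{f_j}\dots)$. Let $\mathcal U=\{U_\alpha\}$ be any affine open cover of $X$, and let $\mathbb H^n=\mathbb H^n(X,\Lambda_0,\mathscr{H}om(F,F)^\bullet)$ be the hypercohomology, computed by the total Čech complex $\bigoplus_{p+q=n}\check C^q(\mathcal U,\wedge^pT_X\otimes\mathscr{H}om(F,F))$ with differential $v+(-1)^{n+1}\delta$ on degree $n$. (1) There is a bijection $\kappa:\mathrm{Def}_{(F,\nabla)}(k[\epsilon])\to\mathbb H^1$ given as follows. Every first-order deformation is isomorphic over each $U_\alpha$, as a deformation of $\mathcal O$-modules, to $F|_{U_\alpha}\otimes_k k[\epsilon]$. For every choice of such isomorphisms, if the transition functions are $1+\epsilon G_{\alpha\beta}$ and the connection becomes $\nabla+\epsilon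 W_\alpha$ on $U_\alpha$, then $(\{-W_\alpha\},\{G_{\alpha\beta}\})$ is a $1$-cocycle and $\kappa$ sends the deformation to its class. (2) Let $A$ be a local Artinian $k$-algebra with residue field $k$, $\eta$ a deformation of $(F,\nabla)$ over $A$, and $e:0\to(t)\to\tilde A\to A\to0$ a small extension of local Artinian $k$-algebras with residue field $k$ (so $t\ne0$ and $t\,\mathfrak m_{\tilde A}=0$). There is a class $o_\eta(e)\in\mathbb H^2$ which is $0$ if and only if $\eta$ lifts to a deformation over $\tilde A$. It is given as follows. After a choice of isomorphisms of $\eta|_{U_\alpha}$ with $F|_{U_\alpha}\otimes_kA$ as deformations of $\mathcal O$-modules (which exist), the transition functions and the connections of $\eta$ have lifts $\tilde F_{\alpha\beta}\in\mathrm{End}(F|_{U_\alpha\cap U_\beta}\otimes_k\tilde A)$ and $\tilde\nabla_\alpha$ (an $\tilde A$-linear, not necessarily flat, Poisson connection on $F|_{U_\alpha}\otimes_k\tilde A$). For every choice of these data there are $S_\alpha,Q_{\alpha\beta},G_{\alpha\beta\gamma}$ such that $tS_\alpha$ is the curvature of $\tilde\nabla_\alpha$, $\tilde\nabla_\alpha\tilde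 F_{\alpha\beta}-\tilde F_{\alpha\beta}\tilde\nabla_\beta=tQ_{\alpha\beta}$ and $\tilde F_{\alpha\beta}\tilde F_{\beta\gamma}-\tilde F_{\alpha\gamma}=tG_{\alpha\beta\gamma}$; the triple $(\{-S_\alpha\},\{Q_{\alpha\beta}\},\{G_{\alpha\beta\gamma}\})$ is a $2$-cocycle, and $o_\eta(e)$ is its class. -/

import Mathlib

open CategoryTheory Opposite TopologicalSpace AlgebraicGeometry
open scoped TensorProduct

universe u

noncomputable section

namespace PoissonBundles

/-! ### Sheaves of algebras, Poisson brackets, sheaves of modules -/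

section Basic

variable {S : Type u} [CommRing S] {T : TopCat.{u}}

/-- Presheaves of commutative `S`-algebras on a topological space. -/
abbrev AlgPresheaf (S : Type u) [CommRing S] (T : TopCat.{u}) :=
  TopCat.Presheaf (CommAlgCat.{u} S) T

/-- Sections of `R` over `U`. -/
abbrev Fn (R : AlgPresheaf S T) (U : Opens T) : Type u := R.obj (op U)

/-- Restriction of functions. -/
def Fn.res {R : AlgPresheaf S T} {V U : Opens T} (h : V ≤ U) : Fn R U →ₐ[S] Fn R V :=
  (R.map (homOfLE h).op).hom

/-- A Poisson structure over `S` on a sheaf of `S`-algebras: `S`-bilinear brackets on sections,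
compatible with restriction. -/
structure PoissonStructure (R : AlgPresheaf S T) where
  br (U : Opens T) : Fn R U →ₗ[S] Fn R U →ₗ[S] Fn R U
  skew : ∀ U f g, br U f g = - br U g f
  leibniz : ∀ U f g h, br U (f * g) h = f * br U g h + g * br U f h
  jacobi : ∀ U f g h, br U f (br U g h) + br U g (br U h f) + br U h (br U f g) = 0
  res_br : ∀ {V U : Opens T} (h : V ≤ U) f g, Fn.res h (br U f g) = br V (Fn.res h f) (Fn.res h g)

/-- Presheaves of `R`-modules. -/
abbrev PMod (R : AlgPresheaf S T) :=
  PresheafOfModules.{u} (R ⋙ forget₂ (CommAlgCat.{u} S) CommRingCat.{u} ⋙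
    forget₂ CommRingCat.{u} RingCat.{u})

/-- Sections of a presheaf of modules over `U`. -/
def Sec {R : AlgPresheaf S T} (M : PMod R) (U : Opens T) : Type u := M.obj (op U)

namespace Sec

variable {R : AlgPresheaf S T}

instance (M : PMod R) (U : Opens T) : AddCommGroup (Sec M U) :=
  inferInstanceAs (AddCommGroup (M.obj (op U)))

instance (M : PMod R) (U : Opens T) : Module (Fn R U) (Sec M U) :=
  (M.obj (op U)).isModule

instance (M : PMod R) (U : Opens T) : Module S (Sec M U) :=
  Module.compHom _ (algebraMap S (Fn R U))

instance (M : PMod R) (U : Opens T) : IsScalarTower S (Fn R U) (Sec M U) :=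
  IsScalarTower.of_algebraMap_smul fun _ _ => rfl

lemma map_smul_aux (M : PMod R) {V U : Opens T} (h : V ≤ U) (g : Fn R U) (m : Sec M U) :
    (M.map (homOfLE h).op).hom (g • m : Sec M U) =
      (Fn.res h g • ((M.map (homOfLE h).op).hom m : Sec M V) : Sec M V) :=
  (M.map (homOfLE h).op).hom.map_smul g m

/-- Restriction of sections of a presheaf of modules. -/
def res {M : PMod R} {V U : Opens T} (h : V ≤ U) : Sec M U →ₗ[S] Sec M V where
  toFun m := (M.map (homOfLE h).op).hom m
  map_add' m n := (M.map (homOfLE h).op).hom.map_add m n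
  map_smul' c m := by
    have := map_smul_aux M h (algebraMap S (Fn R U) c) m
    rw [AlgHom.commutes] at this
    exact this

end Sec

/-- `M` is locally free of finite rank. -/
def IsLocallyFree {R : AlgPresheaf S T} (M : PMod R) : Prop :=
  ∀ x : T, ∃ U : Opens T, x ∈ U ∧ ∃ (n : ℕ) (e : Fin n → Sec M U), ∀ (V : Opens T) (h : V ≤ U),
    Function.Bijective fun c : Fin n → Fn R V => ∑ i, c i • Sec.res h (e i)

/-- A Poisson vector bundle over `S`: a sheaf of `R`-modules, locally free of finite rank, with a
flat `S`-bilinear Poisson connection `{-,-} : R ⊗ M → M`. -/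
structure PoissonBundle {R : AlgPresheaf S T} (P : PoissonStructure R) where
  M : PMod R
  isSheaf : TopCat.Presheaf.IsSheaf M.presheaf
  locallyFree : IsLocallyFree M
  conn (U : Opens T) : Fn R U →ₗ[S] Sec M U →ₗ[S] Sec M U
  conn_mul : ∀ U f g m, conn U (f * g) m = f • conn U g m + g • conn U f m
  conn_smul : ∀ U f g m, conn U f (g • m) = P.br U f g • m + g • conn U f m
  flat : ∀ U f g m, conn U f (conn U g m) = conn U (P.br U f g) m + conn U g (conn U f m)
  res_conn : ∀ {V U : Opens T} (h : V ≤ U) f m,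
    Sec.res h (conn U f m) = conn V (Fn.res h f) (Sec.res h m)

end Basic

/-- The `k`-algebra structure on functions on a scheme over `k`. -/
abbrev scalars {k : Type u} [CommRing k] {X : Scheme.{u}} (p : X ⟶ Spec (CommRingCat.of k))
    (U : (Opens X)ᵒᵖ) : k →+* X.presheaf.obj U :=
  ((Scheme.ΓSpecIso (CommRingCat.of k)).inv ≫ p.appTop ≫
      X.presheaf.map (homOfLE (le_top : U.unop ≤ ⊤)).op).hom

/-- The structure sheaf of a scheme over `k`, as a sheaf of `k`-algebras. -/
def structureSheaf {k : Type u} [CommRing k] {X : Scheme.{u}} (p : X ⟶ Spec (CommRingCat.of k)) :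
    AlgPresheaf k X where
  obj U := @CommAlgCat.of k _ (X.presheaf.obj U) _ (scalars p U).toAlgebra
  map {U V} i := by
    letI := fun W : (Opens X)ᵒᵖ => (scalars p W).toAlgebra
    exact CommAlgCat.ofHom
      { (X.presheaf.map i).hom with
        commutes' := fun c => by
          change (X.presheaf.map i).hom (scalars p U c) = scalars p V c
          have : (homOfLE (le_top : U.unop ≤ ⊤)).op ≫ i = (homOfLE (le_top : V.unop ≤ ⊤)).op :=
            Subsingleton.elim _ _
          rw [scalars, scalars, ← this, X.presheaf.map_comp]
          rfl }
  map_id U := by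
    let := fun W : (Opens X)ᵒᵖ => (scalars p W).toAlgebra
    apply CommAlgCat.hom_ext
    exact AlgHom.ext fun x => congr($(X.presheaf.map_id U) x)
  map_comp f g := by
    let := fun W : (Opens X)ᵒᵖ => (scalars p W).toAlgebra
    apply CommAlgCat.hom_ext
    exact AlgHom.ext fun x => congr($(X.presheaf.map_comp f g) x)

/-! ### The product with `Spec A` -/

section BaseChange

variable {k : Type u} [CommRing k] {T : TopCat.{u}}

/-- `R ⊗ A`, as a presheaf of `A`-algebras. If `A` is a local Artinian `k`-algebra with residue
field `k`, then `Spec A` is a point and `A` is finite dimensional, so for the structure sheaf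
`R = 𝒪_X` this is the structure sheaf of `X × Spec A`, a scheme with the same underlying space as
`X`. -/
def baseChange (R : AlgPresheaf k T) (A : Type u) [CommRing A] [Algebra k A] :
    AlgPresheaf A T where
  obj U := CommAlgCat.of A (A ⊗[k] R.obj U)
  map i := CommAlgCat.ofHom (Algebra.TensorProduct.map (AlgHom.id A A) (R.map i).hom)
  map_id U := by
    apply CommAlgCat.hom_ext
    simp
  map_comp f g := by
    apply CommAlgCat.hom_ext
    simp only [Functor.map_comp, CommAlgCat.hom_comp, CommAlgCat.hom_ofHom]
    ext x
    rfl

/-- The function `a ⊗ f` on the product with `Spec A`. -/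
def tm {R : AlgPresheaf k T} {A : Type u} [CommRing A] [Algebra k A] {U : Opens T}
    (a : A) (f : Fn R U) : Fn (baseChange R A) U :=
  (a ⊗ₜ[k] f : A ⊗[k] Fn R U)

variable {R : AlgPresheaf k T}

lemma Fn.induction {A : Type u} [CommRing A] [Algebra k A] {U : Opens T}
    {p : Fn (baseChange R A) U → Prop} (x) (h0 : p 0) (ht : ∀ a f, p (tm a f))
    (ha : ∀ x y, p x → p y → p (x + y)) : p x :=
  TensorProduct.induction_on x h0 ht ha

lemma tm_mul_tm {A : Type u} [CommRing A] [Algebra k A] {U : Opens T} (a b : A) (f g : Fn R U) :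
    (tm a f : Fn (baseChange R A) U) * tm b g = tm (a * b) (f * g) :=
  Algebra.TensorProduct.tmul_mul_tmul a b f g

lemma res_tm {A : Type u} [CommRing A] [Algebra k A] {V U : Opens T} (h : V ≤ U) (a : A)
    (f : Fn R U) : Fn.res h (tm a f : Fn (baseChange R A) U) = tm a (Fn.res h f) := rfl

/-- The `A`-bilinear extension of the bracket: `{a ⊗ f, b ⊗ g} = ab ⊗ {f, g}`. -/
def bracketBaseChange (P : PoissonStructure R) (A : Type u) [CommRing A] [Algebra k A]
    (U : Opens T) :
    Fn (baseChange R A) U →ₗ[A] Fn (baseChange R A) U →ₗ[A] Fn (baseChange R A) U :=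
  LinearMap.BilinMap.baseChange A (P.br U)

lemma bracketBaseChange_tm (P : PoissonStructure R) {A : Type u} [CommRing A] [Algebra k A]
    (U : Opens T) (a b : A) (f g : Fn R U) :
    bracketBaseChange P A U (tm a f) (tm b g) = tm (a * b) (P.br U f g) :=
  LinearMap.BilinMap.baseChange_tmul (P.br U) a f b g

/-- The Poisson structure over `A` induced on the product with `Spec A`. -/
def PoissonStructure.baseChange (P : PoissonStructure R) (A : Type u) [CommRing A] [Algebra k A] :
    PoissonStructure (baseChange R A) where
  br := bracketBaseChange P A
  skew U f g := by
    induction f using Fn.induction with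
    | h0 => simp
    | ha x y hx hy => simp only [map_add, LinearMap.add_apply, hx, hy, neg_add]
    | ht a f =>
      induction g using Fn.induction with
      | h0 => simp
      | ha x y hx hy => simp only [map_add, LinearMap.add_apply, hx, hy, neg_add]
      | ht b g =>
        rw [bracketBaseChange_tm, bracketBaseChange_tm, P.skew, mul_comm b a]
        exact TensorProduct.tmul_neg _ _
  leibniz U f g h := by
    induction f using Fn.induction with
    | h0 => simp
    | ha x y hx hy => simp only [map_add, LinearMap.add_apply, add_mul, mul_add, hx, hy]; ring
    | ht a f =>
    induction g using Fn.induction with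
    | h0 => simp
    | ha x y hx hy => simp only [map_add, LinearMap.add_apply, add_mul, mul_add, hx, hy]; ring
    | ht b g =>
    induction h using Fn.induction with
    | h0 => simp
    | ha x y hx hy => simp only [map_add, mul_add, hx, hy]; ring
    | ht c h =>
      simp only [tm_mul_tm, bracketBaseChange_tm, P.leibniz]
      rw [show b * (a * c) = a * b * c by ring, show a * (b * c) = a * b * c by ring]
      exact TensorProduct.tmul_add _ _ _
  jacobi U f g h := by
    induction f using Fn.induction with
    | h0 => simp
    | ha x y hx hy =>
      simp only [map_add, LinearMap.add_apply]
      rw [← add_zero (0 : Fn (PoissonBundles.baseChange R A) U)]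
      nth_rewrite 1 [← hx]
      rw [← hy]
      abel
    | ht a f =>
    induction g using Fn.induction with
    | h0 => simp
    | ha x y hx hy =>
      simp only [map_add, LinearMap.add_apply]
      rw [← add_zero (0 : Fn (PoissonBundles.baseChange R A) U)]
      nth_rewrite 1 [← hx]
      rw [← hy]
      abel
    | ht b g =>
    induction h using Fn.induction with
    | h0 => simp
    | ha x y hx hy =>
      simp only [map_add, LinearMap.add_apply]
      rw [← add_zero (0 : Fn (PoissonBundles.baseChange R A) U)]
      nth_rewrite 1 [← hx]
      rw [← hy]
      abel
    | ht c h =>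
      simp only [bracketBaseChange_tm]
      rw [show b * (c * a) = a * (b * c) by ring, show c * (a * b) = a * (b * c) by ring]
      have : tm (a * (b * c)) (P.br U f (P.br U g h) + P.br U g (P.br U h f) +
          P.br U h (P.br U f g)) = (0 : Fn (PoissonBundles.baseChange R A) U) := by
        rw [P.jacobi]
        exact TensorProduct.tmul_zero _ _
      rw [← this]
      have hadd : ∀ (d : A) (x y : Fn R U),
          (tm d (x + y) : Fn (PoissonBundles.baseChange R A) U) = tm d x + tm d y :=
        fun d x y => TensorProduct.tmul_add d x y
      rw [hadd, hadd]
  res_br hVU f g := by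
    induction f using Fn.induction with
    | h0 => simp
    | ha x y hx hy => simp only [map_add, LinearMap.add_apply, hx, hy]
    | ht a f =>
      induction g using Fn.induction with
      | h0 => simp
      | ha x y hx hy => simp only [map_add, hx, hy]
      | ht b g => simp only [bracketBaseChange_tm, res_tm, P.res_br]

/-- Restriction of functions along the closed immersion `Spec A → Spec B` given by `B → A`. -/
def reduce {B A : Type u} [CommRing B] [Algebra k B] [CommRing A] [Algebra k A] (μ : B →ₐ[k] A)
    (U : Opens T) : Fn (baseChange R B) U →+* Fn (baseChange R A) U :=
  (Algebra.TensorProduct.map μ (AlgHom.id k (Fn R U))).toRingHom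

/-- Restriction of functions to the closed fibre given by `A → k`. -/
def specialize {A : Type u} [CommRing A] [Algebra k A] (ε : A →ₐ[k] k) (U : Opens T) :
    Fn (baseChange R A) U →+* Fn R U :=
  (Algebra.TensorProduct.lift ((Algebra.ofId k (Fn R U)).comp ε) (AlgHom.id k (Fn R U))
    fun _ _ => Commute.all _ _).toRingHom

end BaseChange

/-! ### The complex `ℋom(F,F) → T ⊗ ℋom(F,F) → ⋀² T ⊗ ℋom(F,F) → ⋯` -/

section Complex

variable {k : Type u} [CommRing k] {T : TopCat.{u}} {R : AlgPresheaf k T}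

/-- Families of operations taking `p` functions and a section of `M` to a section of `M`, over
all open subsets of `U`. -/
abbrev Op (M : PMod R) (p : ℕ) (U : Opens T) : Type u :=
  ∀ V : Set.Iic U, (Fin p → Fn R V.1) → Sec M V.1 → Sec M V.1

/-- Restriction of operations. -/
def Op.restrict {M : PMod R} {p : ℕ} {V U : Opens T} (h : V ≤ U) : Op M p U →+ Op M p V where
  toFun D := fun W => D ⟨W.1, W.2.trans h⟩
  map_zero' := rfl
  map_add' _ _ := rfl

/-- `D` is a section over `U` of `ℋom(⋀ᵖ Ω¹, ℋom(M, M))`, which is `⋀ᵖ T ⊗ ℋom(M, M)` in the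
smooth case: it is `R`-linear in the section of `M`, an alternating `k`-linear multiderivation in
the functions, and commutes with restriction. -/
structure IsPolyvector {M : PMod R} {p : ℕ} {U : Opens T} (D : Op M p U) : Prop where
  map_add : ∀ V f m n, D V f (m + n) = D V f m + D V f n
  map_smul : ∀ V f (g : Fn R V.1) m, D V f (g • m) = g • D V f m
  add : ∀ V (f : Fin p → Fn R V.1) i a b m, D V (Function.update f i (a + b)) m =
    D V (Function.update f i a) m + D V (Function.update f i b) m
  smul : ∀ V (f : Fin p → Fn R V.1) i (c : k) a m, D V (Function.update f i (c • a)) m =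
    c • D V (Function.update f i a) m
  mul : ∀ V (f : Fin p → Fn R V.1) i a b m, D V (Function.update f i (a * b)) m =
    a • D V (Function.update f i b) m + b • D V (Function.update f i a) m
  alt : ∀ V (f : Fin p → Fn R V.1) i j m, i ≠ j → f i = f j → D V f m = 0
  res : ∀ {W V : Set.Iic U} (hWV : W.1 ≤ V.1) f m,
    Sec.res hWV (D V f m) = D W (fun i => Fn.res hWV (f i)) (Sec.res hWV m)

/-- The group of sections over `U` of `⋀ᵖ T ⊗ ℋom(M, M)`. -/
def polyvectors (M : PMod R) (p : ℕ) (U : Opens T) : AddSubgroup (Op M p U) where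
  carrier := {D | IsPolyvector D}
  zero_mem' := by constructor <;> intros <;> simp
  add_mem' {D D'} hD hD' := by
    constructor
    · intro V f m n
      simp only [Pi.add_apply, hD.map_add, hD'.map_add]; abel
    · intro V f g m
      simp only [Pi.add_apply, hD.map_smul, hD'.map_smul, smul_add]
    · intro V f i a b m
      simp only [Pi.add_apply, hD.add, hD'.add]; abel
    · intro V f i c a m
      simp only [Pi.add_apply, hD.smul, hD'.smul, smul_add]
    · intro V f i a b m
      simp only [Pi.add_apply, hD.mul, hD'.mul, smul_add]; abel
    · intro V f i j m hij hf
      simp only [Pi.add_apply, hD.alt V f i j m hij hf, hD'.alt V f i j m hij hf, add_zero]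
    · intro W V hWV f m
      simp only [Pi.add_apply, _root_.map_add, hD.res, hD'.res]
  neg_mem' {D} hD := by
    constructor
    · intro V f m n
      simp only [Pi.neg_apply, hD.map_add]; abel
    · intro V f g m
      simp only [Pi.neg_apply, hD.map_smul, smul_neg]
    · intro V f i a b m
      simp only [Pi.neg_apply, hD.add]; abel
    · intro V f i c a m
      simp only [Pi.neg_apply, hD.smul, smul_neg]
    · intro V f i a b m
      simp only [Pi.neg_apply, hD.mul, smul_neg]; abel
    · intro V f i j m hij hf
      simp only [Pi.neg_apply, hD.alt V f i j m hij hf, neg_zero]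
    · intro W V hWV f m
      simp only [Pi.neg_apply, _root_.map_neg, hD.res]

variable {P : PoissonStructure R} (E : PoissonBundle P)

/-- The induced Poisson connection on `ℋom(F, F)`: `{f, φ}(m) = {f, φ(m)} - φ({f, m})`. -/
def homConn {V : Opens T} (f : Fn R V) (φ : Sec E.M V → Sec E.M V) (m : Sec E.M V) : Sec E.M V :=
  E.conn V f (φ m) - φ (E.conn V f m)

/-- The differential `⋀ᵖ T ⊗ ℋom(F, F) → ⋀ᵖ⁺¹ T ⊗ ℋom(F, F)` induced by the flat Poisson
connection on `ℋom(F, F)`; in degrees `0` and `1` it is `D ↦ (f ↦ {f, D})` and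
`D ↦ ((f, g) ↦ {f, D(g)} - {g, D(f)} - D({f, g}))`. In the second sum, `{fᵢ, fⱼ}` is put in the
place of `fᵢ` and `fⱼ` is deleted, which accounts for the sign. -/
def dPoisson (p : ℕ) (U : Opens T) : Op E.M p U →+ Op E.M (p + 1) U where
  toFun D := fun V f m =>
    (∑ i : Fin (p + 1), (-1 : ℤ) ^ (i : ℕ) • homConn E (f i) (D V (i.removeNth f)) m) +
    ∑ j : Fin (p + 1), ∑ i : Fin p, if i.castSucc < j then
      (-1 : ℤ) ^ (j : ℕ) •
        D V (Function.update (j.removeNth f) i (P.br V.1 (f i.castSucc) (f j))) m else 0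
  map_zero' := by
    funext V f m
    simp [homConn]
  map_add' D D' := by
    funext V f m
    have h1 : ∀ (a : Fn R V.1) (φ ψ : Sec E.M V.1 → Sec E.M V.1),
        homConn E a (φ + ψ) m = homConn E a φ m + homConn E a ψ m := by
      intro a φ ψ
      simp only [homConn, Pi.add_apply, map_add]
      abel
    simp only [Pi.add_apply, h1, smul_add, Finset.sum_add_distrib, ite_add_zero]
    abel

/-! ### Čech hypercohomology -/

variable {ι : Type u} (𝒰 : ι → Opens T)

/-- The intersection `U_{s 0} ∩ ⋯ ∩ U_{s q}`. -/
def inter {q : ℕ} (s : Fin (q + 1) → ι) : Opens T := ⨅ i, 𝒰 (s i)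

lemma inter_le {q : ℕ} (s : Fin (q + 1) → ι) (i : Fin (q + 1)) : inter 𝒰 s ≤ 𝒰 (s i) :=
  iInf_le _ i

lemma inter_le_face {q : ℕ} (s : Fin (q + 2) → ι) (i : Fin (q + 2)) :
    inter 𝒰 s ≤ inter 𝒰 (i.removeNth s) :=
  le_iInf fun j => iInf_le _ (i.succAbove j)

/-- Families indexed by `p` and `q` of Čech `q`-cochains of operations with `p` functions. -/
abbrev Cochains : Type u := ∀ (p q : ℕ) (s : Fin (q + 1) → ι), Op E.M p (inter 𝒰 s)

/-- The Čech differential. -/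
def cech (p q : ℕ) : (∀ s : Fin (q + 1) → ι, Op E.M p (inter 𝒰 s)) →+
    ∀ s : Fin (q + 2) → ι, Op E.M p (inter 𝒰 s) where
  toFun c := fun s => ∑ i : Fin (q + 2),
    (-1 : ℤ) ^ (i : ℕ) • Op.restrict (inter_le_face 𝒰 s i) (c (i.removeNth s))
  map_zero' := by funext s; simp
  map_add' c d := by
    funext s
    simp only [Pi.add_apply, map_add, smul_add, Finset.sum_add_distrib]

/-- The component of the total differential that comes from the Poisson connection. -/
def vertical (c : Cochains E 𝒰) : Cochains E 𝒰
  | 0, _ => 0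
  | p + 1, q => fun s => dPoisson E p _ (c p q s)

/-- The component of the total differential that comes from the Čech differential `δ`; it is
`(-1)ⁿ⁺¹ δ` on total degree `n`. -/
def horizontal (c : Cochains E 𝒰) : Cochains E 𝒰
  | _, 0 => 0
  | p, q + 1 => (-1 : ℤ) ^ (p + q + 1) • cech E 𝒰 p q (c p q)

/-- The differential of the total complex. -/
def dTotal : Cochains E 𝒰 →+ Cochains E 𝒰 :=
  AddMonoidHom.mk' (fun c => vertical E 𝒰 c + horizontal E 𝒰 c) fun c d => by
    funext p q s
    rcases p with _ | p <;> rcases q with _ | q <;>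
      simp only [vertical, horizontal, Pi.add_apply, map_add, smul_add, Pi.zero_apply, add_zero,
        zero_add] <;> abel

/-- Total Čech cochains of degree `n` with values in `ℋom(F, F)^•`: the elements of the product of
the groups `Č^q(𝒰, ⋀ᵖ T ⊗ ℋom(F, F))` with `p + q = n`. -/
def total (n : ℤ) : AddSubgroup (Cochains E 𝒰) where
  carrier := {c | (∀ p q s, c p q s ∈ polyvectors E.M p (inter 𝒰 s)) ∧
    ∀ p q : ℕ, (p + q : ℤ) ≠ n → c p q = 0}
  zero_mem' := ⟨fun _ _ _ => zero_mem _, fun _ _ _ => rfl⟩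
  add_mem' ha hb := ⟨fun p q s => add_mem (ha.1 p q s) (hb.1 p q s), fun p q h => by
    rw [Pi.add_apply, Pi.add_apply, ha.2 p q h, hb.2 p q h, add_zero]⟩
  neg_mem' ha := ⟨fun p q s => neg_mem (ha.1 p q s), fun p q h => by
    rw [Pi.neg_apply, Pi.neg_apply, ha.2 p q h, neg_zero]⟩

/-- Total cocycles of degree `n`. -/
def cocycles (n : ℤ) : AddSubgroup (Cochains E 𝒰) := total E 𝒰 n ⊓ (dTotal E 𝒰).ker

/-- Total coboundaries of degree `n`. -/
def coboundaries (n : ℤ) : AddSubgroup (Cochains E 𝒰) := (total E 𝒰 (n - 1)).map (dTotal E 𝒰)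

/-- The hypercohomology group `ℍⁿ(X, ℋom(F, F)^•)`, computed by the total Čech complex of `𝒰`. -/
abbrev HH (n : ℤ) : Type u :=
  cocycles E 𝒰 n ⧸ (coboundaries E 𝒰 n).addSubgroupOf (cocycles E 𝒰 n)

/-- The class of a total cocycle. -/
def HH.mk {n : ℤ} (c : cocycles E 𝒰 n) : HH E 𝒰 n := QuotientAddGroup.mk c

end Complex

/-! ### Deformations -/

section Deformations

/-- A morphism exhibiting the Poisson vector bundle `E` as the restriction `E' ⊗_{R'} R` of `E'`
along the surjective homomorphism of sheaves of rings `φ : R' → R` on the same space: it is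
semilinear, compatible with the connections, surjective as a map of sheaves, and its kernel is the
subsheaf `ker(φ) E'`. -/
structure Restriction {S S' : Type u} [CommRing S] [CommRing S'] {T : TopCat.{u}}
    {R : AlgPresheaf S T} {R' : AlgPresheaf S' T} {P : PoissonStructure R}
    {P' : PoissonStructure R'} (φ : ∀ U, Fn R' U →+* Fn R U) (E' : PoissonBundle P')
    (E : PoissonBundle P) where
  hom (U : Opens T) : Sec E'.M U →+ Sec E.M U
  hom_smul : ∀ U f m, hom U (f • m) = φ U f • hom U m
  res_hom : ∀ {V U : Opens T} (h : V ≤ U) m, Sec.res h (hom U m) = hom V (Sec.res h m)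
  hom_conn : ∀ U f m, hom U (E'.conn U f m) = E.conn U (φ U f) (hom U m)
  surj : ∀ U (m : Sec E.M U), ∀ x ∈ U, ∃ (V : Opens T) (h : V ≤ U) (m' : Sec E'.M V),
    x ∈ V ∧ hom V m' = Sec.res h m
  ker : ∀ U (m : Sec E'.M U), hom U m = 0 → ∀ x ∈ U, ∃ (V : Opens T) (h : V ≤ U), x ∈ V ∧
    Sec.res h m ∈ RingHom.ker (φ V) • (⊤ : Submodule (Fn R' V) (Sec E'.M V))

variable {k : Type u} [CommRing k] {T : TopCat.{u}} {R : AlgPresheaf k T}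
  {P : PoissonStructure R} (E : PoissonBundle P)
  {A : Type u} [CommRing A] [Algebra k A]

/-- A deformation of the Poisson vector bundle `E` over `A`, where `ε : A → k` is the residue map:
a Poisson vector bundle over `A` on the product with `Spec A`, with an identification of its
restriction to the closed fibre with `E`. -/
structure Deformation (ε : A →ₐ[k] k) where
  bundle : PoissonBundle (P.baseChange A)
  restr : Restriction (specialize ε) bundle E

variable {E} {ε : A →ₐ[k] k}

/-- `D` and `D'` are isomorphic deformations: there is an isomorphism of Poisson modules that
induces the identity on `E`. -/
def Deformation.IsIso (D D' : Deformation E ε) : Prop :=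
  ∃ e : D.bundle.M ≅ D'.bundle.M,
    (∀ U f (m : Sec D.bundle.M U), (e.hom.app (op U)).hom (D.bundle.conn U f m) =
      D'.bundle.conn U f ((e.hom.app (op U)).hom m)) ∧
    ∀ U (m : Sec D.bundle.M U), D'.restr.hom U ((e.hom.app (op U)).hom m) = D.restr.hom U m

variable (E ε) in
/-- Isomorphism of deformations is an equivalence relation. -/
def Deformation.setoid : Setoid (Deformation E ε) where
  r := Deformation.IsIso
  iseqv := by
    refine ⟨fun D => ⟨Iso.refl _, fun _ _ _ => rfl, fun _ _ => rfl⟩, ?_, ?_⟩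
    · rintro D D' ⟨e, h1, h2⟩
      have hr : ∀ U (m : Sec D'.bundle.M U),
          (e.hom.app (op U)).hom ((e.inv.app (op U)).hom m) = m := fun U m =>
        congr(($(e.inv_hom_id).app (op U)).hom m)
      have hl : ∀ U (m : Sec D.bundle.M U),
          (e.inv.app (op U)).hom ((e.hom.app (op U)).hom m) = m := fun U m =>
        congr(($(e.hom_inv_id).app (op U)).hom m)
      refine ⟨e.symm, fun U f m => ?_, fun U m => ?_⟩
      · have := h1 U f ((e.inv.app (op U)).hom m)
        rw [hr] at this
        exact (congrArg (e.inv.app (op U)).hom this.symm).trans (hl U _)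
      · have := h2 U ((e.inv.app (op U)).hom m)
        rw [hr] at this
        exact this.symm
    · rintro D D' D'' ⟨e, h1, h2⟩ ⟨e', h1', h2'⟩
      refine ⟨e ≪≫ e', fun U f m => ?_, fun U m => ?_⟩
      · exact (congrArg (e'.hom.app (op U)).hom (h1 U f m)).trans (h1' U f _)
      · exact (h2' U _).trans (h2 U m)

variable (E ε) in
/-- The set `Def_{(F, ∇)}(A)` of isomorphism classes of deformations. -/
def Def : Type (u + 1) := Quotient (Deformation.setoid E ε)

/-- The isomorphism class of a deformation. -/
def Deformation.cls (D : Deformation E ε) : Def E ε := Quotient.mk _ D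

/-- A lifting of the deformation `D` over `A` along `μ : B → A`: a deformation over `B` with an
identification of its restriction to `A` with `D`, as deformations. -/
structure Lifting {B : Type u} [CommRing B] [Algebra k B] (μ : B →ₐ[k] A)
    (D : Deformation E ε) where
  deformation : Deformation E (ε.comp μ)
  restr : Restriction (reduce μ) deformation.bundle D.bundle
  restr_comp : ∀ U (m : Sec deformation.bundle.M U),
    D.restr.hom U (restr.hom U m) = deformation.restr.hom U m

/-- `0 → (t) → B → A → 0` is a small extension. -/
structure IsSmallExtension {B : Type u} [CommRing B] [IsLocalRing B] [Algebra k B] (μ : B →ₐ[k] A)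
    (t : B) : Prop where
  surjective : Function.Surjective μ
  ker : RingHom.ker μ = Ideal.span {t}
  ne_zero : t ≠ 0
  mem : t ∈ IsLocalRing.maximalIdeal B
  mul_eq_zero : ∀ x ∈ IsLocalRing.maximalIdeal B, t * x = 0

/-! ### Čech description of deformations -/

/-- A trivialization over `U` of the deformation of modules underlying `D`: an isomorphism of the
constant deformation `F ⊗ A` with `D` over `U` that induces the identity on `F`. -/
structure LocalTriv (D : Deformation E ε) (U : Opens T) where
  equiv (V : Opens T) (h : V ≤ U) : A ⊗[k] Sec E.M V ≃+ Sec D.bundle.M V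
  equiv_smul : ∀ V h (a b : A) (f : Fn R V) m,
    equiv V h ((a * b) ⊗ₜ (f • m)) = (tm a f : Fn (baseChange R A) V) • equiv V h (b ⊗ₜ m)
  res_equiv : ∀ {W V : Opens T} (hWV : W ≤ V) (h : V ≤ U) (a : A) m,
    Sec.res hWV (equiv V h (a ⊗ₜ m)) = equiv W (hWV.trans h) (a ⊗ₜ Sec.res hWV m)
  restr_equiv : ∀ V h a m, D.restr.hom V (equiv V h (a ⊗ₜ m)) = ε a • m

variable {ι : Type u} {𝒰 : ι → Opens T}

open scoped DualNumber in
/-- Let `D` be a first-order deformation, with trivializations `φ α` over the `U_α`. The total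
`1`-cochain `c` is `({-W_α}, {G_αβ})`, where the transition functions of `D` are `1 + ε G_αβ`
and its connection is `∇ + ε W_α` on `U_α`. -/
structure IsFirstOrderCochain (D : Deformation E (TrivSqZeroExt.fstHom k k k))
    (φ : ∀ α, LocalTriv D (𝒰 α)) (c : Cochains E 𝒰) : Prop where
  conn : ∀ (s : Fin 1 → ι) (V : Opens T) (h : V ≤ inter 𝒰 s) (f : Fn R V) (m : Sec E.M V),
    D.bundle.conn V (tm 1 f)
        ((φ (s 0)).equiv V (h.trans (inter_le 𝒰 s 0)) ((1 : k[ε]) ⊗ₜ m)) =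
      (φ (s 0)).equiv V (h.trans (inter_le 𝒰 s 0))
        ((1 : k[ε]) ⊗ₜ E.conn V f m + DualNumber.eps ⊗ₜ (- c 1 0 s ⟨V, h⟩ ![f] m))
  trans : ∀ (s : Fin 2 → ι) (V : Opens T) (h : V ≤ inter 𝒰 s) (m : Sec E.M V),
    (φ (s 1)).equiv V (h.trans (inter_le 𝒰 s 1)) ((1 : k[ε]) ⊗ₜ m) =
      (φ (s 0)).equiv V (h.trans (inter_le 𝒰 s 0))
        ((1 : k[ε]) ⊗ₜ m + DualNumber.eps ⊗ₜ c 0 1 s ⟨V, h⟩ ![] m)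

/-- Multiplication by a function on `B ⊗ F`. -/
def act (B : Type u) [CommRing B] [Algebra k B] {M : PMod R} {V : Opens T} (g : Fn R V) :
    Module.End B (B ⊗[k] Sec M V) :=
  LinearMap.baseChange B (Algebra.lsmul k k (Sec M V) g)

/-- Restriction of sections of `B ⊗ F`. -/
def resB (B : Type u) [CommRing B] [Algebra k B] {M : PMod R} {W V : Opens T} (h : W ≤ V) :
    B ⊗[k] Sec M V →ₗ[B] B ⊗[k] Sec M W :=
  LinearMap.baseChange B (Sec.res h)

/-- An arbitrary collection of local data over `B` lifting the deformation `D` over `A` along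
`μ : B → A`. Fix trivializations of `D` over the `U_α`, so that `D` is given by transition
functions and by Poisson connections on the `F|_{U_α} ⊗ A`. The data are Poisson connections `conn`
on the `F|_{U_α} ⊗ B`, not necessarily flat, and endomorphisms `trans` of the
`F|_{U_α ∩ U_β} ⊗ B`, which lift the connections and transition functions of `D`. -/
structure LocalLift {B : Type u} [CommRing B] [Algebra k B] (μ : B →ₐ[k] A) (D : Deformation E ε)
    (𝒰 : ι → Opens T) where
  triv (α : ι) : LocalTriv D (𝒰 α)
  conn (α : ι) (V : Opens T) (h : V ≤ 𝒰 α) : Fn R V →ₗ[k] Module.End B (B ⊗[k] Sec E.M V)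
  conn_mul : ∀ α V h f g, conn α V h (f * g) = act B f * conn α V h g + act B g * conn α V h f
  conn_act : ∀ α V h f g,
    conn α V h f * act B g = act B (P.br V f g) + act B g * conn α V h f
  res_conn : ∀ α {W V : Opens T} (hWV : W ≤ V) h f x,
    resB B hWV (conn α V h f x) = conn α W (hWV.trans h) (Fn.res hWV f) (resB B hWV x)
  conn_reduce : ∀ α V h f x,
    (triv α).equiv V h (LinearMap.rTensor (Sec E.M V) μ.toLinearMap (conn α V h f x)) =
      D.bundle.conn V (tm 1 f)
        ((triv α).equiv V h (LinearMap.rTensor (Sec E.M V) μ.toLinearMap x))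
  trans (α β : ι) (V : Opens T) (hα : V ≤ 𝒰 α) (hβ : V ≤ 𝒰 β) : Module.End B (B ⊗[k] Sec E.M V)
  trans_act : ∀ α β V hα hβ g, trans α β V hα hβ * act B g = act B g * trans α β V hα hβ
  res_trans : ∀ α β {W V : Opens T} (hWV : W ≤ V) hα hβ x,
    resB B hWV (trans α β V hα hβ x) =
      trans α β W (hWV.trans hα) (hWV.trans hβ) (resB B hWV x)
  trans_reduce : ∀ α β V hα hβ x,
    (triv α).equiv V hα (LinearMap.rTensor (Sec E.M V) μ.toLinearMap (trans α β V hα hβ x)) =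
      (triv β).equiv V hβ (LinearMap.rTensor (Sec E.M V) μ.toLinearMap x)

/-- The total `2`-cochain `c` is the defect `({-S_α}, {Q_αβ}, {G_αβγ})` of the local lift `L`, where
`t S_α` is the curvature of the connection on `U_α`, `t Q_αβ` is the failure of the transition
function on `U_α ∩ U_β` to be compatible with the connections, and `t G_αβγ` is the failure of
the cocycle condition on `U_α ∩ U_β ∩ U_γ`. -/
structure LocalLift.IsDefect {B : Type u} [CommRing B] [Algebra k B] {μ : B →ₐ[k] A}
    {D : Deformation E ε} (L : LocalLift μ D 𝒰) (t : B) (c : Cochains E 𝒰) : Prop where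
  curvature : ∀ (s : Fin 1 → ι) (V : Opens T) (h : V ≤ inter 𝒰 s) (f g : Fn R V) (m : Sec E.M V),
    let N := L.conn (s 0) V (h.trans (inter_le 𝒰 s 0))
    N f (N g (1 ⊗ₜ m)) - N g (N f (1 ⊗ₜ m)) - N (P.br V f g) (1 ⊗ₜ m) =
      t ⊗ₜ (- c 2 0 s ⟨V, h⟩ ![f, g] m)
  compat : ∀ (s : Fin 2 → ι) (V : Opens T) (h : V ≤ inter 𝒰 s) (f : Fn R V) (m : Sec E.M V),
    let h0 := h.trans (inter_le 𝒰 s 0)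
    let h1 := h.trans (inter_le 𝒰 s 1)
    L.conn (s 0) V h0 f (L.trans (s 0) (s 1) V h0 h1 (1 ⊗ₜ m)) -
        L.trans (s 0) (s 1) V h0 h1 (L.conn (s 1) V h1 f (1 ⊗ₜ m)) =
      t ⊗ₜ c 1 1 s ⟨V, h⟩ ![f] m
  cocycle : ∀ (s : Fin 3 → ι) (V : Opens T) (h : V ≤ inter 𝒰 s) (m : Sec E.M V),
    let h0 := h.trans (inter_le 𝒰 s 0)
    let h1 := h.trans (inter_le 𝒰 s 1)
    let h2 := h.trans (inter_le 𝒰 s 2)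
    L.trans (s 0) (s 1) V h0 h1 (L.trans (s 1) (s 2) V h1 h2 (1 ⊗ₜ m)) -
        L.trans (s 0) (s 2) V h0 h2 (1 ⊗ₜ m) =
      t ⊗ₜ c 0 2 s ⟨V, h⟩ ![] m

end Deformations

end PoissonBundles
end

/-! The proof replaces deformations by descent data and then does linear algebra modulo a small
ideal.

Over an affine open set an infinitesimal deformation `D` of the module `F` is trivial. The
restriction map from `D` to `F` is a locally split surjection of locally free sheaves over the
functions on `X`. Over an affine set the local splittings can be extended after multiplication by
powers of functions and averaged by a partition of unity (`AffineBasis.IsLoc.exists_splitting`). A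
splitting induces a map from `F ⊗ A` to `D` which is bijective by Nakayama's lemma, because the
kernel of `A → k` is nilpotent (`Deformation.bijective_splitMap`). Hence a deformation amounts to
connections on the `F|_{U_α} ⊗ A` and transition functions (`LocData`) that satisfy three equations:
flatness, compatibility of transitions with connections, and the cocycle condition
(`LocData.IsStrict`). Conversely, such data glue to a deformation, provided that `F_αα = 1`
(`LocData.exists_deformation`).

Let `0 → (t) → B → A → 0` be small. The kernel of `F ⊗ B → F ⊗ A` is `t ⊗ F`, and on it every lifted
connection acts as `∇` and every lifted transition function as the identity (`IsConnOn.apply_tmul`,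
`IsHomOn.apply_tmul`). An operator that is linear over functions and vanishes on `F ⊗ A` is
therefore `t` times an operator on `F`; if it is an alternating multiderivation in its arguments, it
is a polyvector with values in `End F` (`exists_polyvector`). Thus the failure of the three
equations for local lifts of the data is a total `2`-cochain, the defect.

Two computations carry the theorem. The defect is a cocycle, by the Bianchi identity and the
associativity of composition (`LocData.IsDefect.mem_cocycles`). If endomorphisms `θ_α` fail to
intertwine local data `L'` and `L` by `t` times a `1`-cochain `b`, then `db` is the difference of
the defects (`LocData.IsGauge.dTotal_eq`). With `θ` a lift of a change of trivialization, this shows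
that the class of the defect is independent of all choices. With `θ = 1`, it shows that a
perturbation by `b` changes the defect by `db`, so the data can be made strict exactly if the class
is zero (`exists_obstruction`).

For first-order deformations the small extension is `k[ε] → k`. Every collection of data differs
from the constant data by a `1`-cochain, which is closed because both defects vanish. A change of
trivialization has the form `1 + ε H` and alters the cochain by `dH`. Perturbation of the constant
data realizes every cocycle (`exists_classification`). -/

noncomputable section

namespace PoissonBundles

/-! ### Gluing of sections and of maps -/

section Gluing

variable {T : TopCat.{u}}

/-- The presheaf of sets `G` with restriction maps `r` is a sheaf. -/
structure IsSheafOn (G : Opens T → Type u) (r : ∀ V U, V ≤ U → G U → G V) : Prop where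
  res_self : ∀ U x, r U U le_rfl x = x
  res_res : ∀ {W V U : Opens T} (h : W ≤ V) (h' : V ≤ U) x,
    r W V h (r V U h' x) = r W U (h.trans h') x
  eq_of_locally : ∀ {U : Opens T} (x y : G U),
    (∀ p ∈ U, ∃ (V : Opens T) (h : V ≤ U), p ∈ V ∧ r V U h x = r V U h y) → x = y
  glue : ∀ {ι : Type u} (V : ι → Opens T) (U : Opens T) (hV : ∀ i, V i ≤ U) (_ : U ≤ iSup V)
    (x : ∀ i, G (V i)), (∀ i j W (hi : W ≤ V i) (hj : W ≤ V j),
      r W (V i) hi (x i) = r W (V j) hj (x j)) → ∃ y : G U, ∀ i, r (V i) U (hV i) y = x i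

lemma exists_mem_of_le_iSup {ι : Type*} {V : ι → Opens T} {U : Opens T} (h : U ≤ iSup V) {p : T}
    (hp : p ∈ U) : ∃ i, p ∈ V i :=
  Opens.mem_iSup.mp (h hp)

/-- Two sections that agree on a cover are equal. -/
lemma IsSheafOn.eq_of_cover {G : Opens T → Type u} {r : ∀ V U, V ≤ U → G U → G V}
    (hG : IsSheafOn G r) {ι : Type*} {V : ι → Opens T} {U : Opens T} (h : U ≤ iSup V) {x y : G U}
    (hxy : ∀ i W (hW : W ≤ U), W ≤ V i → r W U hW x = r W U hW y) : x = y := by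
  refine hG.eq_of_locally x y fun p hp => ?_
  obtain ⟨i, hi⟩ := exists_mem_of_le_iSup h hp
  exact ⟨U ⊓ V i, inf_le_left, ⟨hp, hi⟩, hxy i _ _ inf_le_right⟩

/-- Morphisms into a sheaf glue. -/
lemma IsSheafOn.exists_glued_map {G G' : Opens T → Type u} {r : ∀ V U, V ≤ U → G U → G V}
    {r' : ∀ V U, V ≤ U → G' U → G' V} (hG' : IsSheafOn G' r')
    (hrr : ∀ {W V U : Opens T} (h : W ≤ V) (h' : V ≤ U) x,
      r W V h (r V U h' x) = r W U (h.trans h') x)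
    {ι : Type u} {𝒰 : ι → Opens T} {U : Opens T} (hU : U ≤ iSup 𝒰)
    (σ : ∀ i V, V ≤ 𝒰 i → G V → G' V)
    (hσ : ∀ i {W V : Opens T} (hWV : W ≤ V) (hV : V ≤ 𝒰 i) x,
      r' W V hWV (σ i V hV x) = σ i W (hWV.trans hV) (r W V hWV x))
    (hagree : ∀ i j V (hi : V ≤ 𝒰 i) (hj : V ≤ 𝒰 j) x, σ i V hi x = σ j V hj x) :
    ∃ τ : ∀ V, V ≤ U → G V → G' V,
      (∀ {W V : Opens T} (hWV : W ≤ V) (hV : V ≤ U) x,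
        r' W V hWV (τ V hV x) = τ W (hWV.trans hV) (r W V hWV x)) ∧
      ∀ i V (hi : V ≤ 𝒰 i) (hV : V ≤ U) x, τ V hV x = σ i V hi x := by
  -- The glued value is characterized by its restrictions to all small open sets, not only to the
  -- members of the cover. Compatibility with restriction can then be read off locally.
  have key : ∀ V (_ : V ≤ U) (x : G V), ∃ y : G' V, ∀ i W (hW : W ≤ V) (hi : W ≤ 𝒰 i),
      r' W V hW y = σ i W hi (r W V hW x) := by
    intro V hV x
    obtain ⟨y, hy⟩ := hG'.glue (fun i => V ⊓ 𝒰 i) V (fun i => inf_le_left)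
      (by rw [← inf_iSup_eq]; exact le_inf le_rfl (hV.trans hU))
      (fun i => σ i _ inf_le_right (r _ V inf_le_left x)) (fun i j W hi hj => by
        rw [hσ, hσ, hrr, hrr]; exact hagree _ _ _ _ _ _)
    refine ⟨y, fun i W hW hi => ?_⟩
    have := congrArg (r' W _ (le_inf hW hi)) (hy i)
    rwa [hG'.res_res, hσ, hrr] at this
  choose τ hτ using key
  refine ⟨τ, fun {W V} hWV hV x => ?_, fun i V hi hV x => ?_⟩
  · refine hG'.eq_of_cover ((hWV.trans hV).trans hU) fun i W' hW' hi => ?_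
    rw [hG'.res_res, hτ V hV x i _ (hW'.trans hWV) hi, hτ W (hWV.trans hV) _ i _ hW' hi, hrr]
  · refine hG'.eq_of_cover (hV.trans hU) fun j W hW hj => ?_
    rw [hτ V hV x j W hW hj, hσ]
    exact hagree _ _ _ _ _ _

/-- A morphism of sheaves that is locally bijective is bijective. -/
lemma IsSheafOn.bijective_of_locally {G G' : Opens T → Type u} {r : ∀ V U, V ≤ U → G U → G V}
    {r' : ∀ V U, V ≤ U → G' U → G' V} (hG : IsSheafOn G r) (hG' : IsSheafOn G' r') {U : Opens T}
    (τ : ∀ V, V ≤ U → G V → G' V)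
    (hτ : ∀ {W V : Opens T} (hWV : W ≤ V) (hV : V ≤ U) x,
        r' W V hWV (τ V hV x) = τ W (hWV.trans hV) (r W V hWV x))
    (hloc : ∀ p ∈ U, ∃ W, p ∈ W ∧ ∀ V (hV : V ≤ U), V ≤ W → Function.Bijective (τ V hV))
    (V : Opens T) (hV : V ≤ U) : Function.Bijective (τ V hV) := by
  -- Injectivity on all open sets has to come first: it forces the local preimages of a section to
  -- agree on overlaps, so that they glue.
  have inj : ∀ V (hV : V ≤ U), Function.Injective (τ V hV) := by
    intro V hV x y hxy
    refine hG.eq_of_locally x y fun p hp => ?_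
    obtain ⟨W, hpW, hW⟩ := hloc p (hV hp)
    refine ⟨V ⊓ W, inf_le_left, ⟨hp, hpW⟩, (hW _ (inf_le_left.trans hV) inf_le_right).1 ?_⟩
    rw [← hτ inf_le_left hV, ← hτ inf_le_left hV, hxy]
  refine ⟨inj V hV, fun y => ?_⟩
  choose! W hpW hW using hloc
  have key : ∀ p : V, ∃ x : G (V ⊓ W p), τ (V ⊓ W p) (inf_le_left.trans hV) x =
      r' _ _ inf_le_left y := fun p =>
    (hW p (hV p.2) _ (inf_le_left.trans hV) inf_le_right).2 _
  choose x hx using key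
  obtain ⟨z, hz⟩ := hG.glue (fun p : V => V ⊓ W p) V (fun _ => inf_le_left)
    (fun p hp => Opens.mem_iSup.mpr ⟨⟨p, hp⟩, hp, hpW p (hV hp)⟩) x (fun p q W' hp hq =>
      inj W' ((hp.trans inf_le_left).trans hV) (by
        rw [← hτ hp (inf_le_left.trans hV), ← hτ hq (inf_le_left.trans hV), hx, hx,
          hG'.res_res, hG'.res_res]))
  refine ⟨z, hG'.eq_of_cover (V := fun p : V => V ⊓ W p)
    (fun p hp => Opens.mem_iSup.mpr ⟨⟨p, hp⟩, hp, hpW p (hV hp)⟩) fun p W' hW' hp => ?_⟩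
  rw [hτ, ← hG.res_res hp inf_le_left, hz, ← hτ hp (inf_le_left.trans hV), hx, hG'.res_res]

end Gluing

/-! ### Presheaves of modules from families of sections -/

section PMod

variable {S : Type u} [CommRing S] {T : TopCat.{u}} {R : AlgPresheaf S T}

lemma Fn.res_self {U : Opens T} (x : Fn R U) : Fn.res (le_refl U) x = x :=
  congr(($(R.map_id (op U))).hom x)

lemma Fn.res_res {W V U : Opens T} (h : W ≤ V) (h' : V ≤ U) (x : Fn R U) :
    Fn.res h (Fn.res h' x) = Fn.res (h.trans h') x :=
  congr(($(R.map_comp (homOfLE h').op (homOfLE h).op)).hom x).symm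

namespace Sec

variable (M : PMod R)

lemma res_smul {V U : Opens T} (h : V ≤ U) (g : Fn R U) (m : Sec M U) :
    Sec.res h (g • m) = Fn.res h g • Sec.res h m :=
  map_smul_aux M h g m

lemma res_self {U : Opens T} (m : Sec M U) : Sec.res (le_refl U) m = m := by
  have := congr(($(M.map_id (op U))).hom m)
  exact this

lemma res_res {W V U : Opens T} (h : W ≤ V) (h' : V ≤ U) (m : Sec M U) :
    Sec.res h (Sec.res h' m) = Sec.res (h.trans h') m :=
  (M.map_comp_apply (homOfLE h').op (homOfLE h).op m).symm

end Sec

/-- Sections of a sheaf of modules form a sheaf. -/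
lemma isSheafOn_sec {M : PMod R} (hM : TopCat.Presheaf.IsSheaf M.presheaf) :
    IsSheafOn (Sec M) (fun _ _ h => Sec.res h) where
  res_self U x := Sec.res_self M x
  res_res h h' x := Sec.res_res M h h' x
  eq_of_locally {U} x y hxy := by
    choose! V hV hp h using hxy
    refine TopCat.Sheaf.eq_of_locally_eq' (F := (⟨M.presheaf, hM⟩ : TopCat.Sheaf AddCommGrpCat T))
      (fun p : U => V p) U (fun p => homOfLE (hV p p.2)) (fun p hp' => ?_) x y ?_
    · exact Opens.mem_iSup.mpr ⟨⟨p, hp'⟩, hp p hp'⟩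
    · exact fun p => h p p.2
  glue {ι} V U hV hU x hx := by
    obtain ⟨y, hy, -⟩ := TopCat.Sheaf.existsUnique_gluing'
      (F := (⟨M.presheaf, hM⟩ : TopCat.Sheaf AddCommGrpCat T)) V U (fun i => homOfLE (hV i)) hU x
      (fun i j => hx i j _ _ _)
    exact ⟨y, hy⟩

/-- The presheaf of modules with given sections and restriction maps. -/
def pmodMk (G : Opens T → Type u) [∀ U, AddCommGroup (G U)] [∀ U, Module (Fn R U) (G U)]
    (r : ∀ V U, V ≤ U → G U →+ G V) (hsmul : ∀ V U (h : V ≤ U) (f : Fn R U) (m : G U),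
      r V U h (f • m) = Fn.res h f • r V U h m) (hself : ∀ U x, r U U le_rfl x = x)
    (hres : ∀ W V U (h : W ≤ V) (h' : V ≤ U) x, r W V h (r V U h' x) = r W U (h.trans h') x) :
    PMod R where
  obj U := @ModuleCat.of (Fn R U.unop) _ (G U.unop) _ _
  map {U V} i :=
    letI := Module.compHom (G V.unop) (Fn.res (R := R) (leOfHom i.unop)).toRingHom
    ModuleCat.ofHom (X := G U.unop) (Y := G V.unop) (R := Fn R U.unop)
    { toFun := r V.unop U.unop (leOfHom i.unop)
      map_add' := (r V.unop U.unop (leOfHom i.unop)).map_add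
      map_smul' := fun f m => hsmul V.unop U.unop (leOfHom i.unop) f m }
  map_id U := ConcreteCategory.hom_ext _ _ fun x => hself U.unop x
  map_comp {U V W} i j := ConcreteCategory.hom_ext _ _ fun x =>
    (hres W.unop V.unop U.unop (leOfHom j.unop) (leOfHom i.unop) x).symm

/-- A presheaf of modules whose sections satisfy the sheaf axioms is a sheaf. -/
lemma isSheaf_of_isSheafOn {M : PMod R} (hM : IsSheafOn (Sec M) (fun _ _ h => Sec.res h)) :
    TopCat.Presheaf.IsSheaf M.presheaf := by
  rw [TopCat.Presheaf.isSheaf_iff_isSheaf_comp (forget AddCommGrpCat)]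
  rw [TopCat.Presheaf.isSheaf_iff_isSheafUniqueGluing_types]
  intro ι V x hx
  have hx' : ∀ i j W (hi : W ≤ V i) (hj : W ≤ V j),
      Sec.res (M := M) hi (x i) = Sec.res hj (x j) := fun i j W hi hj => by
    have := congrArg (Sec.res (M := M) (le_inf hi hj)) (hx i j)
    exact (Sec.res_res M (le_inf hi hj) inf_le_left (x i)).symm.trans
      (this.trans (Sec.res_res M (le_inf hi hj) inf_le_right (x j)))
  obtain ⟨y, hy⟩ := hM.glue V (iSup V) (le_iSup V) le_rfl x hx'
  have uniq : ∀ z : Sec M (iSup V), (∀ i, Sec.res (le_iSup V i) z = x i) → z = y := by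
    intro z hz
    refine hM.eq_of_cover (U := iSup V) le_rfl fun i W hW hi => ?_
    have h1 := congrArg (Sec.res (M := M) hi) ((hz i).trans (hy i).symm)
    rwa [Sec.res_res, Sec.res_res] at h1
  exact ⟨y, hy, uniq⟩

/-- A family of bijective linear maps that is compatible with restriction is an isomorphism. -/
lemma exists_iso_of_bijective {M M' : PMod R} (e : ∀ U, Sec M U → Sec M' U)
    (hadd : ∀ U x y, e U (x + y) = e U x + e U y)
    (hsmul : ∀ U (f : Fn R U) x, e U (f • x) = f • e U x)
    (hres : ∀ {V U : Opens T} (h : V ≤ U) x, Sec.res h (e U x) = e V (Sec.res h x))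
    (hbij : ∀ U, Function.Bijective (e U)) :
    ∃ i : M ≅ M', ∀ U x, (i.hom.app (op U)).hom x = e U x := by
  let l : ∀ U : (Opens T)ᵒᵖ, M.obj U ≃ₗ[Fn R U.unop] M'.obj U := fun U =>
    LinearEquiv.ofBijective
      { toFun := e U.unop, map_add' := hadd U.unop, map_smul' := hsmul U.unop } (hbij U.unop)
  refine ⟨PresheafOfModules.isoMk (fun U => (l U).toModuleIso) fun {U V} i => ?_, fun U x => rfl⟩
  apply ModuleCat.hom_ext
  apply LinearMap.ext
  intro x
  exact (hres (leOfHom i.unop) x).symm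

end PMod

/-! ### The sections of `F ⊗ B` -/

section Tensor

variable {k : Type u} [Field k] {T : TopCat.{u}} {R : AlgPresheaf k T} {B : Type u} [CommRing B]
  [Algebra k B] {A : Type u} [CommRing A] [Algebra k A] {M : PMod R} {V : Opens T}

/-- The action of functions on the product with `Spec B` on sections of `F ⊗ B`. -/
def actHom (B : Type u) [CommRing B] [Algebra k B] (M : PMod R) (V : Opens T) :
    Fn (baseChange R B) V →ₐ[B] Module.End B (B ⊗[k] Sec M V) :=
  Algebra.TensorProduct.lift (Algebra.ofId B (Module.End B (B ⊗[k] Sec M V)))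
    ((Module.End.baseChangeHom k B (Sec M V)).comp (Algebra.lsmul k k (Sec M V)))
    fun b _ => Algebra.commutes b _

/-- Since `(B ⊗ R) ⊗_R F = B ⊗ F`, the group `B ⊗ F(V)` serves as the sections of the constant
deformation. No sheafification is needed when `B` is finite dimensional. -/
instance tensorModule : Module (Fn (baseChange R B) V) (B ⊗[k] Sec M V) :=
  Module.compHom _ (actHom B M V).toRingHom

lemma tm_smul (b : B) (f : Fn R V) (x : B ⊗[k] Sec M V) :
    (tm b f : Fn (baseChange R B) V) • x = b • act B f x := by
  change actHom B M V (b ⊗ₜ f) x = _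
  simp only [actHom]
  rfl

@[simp]
lemma act_tmul (f : Fn R V) (b : B) (m : Sec M V) : act B f (b ⊗ₜ[k] m) = b ⊗ₜ (f • m) := rfl

@[simp]
lemma resB_tmul {W : Opens T} (h : W ≤ V) (b : B) (m : Sec M V) :
    resB B h (b ⊗ₜ[k] m) = b ⊗ₜ Sec.res h m := rfl

lemma tm_smul_tmul (b c : B) (f : Fn R V) (m : Sec M V) :
    (tm b f : Fn (baseChange R B) V) • (c ⊗ₜ[k] m) = (b * c) ⊗ₜ (f • m) := by
  rw [tm_smul, act_tmul, TensorProduct.smul_tmul', smul_eq_mul]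

lemma tm_add_left (a b : B) (f : Fn R V) :
    (tm (a + b) f : Fn (baseChange R B) V) = tm a f + tm b f := TensorProduct.add_tmul _ _ _

lemma tm_add_right (a : B) (f g : Fn R V) :
    (tm a (f + g) : Fn (baseChange R B) V) = tm a f + tm a g := TensorProduct.tmul_add _ _ _

lemma smul_tm (a b : B) (f : Fn R V) :
    a • (tm b f : Fn (baseChange R B) V) = tm (a * b) f := rfl

lemma tm_one_one : (tm 1 1 : Fn (baseChange R B) V) = 1 := rfl

lemma tm_eq_smul (b : B) (f : Fn R V) : (tm b f : Fn (baseChange R B) V) = b • tm 1 f := by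
  rw [smul_tm, mul_one]

instance : IsScalarTower B (Fn (baseChange R B) V) (B ⊗[k] Sec M V) where
  smul_assoc b r x := by
    change actHom B M V (b • r) x = b • actHom B M V r x
    rw [map_smul]
    rfl

/-- The inclusion of functions into functions on the product with `Spec B`. -/
def incl (B : Type u) [CommRing B] [Algebra k B] (V : Opens T) :
    Fn R V →+* Fn (baseChange R B) V :=
  (Algebra.TensorProduct.includeRight : Fn R V →ₐ[k] B ⊗[k] Fn R V).toRingHom

lemma incl_apply (f : Fn R V) : incl B V f = tm 1 f := rfl

lemma tensor_induction {p : B ⊗[k] Sec M V → Prop} (x) (h0 : p 0) (ht : ∀ b m, p (b ⊗ₜ m))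
    (ha : ∀ x y, p x → p y → p (x + y)) : p x :=
  TensorProduct.induction_on x h0 ht ha

lemma resB_smul {W : Opens T} (h : W ≤ V) (r : Fn (baseChange R B) V) (x : B ⊗[k] Sec M V) :
    resB B h (r • x) = Fn.res h r • resB B h x := by
  induction r using Fn.induction with
  | h0 => simp
  | ha r s hr hs => simp only [add_smul, map_add, hr, hs]
  | ht a f =>
    induction x using tensor_induction with
    | h0 => simp
    | ha x y hx hy => simp only [smul_add, map_add, hx, hy]
    | ht b m =>
      rw [tm_smul_tmul, res_tm, resB_tmul, resB_tmul, tm_smul_tmul, Sec.res_smul]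

lemma resB_self (x : B ⊗[k] Sec M V) : resB B (le_refl V) x = x := by
  induction x using tensor_induction with
  | h0 => simp
  | ha x y hx hy => rw [map_add, hx, hy]
  | ht b m => rw [resB_tmul, Sec.res_self]

lemma resB_resB {W' W : Opens T} (h : W' ≤ W) (h' : W ≤ V) (x : B ⊗[k] Sec M V) :
    resB B h (resB B h' x) = resB B (h.trans h') x := by
  induction x using tensor_induction with
  | h0 => simp
  | ha x y hx hy => simp only [map_add, hx, hy]
  | ht b m => simp only [resB_tmul, Sec.res_res]

/-- Evaluation of a linear form on the coefficients. -/
def slice {G : Type*} [AddCommGroup G] [Module k G] (l : B →ₗ[k] k) : B ⊗[k] G →ₗ[k] G :=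
  (TensorProduct.lid k G).toLinearMap ∘ₗ LinearMap.rTensor G l

@[simp]
lemma slice_tmul {G : Type*} [AddCommGroup G] [Module k G] (l : B →ₗ[k] k) (b : B) (m : G) :
    slice l (b ⊗ₜ m) = l b • m := by
  simp [slice]

lemma res_slice (l : B →ₗ[k] k) {W : Opens T} (h : W ≤ V) (x : B ⊗[k] Sec M V) :
    Sec.res h (slice l x) = slice l (resB B h x) := by
  induction x using tensor_induction with
  | h0 => simp
  | ha x y hx hy => simp only [map_add, hx, hy]
  | ht b m => simp

/-- A basis of `B` makes `B ⊗ G` a finite direct sum of copies of `G`, with the slices along the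
coordinate forms as projections. This is how finite dimensionality of the coefficients reduces
statements about `F ⊗ B` to statements about `F`. -/
lemma eq_sum_slice {G : Type*} [AddCommGroup G] [Module k G] {κ : Type*} [Fintype κ]
    (b : Module.Basis κ k B) (x : B ⊗[k] G) :
    x = ∑ i, b i ⊗ₜ slice (b.coord i) x := by
  induction x using TensorProduct.induction_on with
  | zero => simp
  | add x y hx hy =>
    simp only [map_add, TensorProduct.tmul_add, Finset.sum_add_distrib]
    rw [← hx, ← hy]
  | tmul c m =>
    simp only [slice_tmul, TensorProduct.tmul_smul]
    simp only [TensorProduct.smul_tmul', ← TensorProduct.sum_tmul]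
    congr 1
    exact (b.sum_repr c).symm

/-- `F ⊗ B` is a sheaf if `B` is finite dimensional. -/
lemma isSheafOn_tensor [Module.Finite k B] (hM : TopCat.Presheaf.IsSheaf M.presheaf) :
    IsSheafOn (fun V => B ⊗[k] Sec M V) (fun _ _ h => resB B h) where
  res_self U x := resB_self x
  res_res h h' x := resB_resB h h' x
  eq_of_locally {U} x y hxy := by
    rw [eq_sum_slice (Module.finBasis k B) x, eq_sum_slice (Module.finBasis k B) y]
    refine Finset.sum_congr rfl fun i _ => congrArg _ ?_
    refine (isSheafOn_sec hM).eq_of_locally _ _ fun p hp => ?_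
    obtain ⟨V, h, hp, hV⟩ := hxy p hp
    exact ⟨V, h, hp, by rw [res_slice, res_slice, hV]⟩
  glue V U hV hU x hx := by
    have key : ∀ i, ∃ y : Sec M U, ∀ j, Sec.res (hV j) y =
        slice ((Module.finBasis k B).coord i) (x j) := fun i =>
      (isSheafOn_sec hM).glue V U hV hU _ fun j l W hj hl => by
        rw [res_slice, res_slice, hx j l W hj hl]
    choose y hy using key
    refine ⟨∑ i, Module.finBasis k B i ⊗ₜ y i, fun j => ?_⟩
    rw [map_sum, eq_sum_slice (Module.finBasis k B) (x j)]
    simp only [resB_tmul, hy]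

/-- A basis of `F` gives a basis of `F ⊗ B`. -/
lemma bijective_sum_smul_one_tmul {n : ℕ} {e : Fin n → Sec M V}
    (he : Function.Bijective fun c : Fin n → Fn R V => ∑ i, c i • e i) :
    Function.Bijective fun c : Fin n → Fn (baseChange R B) V =>
      ∑ i, c i • ((1 : B) ⊗ₜ[k] e i) := by
  let l : (Fin n → Fn R V) →ₗ[k] Sec M V :=
    { toFun := fun c => ∑ i, c i • e i
      map_add' := fun c d => by simp only [Pi.add_apply, add_smul, Finset.sum_add_distrib]
      map_smul' := fun c d => by
        simp only [Pi.smul_apply, Finset.smul_sum, RingHom.id_apply, smul_assoc] }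
  let E := LinearEquiv.ofBijective l he
  -- Tensor products commute with finite products, so coordinates of sections of `F ⊗ B` are
  -- functions on the product with `Spec B`.
  let Q : B ⊗[k] (Fin n → Fn R V) ≃+ (Fin n → Fn (baseChange R B) V) :=
    (TensorProduct.piRight k k B (fun _ : Fin n => Fn R V)).toAddEquiv
  have key : ∀ x, ∑ i, Q x i • ((1 : B) ⊗ₜ[k] e i) =
      LinearMap.lTensor B E.toLinearMap x := by
    intro x
    induction x using TensorProduct.induction_on with
    | zero =>
      rw [map_zero, map_zero]
      exact Finset.sum_eq_zero fun i _ => zero_smul _ _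
    | add x y hx hy =>
      rw [map_add, map_add, ← hx, ← hy, ← Finset.sum_add_distrib]
      exact Finset.sum_congr rfl fun i _ => add_smul _ _ _
    | tmul b c =>
      have : ∀ i, Q (b ⊗ₜ c) i = tm b (c i) := fun i => rfl
      simp only [this, tm_smul_tmul, mul_one, LinearMap.lTensor_tmul]
      rw [← TensorProduct.tmul_sum]
      rfl
  have h2 : Function.Bijective (LinearMap.lTensor B E.toLinearMap) :=
    (LinearEquiv.lTensor B E).bijective
  have h3 : (fun c : Fin n → Fn (baseChange R B) V => ∑ i, c i • ((1 : B) ⊗ₜ[k] e i)) =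
      LinearMap.lTensor B E.toLinearMap ∘ Q.symm := by
    funext c
    rw [Function.comp_apply, ← key, AddEquiv.apply_symm_apply]
  rw [h3]
  exact h2.comp Q.symm.bijective

/-! ### Change of coefficients -/

@[simp]
lemma specialize_tm (ε : A →ₐ[k] k) (a : A) (f : Fn R V) :
    specialize ε V (tm a f) = ε a • f := by
  change Algebra.TensorProduct.lift _ _ _ (a ⊗ₜ f) = _
  rw [Algebra.TensorProduct.lift_tmul, Algebra.smul_def]
  rfl

@[simp]
lemma reduce_tm (μ : B →ₐ[k] A) (b : B) (f : Fn R V) :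
    reduce μ V (tm b f) = tm (μ b) f := rfl

lemma res_specialize (ε : A →ₐ[k] k) {W : Opens T} (h : W ≤ V) (r : Fn (baseChange R A) V) :
    Fn.res h (specialize ε V r) = specialize ε W (Fn.res h r) := by
  induction r using Fn.induction with
  | h0 => simp
  | ha r s hr hs => simp only [map_add, hr, hs]
  | ht a f => rw [res_tm, specialize_tm, specialize_tm, map_smul]

lemma res_reduce (μ : B →ₐ[k] A) {W : Opens T} (h : W ≤ V) (r : Fn (baseChange R B) V) :
    Fn.res h (reduce μ V r) = reduce μ W (Fn.res h r) := by
  induction r using Fn.induction with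
  | h0 => simp
  | ha r s hr hs => simp only [map_add, hr, hs]
  | ht a f => rfl

lemma slice_smul (ε : A →ₐ[k] k) (r : Fn (baseChange R A) V) (x : A ⊗[k] Sec M V) :
    slice ε.toLinearMap (r • x) = specialize ε V r • slice ε.toLinearMap x := by
  induction r using Fn.induction with
  | h0 => simp
  | ha r s hr hs => simp only [add_smul, map_add, hr, hs]
  | ht a f =>
    induction x using tensor_induction with
    | h0 => simp
    | ha x y hx hy => simp only [smul_add, map_add, hx, hy]
    | ht b m =>
      rw [tm_smul_tmul, specialize_tm, slice_tmul, slice_tmul, AlgHom.toLinearMap_apply,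
        AlgHom.toLinearMap_apply, map_mul, mul_smul, smul_assoc, smul_comm f]

lemma rTensor_smul (μ : B →ₐ[k] A) (r : Fn (baseChange R B) V) (x : B ⊗[k] Sec M V) :
    LinearMap.rTensor (Sec M V) μ.toLinearMap (r • x) =
      reduce μ V r • LinearMap.rTensor (Sec M V) μ.toLinearMap x := by
  induction r using Fn.induction with
  | h0 => simp
  | ha r s hr hs => simp only [add_smul, map_add, hr, hs]
  | ht a f =>
    induction x using tensor_induction with
    | h0 => simp
    | ha x y hx hy => simp only [smul_add, map_add, hx, hy]
    | ht b m =>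
      rw [tm_smul_tmul, reduce_tm, LinearMap.rTensor_tmul, LinearMap.rTensor_tmul, tm_smul_tmul]
      simp

lemma resB_rTensor (μ : B →ₗ[k] A) {W : Opens T} (h : W ≤ V) (x : B ⊗[k] Sec M V) :
    resB A h (LinearMap.rTensor (Sec M V) μ x) = LinearMap.rTensor (Sec M W) μ (resB B h x) := by
  induction x using tensor_induction with
  | h0 => simp
  | ha x y hx hy => simp only [map_add, hx, hy]
  | ht b m => simp

lemma rTensor_act (s : A →ₗ[k] B) (g : Fn R V) (x : A ⊗[k] Sec M V) :
    LinearMap.rTensor (Sec M V) s (act A g x) = act B g (LinearMap.rTensor (Sec M V) s x) := by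
  induction x using tensor_induction with
  | h0 => simp
  | ha x y hx hy => simp only [map_add, hx, hy]
  | ht b m => simp

lemma slice_rTensor (ε : A →ₐ[k] k) (μ : B →ₐ[k] A) (x : B ⊗[k] Sec M V) :
    slice ε.toLinearMap (LinearMap.rTensor (Sec M V) μ.toLinearMap x) =
      slice (ε.comp μ).toLinearMap x := by
  induction x using tensor_induction with
  | h0 => simp
  | ha x y hx hy => simp only [map_add, hx, hy]
  | ht b m => simp

/-- Sections of `F ⊗ A` that vanish on `F` lie in `ker(A → k) (F ⊗ A)`. -/
lemma mem_smul_top_of_slice_eq_zero (ε : A →ₐ[k] k) (x : A ⊗[k] Sec M V)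
    (hx : slice ε.toLinearMap x = 0) :
    x ∈ RingHom.ker (specialize (R := R) ε V) • (⊤ : Submodule (Fn (baseChange R A) V) _) := by
  -- Without the hypothesis on `x` the claim is additive. On `a ⊗ m` the difference is `(a - ε a) ⊗
  -- 1` times `1 ⊗ m`.
  have key : ∀ x : A ⊗[k] Sec M V, x - 1 ⊗ₜ slice ε.toLinearMap x ∈
      RingHom.ker (specialize (R := R) ε V) • (⊤ : Submodule (Fn (baseChange R A) V) _) := by
    intro x
    induction x using tensor_induction with
    | h0 => simp
    | ha x y hx hy =>
      rw [map_add, TensorProduct.tmul_add, add_sub_add_comm]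
      exact add_mem hx hy
    | ht a m =>
      have : a ⊗ₜ[k] m - 1 ⊗ₜ slice ε.toLinearMap (a ⊗ₜ[k] m) =
          (tm (a - algebraMap k A (ε a)) 1 : Fn (baseChange R A) V) • (1 ⊗ₜ[k] m) := by
        rw [tm_smul_tmul, mul_one, one_smul, TensorProduct.sub_tmul, slice_tmul,
          TensorProduct.tmul_smul, TensorProduct.smul_tmul', Algebra.algebraMap_eq_smul_one]
        rfl
      rw [this]
      refine Submodule.smul_mem_smul ?_ trivial
      rw [RingHom.mem_ker, specialize_tm, map_sub, AlgHom.commutes, Algebra.algebraMap_self_apply,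
        sub_self, zero_smul]
  simpa [hx] using key x

/-- Sections of `F ⊗ B` that vanish on `F ⊗ A` lie in `ker(B → A) (F ⊗ B)`. -/
lemma mem_smul_top_of_rTensor_eq_zero (μ : B →ₐ[k] A) (hμ : Function.Surjective μ)
    (x : B ⊗[k] Sec M V) (hx : LinearMap.rTensor (Sec M V) μ.toLinearMap x = 0) :
    x ∈ RingHom.ker (reduce (R := R) μ V) • (⊤ : Submodule (Fn (baseChange R B) V) _) := by
  obtain ⟨s, hs⟩ := μ.toLinearMap.exists_rightInverse_of_surjective
    (LinearMap.range_eq_top.mpr hμ)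
  have hs' : ∀ a, μ (s a) = a := fun a => congr($hs a)
  -- A `k`-linear section `s` is enough: on `b ⊗ m` the difference is `(b - s (μ b)) ⊗ 1` times `1 ⊗
  -- m`, and `b - s (μ b)` lies in the kernel of `μ`.
  have key : ∀ x : B ⊗[k] Sec M V, x - LinearMap.rTensor (Sec M V) s
      (LinearMap.rTensor (Sec M V) μ.toLinearMap x) ∈
      RingHom.ker (reduce (R := R) μ V) • (⊤ : Submodule (Fn (baseChange R B) V) _) := by
    intro x
    induction x using tensor_induction with
    | h0 => simp
    | ha x y hx hy =>
      rw [map_add, map_add, add_sub_add_comm]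
      exact add_mem hx hy
    | ht b m =>
      have : b ⊗ₜ[k] m - LinearMap.rTensor (Sec M V) s
          (LinearMap.rTensor (Sec M V) μ.toLinearMap (b ⊗ₜ[k] m)) =
          (tm (b - s (μ b)) 1 : Fn (baseChange R B) V) • (1 ⊗ₜ[k] m) := by
        rw [tm_smul_tmul, mul_one, one_smul, TensorProduct.sub_tmul]
        rfl
      rw [this]
      refine Submodule.smul_mem_smul ?_ trivial
      rw [RingHom.mem_ker, reduce_tm, map_sub, hs', sub_self]
      exact TensorProduct.zero_tmul _ _
  simpa [hx] using key x

/-- The kernel of `F ⊗ B → F ⊗ A` if the kernel of `B → A` is spanned by `t`. -/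
lemma exists_tmul_of_rTensor_eq_zero (μ : B →ₐ[k] A) (hμ : Function.Surjective μ) {t : B}
    (ht : t ≠ 0) (hker : ∀ b, μ b = 0 → ∃ c : k, b = c • t) (x : B ⊗[k] Sec M V)
    (hx : LinearMap.rTensor (Sec M V) μ.toLinearMap x = 0) : ∃ m : Sec M V, x = t ⊗ₜ m := by
  obtain ⟨s, hs⟩ := μ.toLinearMap.exists_rightInverse_of_surjective
    (LinearMap.range_eq_top.mpr hμ)
  have hs' : ∀ a, μ (s a) = a := fun a => congr($hs a)
  obtain ⟨l, hl⟩ := Module.Projective.exists_dual_ne_zero k ht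
  -- The form `l'` reads off the scalar `c` in `b - s (μ b) = c t`; the factor `(l t)⁻¹` normalizes
  -- `l` at `t`.
  let l' : B →ₗ[k] k := (l t)⁻¹ • (l - l ∘ₗ s ∘ₗ μ.toLinearMap)
  have key : ∀ x : B ⊗[k] Sec M V, x = LinearMap.rTensor (Sec M V) s
      (LinearMap.rTensor (Sec M V) μ.toLinearMap x) + t ⊗ₜ slice l' x := by
    intro x
    induction x using tensor_induction with
    | h0 => simp
    | ha x y hx hy =>
      simp only [map_add, TensorProduct.tmul_add]
      nth_rewrite 1 [hx, hy]
      abel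
    | ht b m =>
      obtain ⟨c, hc⟩ := hker (b - s (μ b)) (by rw [map_sub, hs', sub_self])
      have : l' b = c := by
        have h1 : l (b - s (μ b)) = c * l t := by rw [hc, map_smul, smul_eq_mul]
        simp only [l', LinearMap.smul_apply, LinearMap.sub_apply, LinearMap.comp_apply,
          AlgHom.toLinearMap_apply, smul_eq_mul]
        rw [← map_sub, h1]
        field_simp
      rw [slice_tmul, this, TensorProduct.tmul_smul, TensorProduct.smul_tmul', ← hc]
      simp [TensorProduct.sub_tmul]
  exact ⟨_, by simpa [hx] using key x⟩

/-- Over a field some linear form does not vanish at `t`, and slicing along it recovers `m` up to a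
unit. All identities between polyvectors are later tested after applying `t ⊗ -`. -/
lemma tmul_injective {t : B} (ht : t ≠ 0) :
    Function.Injective fun m : Sec M V => t ⊗ₜ[k] m := by
  obtain ⟨l, hl⟩ := Module.Projective.exists_dual_ne_zero k ht
  intro m n h
  have := congrArg (slice l) h
  simp only [slice_tmul] at this
  exact smul_right_injective _ hl this

/-- Multiplication with an element `t` that is killed by the kernel of `B → k`. -/
lemma smul_eq_tmul_slice (ε : B →ₐ[k] k) {t : B} (h : ∀ b, t * b = ε b • t)
    (x : B ⊗[k] Sec M V) : t • x = t ⊗ₜ slice ε.toLinearMap x := by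
  induction x using tensor_induction with
  | h0 => simp
  | ha x y hx hy => rw [smul_add, hx, hy, map_add, TensorProduct.tmul_add]
  | ht b m =>
    rw [TensorProduct.smul_tmul', smul_eq_mul, h, slice_tmul, TensorProduct.tmul_smul,
      TensorProduct.smul_tmul', AlgHom.toLinearMap_apply]

end Tensor

/-! ### Splittings over affine open sets -/

section Basis

variable {S : Type u} [CommRing S] {T : TopCat.{u}} {R : AlgPresheaf S T}

/-- The sections `e` form a basis of `M` over `V` and all its open subsets. -/
def IsBasisOn (M : PMod R) (V : Opens T) {n : ℕ} (e : Fin n → Sec M V) : Prop :=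
  ∀ (W : Opens T) (h : W ≤ V),
    Function.Bijective fun c : Fin n → Fn R W => ∑ i, c i • Sec.res h (e i)

lemma IsBasisOn.res {M : PMod R} {V W : Opens T} {n : ℕ} {e : Fin n → Sec M V}
    (he : IsBasisOn M V e) (h : W ≤ V) : IsBasisOn M W fun i => Sec.res h (e i) := by
  intro W' h'
  simp only [Sec.res_res]
  exact he W' (h'.trans h)

lemma IsBasisOn.self {M : PMod R} {V : Opens T} {n : ℕ} {e : Fin n → Sec M V}
    (he : IsBasisOn M V e) : Function.Bijective fun c : Fin n → Fn R V => ∑ i, c i • e i := by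
  have := he V le_rfl
  simpa only [Sec.res_self] using this

end Basis

/-- The part of the theory of an affine open subset `U` that is needed to split surjections of
locally free sheaves: basic open sets `D f` and sections over them. -/
structure AffineBasis {S : Type u} [CommRing S] {T : TopCat.{u}} (R : AlgPresheaf S T)
    (U : Opens T) where
  D : Fn R U → Opens T
  D_le : ∀ f, D f ≤ U
  D_mul : ∀ f g, D (f * g) = D f ⊓ D g
  exists_le : ∀ V ≤ U, ∀ p ∈ V, ∃ f, p ∈ D f ∧ D f ≤ V
  span_eq_top : ∀ s : Set (Fn R U), Ideal.span s = ⊤ ↔ U ≤ ⨆ f : s, D f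

namespace AffineBasis

variable {S S' : Type u} [CommRing S] [CommRing S'] {T : TopCat.{u}} {R : AlgPresheaf S T}
  {R' : AlgPresheaf S' T} {U : Opens T} (a : AffineBasis R U)
  (ρ : ∀ V, Fn R V →+* Fn R' V)

lemma D_mul_le_left (f g : Fn R U) : a.D (f * g) ≤ a.D f := a.D_mul f g ▸ inf_le_left

lemma D_mul_le_right (f g : Fn R U) : a.D (f * g) ≤ a.D g := a.D_mul f g ▸ inf_le_right

/-- The sections of `R'` over `D (g f)` are the localization at `f` of the sections over `D g`. -/
structure IsLoc : Prop where
  inj : ∀ (g f : Fn R U) (y : Fn R' (a.D g)), Fn.res (a.D_mul_le_left g f) y = 0 →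
    ∀ᶠ N in Filter.atTop, ρ _ (Fn.res (a.D_le g) f) ^ N * y = 0
  surj : ∀ (g f : Fn R U) (y : Fn R' (a.D (g * f))), ∀ᶠ N in Filter.atTop,
    ∃ y', Fn.res (a.D_mul_le_left g f) y' = ρ _ (Fn.res (a.D_le (g * f)) f) ^ N * y

/-- This is quasi-compactness in algebraic form. The basic open sets with the property cover `U`, so
the corresponding functions generate the unit ideal, and finitely many of them already do. -/
lemma exists_finset_of_locally {p : Opens T → Prop}
    (hp : ∀ x ∈ U, ∃ V : Opens T, x ∈ V ∧ ∀ W ≤ V, p W) :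
    ∃ s : Finset (Fn R U), Ideal.span (s : Set (Fn R U)) = ⊤ ∧ ∀ g ∈ s, p (a.D g) := by
  have h1 : Ideal.span {g : Fn R U | p (a.D g)} = ⊤ := by
    rw [a.span_eq_top]
    intro x hx
    obtain ⟨V, hxV, hV⟩ := hp x hx
    obtain ⟨f, hf, hfV⟩ := a.exists_le (U ⊓ V) inf_le_left x ⟨hx, hxV⟩
    exact Opens.mem_iSup.mpr ⟨⟨f, hV _ (hfV.trans inf_le_right)⟩, hf⟩
  obtain ⟨s, hs, h⟩ := (Ideal.span_eq_top_iff_finite _).mp h1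
  exact ⟨s, h, fun g hg => hs hg⟩

end AffineBasis

/-! ### Morphisms of locally free sheaves and their localization -/

section LinMap

variable {S S' : Type u} [CommRing S] [CommRing S'] {T : TopCat.{u}} {R : AlgPresheaf S T}
  {R' : AlgPresheaf S' T} (ρ : ∀ V, Fn R V →+* Fn R' V) {M : PMod R} {M' : PMod R'}

/-- `σ` is a morphism of sheaves of `R`-modules over `U`, where `R` acts on `M'` through `ρ`. -/
structure IsLinMap {U : Opens T} (σ : ∀ V, V ≤ U → Sec M V → Sec M' V) : Prop where
  add : ∀ V h m n, σ V h (m + n) = σ V h m + σ V h n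
  smul : ∀ V h f m, σ V h (f • m) = ρ V f • σ V h m
  res : ∀ {W V : Opens T} (hWV : W ≤ V) (h : V ≤ U) m,
    Sec.res hWV (σ V h m) = σ W (hWV.trans h) (Sec.res hWV m)

variable {ρ}

lemma IsLinMap.sum {U : Opens T} {σ : ∀ V, V ≤ U → Sec M V → Sec M' V} (hσ : IsLinMap ρ σ)
    {V : Opens T} (h : V ≤ U) {n : ℕ} (c : Fin n → Fn R V) (e : Fin n → Sec M V) :
    σ V h (∑ i, c i • e i) = ∑ i, ρ V (c i) • σ V h (e i) := by
  let l : Sec M V →+ Sec M' V := AddMonoidHom.mk' (σ V h) (hσ.add V h)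
  change l _ = _
  rw [map_sum]
  exact Finset.sum_congr rfl fun i _ => hσ.smul V h _ _

lemma IsLinMap.restrict {U V : Opens T} (hVU : V ≤ U) {σ : ∀ V, V ≤ U → Sec M V → Sec M' V}
    (hσ : IsLinMap ρ σ) : IsLinMap ρ (fun W (h : W ≤ V) => σ W (h.trans hVU)) where
  add W _ := hσ.add W _
  smul W _ := hσ.smul W _
  res h _ := hσ.res h _

/-- Morphisms that agree on a basis are equal. -/
lemma IsLinMap.eq_of_basis {U : Opens T} {σ τ : ∀ V, V ≤ U → Sec M V → Sec M' V}
    (hσ : IsLinMap ρ σ) (hτ : IsLinMap ρ τ) {n : ℕ} {e : Fin n → Sec M U} (he : IsBasisOn M U e)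
    (h : ∀ i, σ U le_rfl (e i) = τ U le_rfl (e i)) (V : Opens T) (hV : V ≤ U) (m : Sec M V) :
    σ V hV m = τ V hV m := by
  obtain ⟨c, rfl⟩ := (he V hV).2 m
  dsimp only
  rw [hσ.sum, hτ.sum]
  refine Finset.sum_congr rfl fun i _ => ?_
  rw [← hσ.res hV le_rfl, ← hτ.res hV le_rfl, h]

variable (hρ : ∀ {W V : Opens T} (h : W ≤ V) f, Fn.res h (ρ V f) = ρ W (Fn.res h f))
include hρ

/-- Morphisms may be prescribed on a basis. -/
lemma exists_linMap_of_basis {U : Opens T} {n : ℕ} {e : Fin n → Sec M U} (he : IsBasisOn M U e)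
    (y : Fin n → Sec M' U) :
    ∃ σ : ∀ V, V ≤ U → Sec M V → Sec M' V, IsLinMap ρ σ ∧ ∀ i, σ U le_rfl (e i) = y i := by
  have hc : ∀ V (h : V ≤ U) m, ∃ c : Fin n → Fn R V, ∑ i, c i • Sec.res h (e i) = m :=
    fun V h m => (he V h).2 m
  choose c hc using hc
  -- Uniqueness of coordinates makes the chosen `c` additive, linear and compatible with
  -- restriction.
  have key : ∀ V (h : V ≤ U) d m, ∑ i, d i • Sec.res h (e i) = m → c V h m = d :=
    fun V h d m hd => (he V h).1 ((hc V h m).trans hd.symm)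
  refine ⟨fun V h m => ∑ i, ρ V (c V h m i) • Sec.res h (y i), ⟨?_, ?_, ?_⟩, fun i => ?_⟩
  · intro V h m m'
    rw [key V h (c V h m + c V h m') (m + m')]
    · simp only [Pi.add_apply, map_add, add_smul, Finset.sum_add_distrib]
    · simp only [Pi.add_apply, add_smul, Finset.sum_add_distrib, hc]
  · intro V h f m
    rw [key V h (f • c V h m) (f • m)]
    · simp only [Pi.smul_apply, smul_eq_mul, map_mul, mul_smul, Finset.smul_sum]
    · simp only [Pi.smul_apply, smul_eq_mul, mul_smul, ← Finset.smul_sum, hc]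
  · intro W V hWV h m
    rw [key W (hWV.trans h) (fun i => Fn.res hWV (c V h m i)) (Sec.res hWV m)]
    · simp only [map_sum, Sec.res_smul, Sec.res_res, hρ]
    · nth_rewrite 2 [← hc V h m]
      simp only [map_sum, Sec.res_smul, Sec.res_res]
  · dsimp only
    rw [key U le_rfl (Pi.single i 1) (e i), Finset.sum_eq_single i]
    · simp [Sec.res_self]
    · intro j _ hj
      simp [hj]
    · simp
    · rw [Finset.sum_eq_single i]
      · simp [Sec.res_self]
      · intro j _ hj
        simp [hj]
      · simp

lemma IsLinMap.smul_left {U : Opens T} {σ : ∀ V, V ≤ U → Sec M V → Sec M' V} (hσ : IsLinMap ρ σ)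
    (f : Fn R U) : IsLinMap ρ fun V h m => ρ V (Fn.res h f) • σ V h m where
  add V h m n := by rw [hσ.add, smul_add]
  smul V h g m := by rw [hσ.smul, smul_comm]
  res hWV h m := by rw [Sec.res_smul, hρ, Fn.res_res, hσ.res]

omit hρ in
lemma IsLinMap.sub {U : Opens T} {σ τ : ∀ V, V ≤ U → Sec M V → Sec M' V} (hσ : IsLinMap ρ σ)
    (hτ : IsLinMap ρ τ) : IsLinMap ρ fun V h m => σ V h m - τ V h m where
  add V h m n := by rw [hσ.add, hτ.add, add_sub_add_comm]
  smul V h g m := by rw [hσ.smul, hτ.smul, smul_sub]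
  res hWV h m := by rw [map_sub, hσ.res, hτ.res]

/-! Localization of sections and of morphisms. -/

variable {U : Opens T} {a : AffineBasis R U} (hloc : a.IsLoc ρ)
include hloc

-- The argument is coordinatewise. Exponents are quantified by `∀ᶠ`, so that one exponent serves all
-- of the finitely many coordinates.
omit hρ in
lemma AffineBasis.IsLoc.sec_inj {g : Fn R U} {n : ℕ} {d : Fin n → Sec M' (a.D g)}
    (hd : IsBasisOn M' (a.D g) d) (f : Fn R U) (y : Sec M' (a.D g))
    (hy : Sec.res (a.D_mul_le_left g f) y = 0) :
    ∀ᶠ N in Filter.atTop, ρ _ (Fn.res (a.D_le g) f) ^ N • y = 0 := by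
  obtain ⟨c, rfl⟩ := hd.self.2 y
  dsimp only at hy ⊢
  have hc : ∀ i, Fn.res (a.D_mul_le_left g f) (c i) = 0 := by
    have : (fun i => Fn.res (a.D_mul_le_left g f) (c i)) = 0 :=
      (hd _ (a.D_mul_le_left g f)).1 (by
        simp only [map_sum, Sec.res_smul] at hy
        simpa using hy)
    exact fun i => congrFun this i
  filter_upwards [Filter.eventually_all.mpr fun i => hloc.inj g f (c i) (hc i)] with N hN
  rw [Finset.smul_sum]
  exact Finset.sum_eq_zero fun i _ => by rw [smul_smul, hN, zero_smul]

omit hρ in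
lemma AffineBasis.IsLoc.sec_surj {g : Fn R U} {n : ℕ} {d : Fin n → Sec M' (a.D g)}
    (hd : IsBasisOn M' (a.D g) d) (f : Fn R U) (y : Sec M' (a.D (g * f))) :
    ∀ᶠ N in Filter.atTop, ∃ y' : Sec M' (a.D g), Sec.res (a.D_mul_le_left g f) y' =
      ρ _ (Fn.res (a.D_le (g * f)) f) ^ N • y := by
  obtain ⟨c, rfl⟩ := (hd _ (a.D_mul_le_left g f)).2 y
  filter_upwards [Filter.eventually_all.mpr fun i => hloc.surj g f (c i)] with N hN
  choose y' hy' using hN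
  refine ⟨∑ i, y' i • d i, ?_⟩
  simp only [map_sum, Sec.res_smul, Finset.smul_sum, smul_smul, hy']

/-- A morphism out of a free sheaf is known from its finitely many values on a basis, so a power of
`f` that kills these values kills the morphism. -/
lemma AffineBasis.IsLoc.linMap_inj {g : Fn R U} {n n' : ℕ} {e : Fin n → Sec M (a.D g)}
    (he : IsBasisOn M (a.D g) e) {d : Fin n' → Sec M' (a.D g)} (hd : IsBasisOn M' (a.D g) d)
    {σ : ∀ V, V ≤ a.D g → Sec M V → Sec M' V} (hσ : IsLinMap ρ σ) (f : Fn R U)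
    (h0 : ∀ V (h : V ≤ a.D (g * f)) m, σ V (h.trans (a.D_mul_le_left g f)) m = 0) :
    ∀ᶠ N in Filter.atTop, ∀ V (h : V ≤ a.D g) m,
      ρ V (Fn.res (h.trans (a.D_le g)) f) ^ N • σ V h m = 0 := by
  have := Filter.eventually_all.mpr fun i => hloc.sec_inj hd f (σ _ le_rfl (e i)) (by
    rw [hσ.res]; exact h0 _ le_rfl _)
  filter_upwards [this] with N hN V h m
  have h1 := hσ.smul_left hρ (Fn.res (a.D_le g) f ^ N)
  have h2 : IsLinMap ρ fun V (_ : V ≤ a.D g) (_ : Sec M V) => (0 : Sec M' V) :=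
    ⟨fun _ _ _ _ => by simp, fun _ _ _ _ => by simp, fun _ _ _ => by simp⟩
  have := h1.eq_of_basis h2 he (fun i => by
    simp only [map_pow, Fn.res_res]
    exact hN i) V h m
  simpa only [map_pow, Fn.res_res] using this

/-- After multiplication by a power of `f` the values on the restricted basis extend to `D g`, and a
morphism may be prescribed by its values on a basis. -/
lemma AffineBasis.IsLoc.linMap_surj {g : Fn R U} {n n' : ℕ} {e : Fin n → Sec M (a.D g)}
    (he : IsBasisOn M (a.D g) e) {d : Fin n' → Sec M' (a.D g)} (hd : IsBasisOn M' (a.D g) d)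
    (f : Fn R U) {σ : ∀ V, V ≤ a.D (g * f) → Sec M V → Sec M' V} (hσ : IsLinMap ρ σ) :
    ∀ᶠ N in Filter.atTop, ∃ τ : ∀ V, V ≤ a.D g → Sec M V → Sec M' V, IsLinMap ρ τ ∧
      ∀ V (h : V ≤ a.D (g * f)) m, τ V (h.trans (a.D_mul_le_left g f)) m =
        ρ V (Fn.res (h.trans (a.D_le _)) f) ^ N • σ V h m := by
  have hle := a.D_mul_le_left g f
  filter_upwards [Filter.eventually_all.mpr fun i =>
    hloc.sec_surj hd f (σ _ le_rfl (Sec.res hle (e i)))] with N hN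
  choose y hy using hN
  obtain ⟨τ, hτ, hτe⟩ := exists_linMap_of_basis hρ he y
  refine ⟨τ, hτ, fun V h m => ?_⟩
  have := (hτ.restrict hle).eq_of_basis
    (hσ.smul_left hρ (Fn.res (a.D_le (g * f)) f ^ N)) (he.res hle) (fun i => by
      rw [← hτ.res hle le_rfl, hτe, hy]
      simp only [map_pow, Fn.res_res]) V h m
  simpa only [map_pow, Fn.res_res] using this

end LinMap

/-! ### Extension of morphisms from basic open sets and splitting of surjections -/

section Splitting

variable {S S' : Type u} [CommRing S] [CommRing S'] {T : TopCat.{u}} {R : AlgPresheaf S T}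
  {R' : AlgPresheaf S' T} {ρ : ∀ V, Fn R V →+* Fn R' V} {M : PMod R} {M' : PMod R'}

lemma IsLocallyFree.exists_basis (hM : IsLocallyFree M) (x : T) :
    ∃ V : Opens T, x ∈ V ∧ ∃ (n : ℕ) (e : Fin n → Sec M V), IsBasisOn M V e :=
  hM x

lemma AffineBasis.exists_finset_bases {U : Opens T} (a : AffineBasis R U) (hM : IsLocallyFree M)
    (hM' : IsLocallyFree M') :
    ∃ s : Finset (Fn R U), Ideal.span (s : Set (Fn R U)) = ⊤ ∧ ∀ g ∈ s,
      (∃ (n : ℕ) (e : Fin n → Sec M (a.D g)), IsBasisOn M (a.D g) e) ∧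
      ∃ (n : ℕ) (e : Fin n → Sec M' (a.D g)), IsBasisOn M' (a.D g) e := by
  refine a.exists_finset_of_locally (p := fun V =>
    (∃ (n : ℕ) (e : Fin n → Sec M V), IsBasisOn M V e) ∧
      ∃ (n : ℕ) (e : Fin n → Sec M' V), IsBasisOn M' V e) fun x _ => ?_
  obtain ⟨V, hxV, n, e, he⟩ := hM.exists_basis x
  obtain ⟨V', hxV', n', e', he'⟩ := hM'.exists_basis x
  exact ⟨V ⊓ V', ⟨hxV, hxV'⟩, fun W hW => ⟨⟨n, _, he.res (hW.trans inf_le_left)⟩,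
    n', _, he'.res (hW.trans inf_le_right)⟩⟩

variable (hρ : ∀ {W V : Opens T} (h : W ≤ V) f, Fn.res h (ρ V f) = ρ W (Fn.res h f))
  {U : Opens T} {a : AffineBasis R U} (hloc : a.IsLoc ρ) (hM : IsLocallyFree M)
  (hM' : IsLocallyFree M') (hS' : IsSheafOn (Sec M') (fun _ _ h => Sec.res h))
include hρ hloc hM hM' hS'

/-- Finitely many `D g` over which both sheaves are free cover `U`. A common exponent for these
works on `U`, since vanishing in a sheaf is local. -/
lemma AffineBasis.IsLoc.linMap_inj_of_locallyFree {σ : ∀ V, V ≤ U → Sec M V → Sec M' V}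
    (hσ : IsLinMap ρ σ) (f : Fn R U) (h0 : ∀ V (h : V ≤ a.D f) m, σ V (h.trans (a.D_le f)) m = 0) :
    ∀ᶠ N in Filter.atTop, ∀ V (h : V ≤ U) m, ρ V (Fn.res h f) ^ N • σ V h m = 0 := by
  obtain ⟨s, hs, hb⟩ := a.exists_finset_bases hM hM'
  have key : ∀ g : s, ∀ᶠ N in Filter.atTop, ∀ V (h : V ≤ a.D g) m,
      ρ V (Fn.res (h.trans (a.D_le g)) f) ^ N • σ V (h.trans (a.D_le g)) m = 0 := by
    intro g
    obtain ⟨⟨n, e, he⟩, n', d, hd⟩ := hb g g.2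
    exact hloc.linMap_inj hρ he hd (hσ.restrict (a.D_le g)) f fun V h m =>
      h0 V (h.trans (a.D_mul_le_right _ _)) m
  filter_upwards [Filter.eventually_all.mpr key] with N hN V h m
  refine hS'.eq_of_cover (h.trans ((a.span_eq_top _).mp hs)) fun g W hW hg => ?_
  rw [map_zero, Sec.res_smul, map_pow, hρ, Fn.res_res, hσ.res]
  exact hN g W hg _

/-- Together with the preceding lemma, this says that `Hom(M, M')` over `D f` is the localization at
`f` of `Hom(M, M')` over `U`. It is the usual argument for quasi-coherent sheaves on quasi-compact,
quasi-separated spaces, carried out for morphisms. -/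
lemma AffineBasis.IsLoc.linMap_surj_of_locallyFree (f : Fn R U)
    {σ : ∀ V, V ≤ a.D f → Sec M V → Sec M' V} (hσ : IsLinMap ρ σ) :
    ∃ N, ∃ τ : ∀ V, V ≤ U → Sec M V → Sec M' V, IsLinMap ρ τ ∧
      ∀ V (h : V ≤ a.D f) m, τ V (h.trans (a.D_le f)) m =
        ρ V (Fn.res (h.trans (a.D_le _)) f) ^ N • σ V h m := by
  obtain ⟨s, hs, hb⟩ := a.exists_finset_bases hM hM'
  have key : ∀ g : s, ∀ᶠ N in Filter.atTop, ∃ τ : ∀ V, V ≤ a.D g → Sec M V → Sec M' V,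
      IsLinMap ρ τ ∧ ∀ V (h : V ≤ a.D (g * f)) m, τ V (h.trans (a.D_mul_le_left g f)) m =
        ρ V (Fn.res (h.trans (a.D_le _)) f) ^ N • σ V (h.trans (a.D_mul_le_right _ _)) m := by
    intro g
    obtain ⟨⟨n, e, he⟩, n', d, hd⟩ := hb g g.2
    exact hloc.linMap_surj hρ he hd f (hσ.restrict (a.D_mul_le_right _ _))
  obtain ⟨N, hN⟩ := (Filter.eventually_all.mpr key).exists
  choose τ hτ hτσ using hN
  -- The extensions of `f ^ N σ` to `D g` and `D g'` agree where `f` is invertible, so a further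
  -- power of `f` kills their difference on the overlap.
  have key2 : ∀ g g' : s, ∀ᶠ K in Filter.atTop, ∀ V (h : V ≤ a.D (g * g')) m,
      ρ V (Fn.res (h.trans (a.D_le _)) f) ^ K • (τ g V (h.trans (a.D_mul_le_left _ _)) m -
        τ g' V (h.trans (a.D_mul_le_right _ _)) m) = 0 := by
    intro g g'
    obtain ⟨⟨n, e, he⟩, n', d, hd⟩ := hb g g.2
    refine hloc.linMap_inj hρ (he.res (a.D_mul_le_left g g')) (hd.res (a.D_mul_le_left g g'))
      (((hτ g).restrict (a.D_mul_le_left g g')).sub ((hτ g').restrict (a.D_mul_le_right g g'))) f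
      fun V h m => ?_
    have h1 : V ≤ a.D (g * f) := by
      rw [a.D_mul] at h ⊢
      exact le_inf ((h.trans inf_le_left).trans (a.D_mul_le_left _ _)) (h.trans inf_le_right)
    have h2 : V ≤ a.D (g' * f) := by
      rw [a.D_mul] at h ⊢
      exact le_inf ((h.trans inf_le_left).trans (a.D_mul_le_right _ _)) (h.trans inf_le_right)
    rw [hτσ g V h1, hτσ g' V h2, sub_self]
  obtain ⟨K, hK⟩ := (Filter.eventually_all.mpr fun g => Filter.eventually_all.mpr (key2 g)).exists
  have hlin : ∀ g : s, IsLinMap ρ fun V (h : V ≤ a.D g) m =>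
      ρ V (Fn.res (h.trans (a.D_le _)) f) ^ K • τ g V h m := fun g => by
    have := (hτ g).smul_left hρ (Fn.res (a.D_le g) f ^ K)
    simpa only [map_pow, Fn.res_res] using this
  have hcov := (a.span_eq_top _).mp hs
  obtain ⟨θ, hθ, hθτ⟩ := hS'.exists_glued_map (fun h h' x => Sec.res_res M h h' x) hcov
    (fun g V h m => ρ V (Fn.res (h.trans (a.D_le _)) f) ^ K • τ g V h m)
    (fun g {W V} hWV hV x => (hlin g).res hWV hV x) (fun g g' V hg hg' x => by
      have := hK g g' V (by rw [a.D_mul]; exact le_inf hg hg') x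
      rwa [smul_sub, sub_eq_zero] at this)
  -- The exponent `N` extends `σ` to the `D g`, and `K` makes the extensions agree on overlaps.
  refine ⟨K + N, θ, ⟨fun V h m n => ?_, fun V h c m => ?_, hθ⟩, fun V h m => ?_⟩
  · refine hS'.eq_of_cover (h.trans hcov) fun g W hW hg => ?_
    rw [hθ, map_add, map_add, hθ, hθ]
    simp only [hθτ g W hg]
    exact (hlin g).add W hg _ _
  · refine hS'.eq_of_cover (h.trans hcov) fun g W hW hg => ?_
    rw [hθ, Sec.res_smul, Sec.res_smul, hρ, hθ]
    simp only [hθτ g W hg]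
    exact (hlin g).smul W hg _ _
  · refine hS'.eq_of_cover ((h.trans (a.D_le f)).trans hcov) fun g W hW hg => ?_
    rw [hθ, hθτ g W hg, hτσ g W (by rw [a.D_mul]; exact le_inf hg (hW.trans h)), Sec.res_smul,
      map_pow, hρ, Fn.res_res, smul_smul, ← pow_add, hσ.res]

/-- A locally split surjection of locally free sheaves splits over affine open subsets. -/
lemma AffineBasis.IsLoc.exists_splitting (hid : a.IsLoc fun V => RingHom.id (Fn R V))
    (hS : IsSheafOn (Sec M) (fun _ _ h => Sec.res h)) (π : ∀ V, Sec M' V →+ Sec M V)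
    (hπ : ∀ {W V : Opens T} (h : W ≤ V) m, Sec.res h (π V m) = π W (Sec.res h m))
    (hπρ : ∀ V f m, π V (ρ V f • m) = f • π V m)
    (hsplit : ∀ x ∈ U, ∃ V : Opens T, x ∈ V ∧ ∃ σ : ∀ W, W ≤ V → Sec M W → Sec M' W,
      IsLinMap ρ σ ∧ ∀ W h m, π W (σ W h m) = m) :
    ∃ σ : ∀ W, W ≤ U → Sec M W → Sec M' W, IsLinMap ρ σ ∧ ∀ W h m, π W (σ W h m) = m := by
  obtain ⟨s, hs, hb⟩ := a.exists_finset_of_locally (p := fun V =>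
    ∃ σ : ∀ W, W ≤ V → Sec M W → Sec M' W, IsLinMap ρ σ ∧ ∀ W h m, π W (σ W h m) = m)
    fun x hx => by
      obtain ⟨V, hxV, σ, hσ, hσπ⟩ := hsplit x hx
      exact ⟨V, hxV, fun W hW => ⟨_, hσ.restrict hW, fun W' h m => hσπ W' _ m⟩⟩
  have key : ∀ g : s, ∃ (K : ℕ) (τ : ∀ V, V ≤ U → Sec M V → Sec M' V), IsLinMap ρ τ ∧
      ∀ V (h : V ≤ U) m, π V (τ V h m) = Fn.res h (g : Fn R U) ^ K • m := by
    intro g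
    obtain ⟨σ, hσ, hσπ⟩ := hb g g.2
    obtain ⟨N, τ, hτ, hτσ⟩ := hloc.linMap_surj_of_locallyFree hρ hM hM' hS' g hσ
    have hπτ : IsLinMap (fun V => RingHom.id (Fn R V)) fun V (h : V ≤ U) m => π V (τ V h m) :=
      ⟨fun V h m n => by rw [hτ.add, map_add], fun V h f m => by rw [hτ.smul, hπρ]; rfl,
        fun hWV h m => by rw [hπ, hτ.res]⟩
    have hι : IsLinMap (fun V => RingHom.id (Fn R V)) fun V (_ : V ≤ U) (m : Sec M V) => m :=
      ⟨fun V h m n => rfl, fun V h f m => rfl, fun hWV h m => rfl⟩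
    -- The morphism `π τ - g ^ N` vanishes over `D g`, hence some `g ^ K` kills it over `U`. Then `g
    -- ^ K τ` splits `π` up to the factor `g ^ (K + N)`.
    have hd := hπτ.sub (hι.smul_left (fun _ _ => rfl) ((g : Fn R U) ^ N))
    obtain ⟨K, hK⟩ := (hid.linMap_inj_of_locallyFree (fun _ _ => rfl) hM hM hS hd g
      fun V h m => by
        have h1 : ∀ f m, π V (ρ V f ^ N • m) = f ^ N • π V m := fun f m => by
          rw [← map_pow, hπρ]
        rw [hτσ V h, h1, hσπ]
        simp).exists
    refine ⟨K + N, _, hτ.smul_left hρ ((g : Fn R U) ^ K), fun V h m => ?_⟩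
    have := hK V h m
    simp only [map_pow, RingHom.id_apply, smul_sub, sub_eq_zero] at this
    rw [hπρ, map_pow, this, smul_smul, ← pow_add]
  choose K τ hτ hτπ using key
  -- The powers still generate the unit ideal. A relation `∑ c_g g ^ K_g = 1` acts as a partition of
  -- unity and turns the approximate splittings into a splitting.
  have hspan : Ideal.span (Set.range fun g : s => (g : Fn R U) ^ K g) = ⊤ :=
    Ideal.span_range_pow_eq_top (s : Set (Fn R U)) hs K
  obtain ⟨c, hc⟩ := (Ideal.mem_span_range_iff_exists_fun).mp
    (hspan ▸ Submodule.mem_top : (1 : Fn R U) ∈ _)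
  refine ⟨fun V h m => ∑ g : s, ρ V (Fn.res h (c g)) • τ g V h m, ⟨?_, ?_, ?_⟩, ?_⟩
  · intro V h m n
    simp only [(hτ _).add, smul_add, Finset.sum_add_distrib]
  · intro V h f m
    simp only [(hτ _).smul, Finset.smul_sum]
    exact Finset.sum_congr rfl fun _ _ => smul_comm _ _ _
  · intro W V hWV h m
    simp only [map_sum, Sec.res_smul, hρ, Fn.res_res, (hτ _).res]
  · intro V h m
    simp only [map_sum, hπρ, hτπ, smul_smul]
    rw [← Finset.sum_smul]
    have : ∑ g : s, Fn.res h (c g) * Fn.res h (g : Fn R U) ^ K g = 1 := by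
      simp only [← map_pow, ← map_mul, ← map_sum, hc, map_one]
    rw [this, one_smul]

end Splitting

/-! ### Trivializations from splittings -/

/-- A linear map between finite modules is bijective if it is so modulo a small ideal. -/
lemma bijective_of_le_jacobson {Q P D : Type*} [CommRing Q] [AddCommGroup P] [Module Q P]
    [AddCommGroup D] [Module Q D] [Module.Finite Q P] [Module.Finite Q D] [Module.Projective Q D]
    {I : Ideal Q} (hI : I ≤ Ideal.jacobson ⊥) (Φ : P →ₗ[Q] D)
    (h1 : (⊤ : Submodule Q D) ≤ LinearMap.range Φ ⊔ I • ⊤)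
    (h2 : LinearMap.ker Φ ≤ I • (⊤ : Submodule Q P)) : Function.Bijective Φ := by
  have hs : Function.Surjective Φ := LinearMap.range_eq_top.mp (top_le_iff.mp
    (Submodule.le_of_le_smul_of_le_jacobson_bot Module.Finite.fg_top hI h1))
  -- A right inverse exists by projectivity. It remains to see that it is surjective, for then it is
  -- a two-sided inverse.
  obtain ⟨Ψ, hΨ⟩ := Module.projective_lifting_property Φ LinearMap.id hs
  have hΨ' : ∀ d, Φ (Ψ d) = d := fun d => congr($hΨ d)
  -- Nakayama's lemma is applied once more: `y - Ψ (Φ y)` lies in the kernel of `Φ`, hence in `I P`,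
  -- so `Ψ` is surjective modulo `I`.
  have hs' : Function.Surjective Ψ := LinearMap.range_eq_top.mp (top_le_iff.mp
    (Submodule.le_of_le_smul_of_le_jacobson_bot Module.Finite.fg_top hI fun y _ => by
      rw [← add_sub_cancel (Ψ (Φ y)) y]
      refine Submodule.add_mem_sup ⟨_, rfl⟩ (h2 ?_)
      rw [LinearMap.mem_ker, map_sub, hΨ', sub_self]))
  refine ⟨(injective_iff_map_eq_zero Φ).mpr fun y hy => ?_, hs⟩
  obtain ⟨d, rfl⟩ := hs' y
  rw [hΨ'] at hy
  rw [hy, map_zero]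

lemma exists_opens_forall {T : TopCat.{u}} {κ : Type*} [Finite κ] {x : T}
    {p : κ → Opens T → Prop} (h : ∀ i, ∃ V : Opens T, x ∈ V ∧ ∀ W ≤ V, p i W) :
    ∃ V : Opens T, x ∈ V ∧ ∀ W ≤ V, ∀ i, p i W := by
  choose V hx hV using h
  exact ⟨⟨⋂ i, V i, isOpen_iInter_of_finite fun i => (V i).isOpen⟩, Set.mem_iInter.mpr hx,
    fun W hW i => hV i W fun y hy => Set.mem_iInter.mp (hW hy) i⟩

section LocalTriv

variable {k : Type u} [Field k] {T : TopCat.{u}} {R : AlgPresheaf k T}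
  {A : Type u} [CommRing A] [Algebra k A] {ε : A →ₐ[k] k}

/-- A function on the product with `Spec A` differs from its value on the closed fibre by a
nilpotent function. For `a ⊗ f` the difference is a multiple of `(a - ε a) ⊗ 1`, and sums of
commuting nilpotent elements are nilpotent. -/
lemma ker_specialize_le_jacobson (hε : ∀ a, ε a = 0 → IsNilpotent a) (V : Opens T) :
    RingHom.ker (specialize (R := R) ε V) ≤ Ideal.jacobson ⊥ := by
  have key : ∀ r : Fn (baseChange R A) V, IsNilpotent (r - tm 1 (specialize ε V r)) := by
    intro r
    induction r using Fn.induction with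
    | h0 =>
      rw [map_zero]
      have : (tm 1 0 : Fn (baseChange R A) V) = 0 := TensorProduct.tmul_zero _ _
      rw [this, sub_zero]
      exact IsNilpotent.zero
    | ha r s hr hs =>
      rw [map_add, tm_add_right, add_sub_add_comm]
      exact Commute.isNilpotent_add (Commute.all _ _) hr hs
    | ht a f =>
      have : (tm a f : Fn (baseChange R A) V) - tm 1 (specialize ε V (tm a f)) =
          tm (a - algebraMap k A (ε a)) 1 * tm 1 f := by
        rw [tm_mul_tm, mul_one, one_mul, specialize_tm, Algebra.algebraMap_eq_smul_one]
        exact ((TensorProduct.sub_tmul a (ε a • (1 : A)) f).trans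
          (congrArg _ (TensorProduct.smul_tmul (ε a) (1 : A) f))).symm
      rw [this]
      refine Commute.isNilpotent_mul_right (Commute.all _ _) ?_
      obtain ⟨n, hn⟩ := hε (a - algebraMap k A (ε a)) (by simp)
      have hpow : ∀ (b : A) (n : ℕ),
          (tm b 1 : Fn (baseChange R A) V) ^ n = tm (b ^ n) 1 := fun b n => by
        induction n with
        | zero => rw [pow_zero, pow_zero, tm_one_one]
        | succ n ih => rw [pow_succ, pow_succ, ih, tm_mul_tm, one_mul]
      exact ⟨n, by rw [hpow, hn]; exact TensorProduct.zero_tmul _ _⟩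
  intro r hr
  refine Ideal.radical_le_jacobson ?_
  have := key r
  rw [RingHom.mem_ker.mp hr] at this
  have h0 : (tm 1 0 : Fn (baseChange R A) V) = 0 := TensorProduct.tmul_zero _ _
  rw [h0, sub_zero] at this
  exact (mem_nilradical.mpr this)

variable {P : PoissonStructure R} {E : PoissonBundle P}

/-- The morphism `F ⊗ A → M'` induced by a morphism `F → M'`. -/
def splitMap {M' : PMod (baseChange R A)} {M : PMod R} {U : Opens T}
    {σ : ∀ V, V ≤ U → Sec M V → Sec M' V} (hσ : IsLinMap (incl A) σ) (V : Opens T) (h : V ≤ U) :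
    A ⊗[k] Sec M V →ₗ[Fn (baseChange R A) V] Sec M' V :=
  let l : A ⊗[k] Sec M V →+ Sec M' V := TensorProduct.liftAddHom
      (AddMonoidHom.mk' (fun a => AddMonoidHom.mk'
        (fun m => (tm a 1 : Fn (baseChange R A) V) • σ V h m)
        fun m n => by rw [hσ.add, smul_add])
        fun a b => by ext m; simp [tm_add_left, add_smul])
      fun c a m => by
        change (tm (c • a) 1 : Fn (baseChange R A) V) • σ V h m =
          (tm a 1 : Fn (baseChange R A) V) • σ V h (c • m)
        rw [← algebraMap_smul (Fn R V) c m, hσ.smul, smul_smul, incl_apply, tm_mul_tm, mul_one,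
          one_mul, Algebra.algebraMap_eq_smul_one]
        exact congrArg (· • σ V h m) (TensorProduct.smul_tmul c a 1)
  { l with
    map_smul' := fun r x => by
      change l (r • x) = r • l x
      induction r using Fn.induction with
      | h0 => simp
      | ha r s hr hs => rw [add_smul, map_add, hr, hs, add_smul]
      | ht b f =>
        induction x using tensor_induction with
        | h0 => simp
        | ha x y hx hy => rw [smul_add, map_add, hx, hy, map_add, smul_add]
        | ht a m =>
          rw [tm_smul_tmul]
          change (tm (b * a) 1 : Fn (baseChange R A) V) • σ V h (f • m) =
            (tm b f : Fn (baseChange R A) V) • (tm a 1 : Fn (baseChange R A) V) • σ V h m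
          rw [hσ.smul, smul_smul, smul_smul, incl_apply, tm_mul_tm, tm_mul_tm, mul_one, mul_one,
            one_mul] }

lemma splitMap_tmul {M' : PMod (baseChange R A)} {M : PMod R} {U : Opens T}
    {σ : ∀ V, V ≤ U → Sec M V → Sec M' V} (hσ : IsLinMap (incl A) σ) (V : Opens T) (h : V ≤ U)
    (a : A) (m : Sec M V) :
    splitMap hσ V h (a ⊗ₜ m) = (tm a 1 : Fn (baseChange R A) V) • σ V h m := rfl

lemma res_splitMap {M' : PMod (baseChange R A)} {M : PMod R} {U : Opens T}
    {σ : ∀ V, V ≤ U → Sec M V → Sec M' V} (hσ : IsLinMap (incl A) σ) {W V : Opens T} (hWV : W ≤ V)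
    (h : V ≤ U) (x : A ⊗[k] Sec M V) :
    Sec.res hWV (splitMap hσ V h x) = splitMap hσ W (hWV.trans h) (resB A hWV x) := by
  induction x using tensor_induction with
  | h0 => simp
  | ha x y hx hy => simp only [map_add, hx, hy]
  | ht a m => rw [resB_tmul, splitMap_tmul, splitMap_tmul, Sec.res_smul, res_tm, map_one, hσ.res]

lemma Deformation.restr_splitMap (D : Deformation E ε) {U : Opens T}
    {σ : ∀ V, V ≤ U → Sec E.M V → Sec D.bundle.M V} (hσ : IsLinMap (incl A) σ)
    (hσε : ∀ V h m, D.restr.hom V (σ V h m) = m) (V : Opens T) (h : V ≤ U)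
    (x : A ⊗[k] Sec E.M V) :
    D.restr.hom V (splitMap hσ V h x) = slice ε.toLinearMap x := by
  induction x using tensor_induction with
  | h0 => simp
  | ha x y hx hy => simp only [map_add, hx, hy]
  | ht a m =>
    rw [splitMap_tmul, D.restr.hom_smul, hσε, specialize_tm, slice_tmul, smul_assoc, one_smul]
    rfl

lemma res_mem_ker_smul_top {M' : PMod (baseChange R A)} {W V : Opens T} (h : W ≤ V) (m : Sec M' V)
    (hm : m ∈ RingHom.ker (specialize (R := R) ε V) • (⊤ : Submodule (Fn (baseChange R A) V) _)) :
    Sec.res h m ∈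
      RingHom.ker (specialize (R := R) ε W) • (⊤ : Submodule (Fn (baseChange R A) W) _) := by
  induction hm using Submodule.smul_induction_on' with
  | smul r hr m _ =>
    rw [Sec.res_smul]
    refine Submodule.smul_mem_smul ?_ trivial
    rw [RingHom.mem_ker, ← res_specialize, RingHom.mem_ker.mp hr, map_zero]
  | add x _ y _ hx hy => rw [map_add]; exact add_mem hx hy

/-- A basis as in the definition of locally free sheaves. -/
def basisOfBijective {Q N : Type*} [CommRing Q] [AddCommGroup N] [Module Q N] {n : ℕ}
    {e : Fin n → N} (he : Function.Bijective fun c : Fin n → Q => ∑ i, c i • e i) :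
    Module.Basis (Fin n) Q N :=
  Module.Basis.ofEquivFun (LinearEquiv.ofBijective (Fintype.linearCombination Q e) he).symm

/-- The map from `F ⊗ A` to `D` is compatible with the projections to `F`, so it is surjective and
injective modulo the kernel of `ε`. Nakayama's lemma finishes the proof near each point, where both
sheaves are free, and bijectivity is local. The ranks need not be compared beforehand. -/
lemma Deformation.bijective_splitMap [Module.Finite k A] (hε : ∀ a, ε a = 0 → IsNilpotent a)
    (D : Deformation E ε) {U : Opens T}
    {σ : ∀ V, V ≤ U → Sec E.M V → Sec D.bundle.M V} (hσ : IsLinMap (incl A) σ)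
    (hσε : ∀ V h m, D.restr.hom V (σ V h m) = m) (V : Opens T) (h : V ≤ U) :
    Function.Bijective (splitMap hσ V h) := by
  refine (isSheafOn_tensor (B := A) E.isSheaf).bijective_of_locally
    (isSheafOn_sec D.bundle.isSheaf) (fun V h => splitMap hσ V h)
    (fun hWV h x => res_splitMap hσ hWV h x) (fun x hx => ?_) V h
  obtain ⟨V₁, hx₁, n, e, he⟩ := E.locallyFree.exists_basis x
  obtain ⟨V₂, hx₂, r, d, hd⟩ := D.bundle.locallyFree.exists_basis x
  have hV₁ : V₁ ⊓ V₂ ⊓ U ≤ V₁ := inf_le_left.trans inf_le_left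
  have hV₂ : V₁ ⊓ V₂ ⊓ U ≤ V₂ := inf_le_left.trans inf_le_right
  replace he := he.res hV₁
  replace hd := hd.res hV₂
  generalize (fun i => Sec.res hV₁ (e i)) = e at he
  generalize (fun i => Sec.res hV₂ (d i)) = d at hd
  clear hV₁ hV₂
  have hxV : x ∈ V₁ ⊓ V₂ ⊓ U := ⟨⟨hx₁, hx₂⟩, hx⟩
  have hVU : V₁ ⊓ V₂ ⊓ U ≤ U := inf_le_right
  generalize V₁ ⊓ V₂ ⊓ U = V at *
  -- Each basis section of `D` differs from a section in the image of the splitting by an element of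
  -- the kernel of restriction to `F`. By the definition of `Restriction` this kernel is only
  -- locally generated by the kernel of the map of rings, so the neighbourhood has to shrink.
  have key : ∀ i : Fin r, ∃ W : Opens T, x ∈ W ∧ ∀ W' ≤ W, ∀ h : W' ≤ V,
      Sec.res h (d i - σ V hVU (D.restr.hom V (d i))) ∈ RingHom.ker (specialize (R := R) ε W') •
        (⊤ : Submodule (Fn (baseChange R A) W') _) := by
    intro i
    obtain ⟨W, hW, hxW, hW'⟩ := D.restr.ker V (d i - σ V hVU (D.restr.hom V (d i)))
      (by rw [map_sub, hσε, sub_self]) x hxV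
    refine ⟨W, hxW, fun W' hWW h => ?_⟩
    have := res_mem_ker_smul_top hWW _ hW'
    rwa [Sec.res_res] at this
  obtain ⟨W, hxW, hW⟩ := exists_opens_forall key
  refine ⟨W ⊓ V, ⟨hxW, hxV⟩, fun W' hW'U hW' => ?_⟩
  have hW'V := hW'.trans inf_le_right
  have b₁ := basisOfBijective (bijective_sum_smul_one_tmul (B := A) (he _ hW'V))
  let b₂ := basisOfBijective (hd _ hW'V)
  have := Module.Finite.of_basis b₁
  have := Module.Finite.of_basis b₂
  have := Module.Projective.of_basis b₂
  refine bijective_of_le_jacobson (ker_specialize_le_jacobson (R := R) hε W') (splitMap hσ W' hW'U)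
    (fun y _ => ?_) fun y hy => ?_
  · obtain ⟨c, rfl⟩ := (hd _ hW'V).2 y
    refine Submodule.sum_mem _ fun i _ => Submodule.smul_mem _ _ ?_
    rw [← add_sub_cancel (Sec.res hW'V (σ V hVU (D.restr.hom V (d i)))) (Sec.res hW'V (d i)),
      ← map_sub]
    refine Submodule.add_mem_sup ⟨1 ⊗ₜ Sec.res hW'V (D.restr.hom V (d i)), ?_⟩
      (hW W' (hW'.trans inf_le_left) i hW'V)
    rw [splitMap_tmul, tm_one_one, one_smul, hσ.res]
  · refine mem_smul_top_of_slice_eq_zero ε y ?_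
    rw [← D.restr_splitMap hσ hσε W' hW'U, LinearMap.mem_ker.mp hy, map_zero]

/-- The trivialization given by a splitting of `D → F`. -/
def Deformation.localTrivOfSplitting [Module.Finite k A] (hε : ∀ a, ε a = 0 → IsNilpotent a)
    (D : Deformation E ε) {U : Opens T}
    {σ : ∀ V, V ≤ U → Sec E.M V → Sec D.bundle.M V} (hσ : IsLinMap (incl A) σ)
    (hσε : ∀ V h m, D.restr.hom V (σ V h m) = m) : LocalTriv D U where
  equiv V h := AddEquiv.ofBijective (splitMap hσ V h) (D.bijective_splitMap hε hσ hσε V h)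
  equiv_smul V h a b f m := by
    rw [← tm_smul_tmul, AddEquiv.ofBijective_apply, AddEquiv.ofBijective_apply]
    exact (splitMap hσ V h).map_smul _ _
  res_equiv hWV h a m := by
    rw [AddEquiv.ofBijective_apply, AddEquiv.ofBijective_apply]
    exact res_splitMap hσ hWV h _
  restr_equiv V h a m := by
    rw [AddEquiv.ofBijective_apply]
    exact (D.restr_splitMap hσ hσε V h _).trans (slice_tmul _ _ _)

lemma Deformation.localTrivOfSplitting_equiv [Module.Finite k A]
    (hε : ∀ a, ε a = 0 → IsNilpotent a) (D : Deformation E ε) {U : Opens T}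
    {σ : ∀ V, V ≤ U → Sec E.M V → Sec D.bundle.M V} (hσ : IsLinMap (incl A) σ)
    (hσε : ∀ V h m, D.restr.hom V (σ V h m) = m) (V : Opens T) (h : V ≤ U) (x : A ⊗[k] Sec E.M V) :
    (D.localTrivOfSplitting hε hσ hσε).equiv V h x = splitMap hσ V h x :=
  AddEquiv.ofBijective_apply _ _ _

/-- Deformations are locally split extensions of `F`. -/
lemma Deformation.exists_local_splitting (D : Deformation E ε) (x : T) :
    ∃ V : Opens T, x ∈ V ∧ ∃ σ : ∀ W, W ≤ V → Sec E.M W → Sec D.bundle.M W,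
      IsLinMap (incl A) σ ∧ ∀ W h m, D.restr.hom W (σ W h m) = m := by
  obtain ⟨V, hxV, n, e, he⟩ := E.locallyFree.exists_basis x
  have key : ∀ i, ∃ W : Opens T, x ∈ W ∧ ∀ W' ≤ W, ∀ h : W' ≤ V, ∃ y : Sec D.bundle.M W',
      D.restr.hom W' y = Sec.res h (e i) := by
    intro i
    obtain ⟨W, h, y, hxW, hy⟩ := D.restr.surj V (e i) x hxV
    exact ⟨W, hxW, fun W' hW h' => ⟨Sec.res hW y, by
      rw [← D.restr.res_hom, hy, Sec.res_res]⟩⟩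
  obtain ⟨W, hxW, hW⟩ := exists_opens_forall key
  have hWV : W ⊓ V ≤ V := inf_le_right
  choose y hy using fun i => hW (W ⊓ V) inf_le_left i hWV
  obtain ⟨σ, hσ, hσe⟩ := exists_linMap_of_basis (ρ := incl A) (M' := D.bundle.M)
    (fun _ _ => rfl) (he.res hWV) y
  refine ⟨W ⊓ V, ⟨hxW, hxV⟩, σ, hσ, fun W' h m => ?_⟩
  -- The composite of `σ` with the restriction to `F` is linear over functions, so it is the
  -- identity as soon as it fixes a basis.
  have h1 : IsLinMap (fun V => RingHom.id (Fn R V)) fun W' (h : W' ≤ W ⊓ V) m =>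
      D.restr.hom W' (σ W' h m) :=
    ⟨fun V h m n => by rw [hσ.add, map_add], fun V h f m => by
      rw [hσ.smul, D.restr.hom_smul, incl_apply, specialize_tm, map_one, one_smul]; rfl,
      fun hWV h m => by rw [D.restr.res_hom, hσ.res]⟩
  have h2 : IsLinMap (fun V => RingHom.id (Fn R V)) fun W' (_ : W' ≤ W ⊓ V) (m : Sec E.M W') => m :=
    ⟨fun V h m n => rfl, fun V h f m => rfl, fun hWV h m => rfl⟩
  exact h1.eq_of_basis h2 (he.res hWV) (fun i => by rw [hσe, hy]) W' h m

/-- Evaluation of a linear form on the coefficients of a function. -/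
def fnSlice (l : A →ₗ[k] k) (V : Opens T) : Fn (baseChange R A) V →+ Fn R V :=
  (slice (G := Fn R V) l).toAddMonoidHom

lemma fnSlice_tm (l : A →ₗ[k] k) (V : Opens T) (a : A) (f : Fn R V) :
    fnSlice l V (tm a f) = l a • f :=
  slice_tmul l a f

lemma res_fnSlice (l : A →ₗ[k] k) {W V : Opens T} (h : W ≤ V) (y : Fn (baseChange R A) V) :
    Fn.res h (fnSlice l V y) = fnSlice l W (Fn.res h y) := by
  induction y using Fn.induction with
  | h0 => simp
  | ha x y hx hy => simp only [map_add, hx, hy]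
  | ht a f => rw [res_tm, fnSlice_tm, fnSlice_tm, map_smul]

lemma eq_sum_tm {κ : Type*} [Fintype κ] (b : Module.Basis κ k A) {V : Opens T}
    (y : Fn (baseChange R A) V) : y = ∑ i, tm (b i) (fnSlice (b.coord i) V y) :=
  eq_sum_slice (G := Fn R V) b y

/-- Functions on the product with `Spec A` are compatible with localization. -/
lemma AffineBasis.IsLoc.incl [Module.Finite k A] {U : Opens T} {a : AffineBasis R U}
    (hid : a.IsLoc fun V => RingHom.id (Fn R V)) : a.IsLoc (incl (R := R) A) where
  inj g f y hy := by
    let b := Module.finBasis k A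
    have hy' : ∀ i, Fn.res (a.D_mul_le_left g f) (fnSlice (b.coord i) _ y) = 0 :=
      fun i => by rw [res_fnSlice, hy, map_zero]
    filter_upwards [Filter.eventually_all.mpr fun i => hid.inj g f _ (hy' i)] with N hN
    simp only [RingHom.id_apply] at hN
    rw [eq_sum_tm b y, Finset.mul_sum]
    refine Finset.sum_eq_zero fun i _ => ?_
    rw [← map_pow, incl_apply, tm_mul_tm, hN]
    exact TensorProduct.tmul_zero _ _
  surj g f y := by
    let b := Module.finBasis k A
    filter_upwards [Filter.eventually_all.mpr fun i =>
      hid.surj g f (fnSlice (b.coord i) _ y)] with N hN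
    choose y' hy' using hN
    refine ⟨∑ i, tm (b i) (y' i), ?_⟩
    rw [map_sum, eq_sum_tm b y, Finset.mul_sum]
    refine Finset.sum_congr rfl fun i _ => ?_
    rw [← map_pow, incl_apply, tm_mul_tm, res_tm, hy', one_mul, RingHom.id_apply]

/-- Deformations are trivial as deformations of modules over affine open subsets. -/
lemma Deformation.nonempty_localTriv [Module.Finite k A] (hε : ∀ a, ε a = 0 → IsNilpotent a)
    (D : Deformation E ε) {U : Opens T} {a : AffineBasis R U}
    (hid : a.IsLoc fun V => RingHom.id (Fn R V)) : Nonempty (LocalTriv D U) := by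
  obtain ⟨σ, hσ, hσε⟩ := (hid.incl (A := A)).exists_splitting (fun _ _ => rfl) E.locallyFree
    D.bundle.locallyFree (isSheafOn_sec D.bundle.isSheaf) hid (isSheafOn_sec E.isSheaf) D.restr.hom
    D.restr.res_hom (fun V f m => by
      rw [D.restr.hom_smul, incl_apply, specialize_tm, map_one, one_smul])
    fun x _ => D.exists_local_splitting x
  exact ⟨D.localTrivOfSplitting hε hσ hσε⟩

end LocalTriv

/-! ### Affine open subsets of schemes and local Artinian algebras -/

section Affine

variable {k : Type u} [CommRing k] {X : Scheme.{u}} (p : X ⟶ Spec (CommRingCat.of k))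

/-- The basic open subsets of an affine open subset. -/
def affineBasis {U : X.Opens} (hU : IsAffineOpen U) : AffineBasis (structureSheaf p) U where
  D f := X.basicOpen (show Γ(X, U) from f)
  D_le f := X.basicOpen_le _
  D_mul f g := X.basicOpen_mul _ _
  exists_le V hV x hx := by
    obtain ⟨f, h1, h2⟩ := hU.exists_basicOpen_le ⟨x, hx⟩ (hV hx)
    exact ⟨f, h2, h1⟩
  span_eq_top s := (hU.self_le_iSup_basicOpen_iff (s := s)).symm

-- The set `D (g f)` is a basic open subset of `D g`, which is again affine, so its functions are a
-- localization of those on `D g`.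
omit p in
lemma exists_pow_mul_eq_zero {U : X.Opens} (hU : IsAffineOpen U) (g f : Γ(X, U))
    (hle : X.basicOpen (g * f) ≤ X.basicOpen g) (y : Γ(X, X.basicOpen g))
    (hy : X.presheaf.map (homOfLE hle).op y = 0) :
    ∃ N : ℕ, X.presheaf.map (homOfLE (X.basicOpen_le g)).op f ^ N * y = 0 := by
  let _ := (X.presheaf.map (homOfLE hle).op).hom.toAlgebra
  have := (hU.basicOpen g).isLocalization_of_eq_basicOpen
    (X.presheaf.map (homOfLE (X.basicOpen_le g)).op f) (homOfLE hle)
    (by rw [X.basicOpen_res, X.basicOpen_mul])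
  obtain ⟨⟨_, N, rfl⟩, hN⟩ := (IsLocalization.map_eq_zero_iff
    (Submonoid.powers (X.presheaf.map (homOfLE (X.basicOpen_le g)).op f))
    Γ(X, X.basicOpen (g * f)) y).mp hy
  exact ⟨N, hN⟩

omit p in
lemma exists_map_eq_mul_pow {U : X.Opens} (hU : IsAffineOpen U) (g f : Γ(X, U))
    (hle : X.basicOpen (g * f) ≤ X.basicOpen g) (y : Γ(X, X.basicOpen (g * f))) :
    ∃ (N : ℕ) (z : Γ(X, X.basicOpen g)), y * X.presheaf.map (homOfLE hle).op
      (X.presheaf.map (homOfLE (X.basicOpen_le g)).op f ^ N) =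
        X.presheaf.map (homOfLE hle).op z := by
  let _ := (X.presheaf.map (homOfLE hle).op).hom.toAlgebra
  have := (hU.basicOpen g).isLocalization_of_eq_basicOpen
    (X.presheaf.map (homOfLE (X.basicOpen_le g)).op f) (homOfLE hle)
    (by rw [X.basicOpen_res, X.basicOpen_mul])
  obtain ⟨⟨z, ⟨_, N, rfl⟩⟩, hN⟩ := IsLocalization.surj
    (Submonoid.powers (X.presheaf.map (homOfLE (X.basicOpen_le g)).op f)) y
  exact ⟨N, z, hN⟩

lemma isLoc_affineBasis {U : X.Opens} (hU : IsAffineOpen U) :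
    (affineBasis p hU).IsLoc fun V => RingHom.id (Fn (structureSheaf p) V) := by
  constructor
  · intro g f y hy
    obtain ⟨N, hN⟩ := exists_pow_mul_eq_zero hU g f ((affineBasis p hU).D_mul_le_left g f) y hy
    filter_upwards [Filter.eventually_ge_atTop N] with K hK
    obtain ⟨j, rfl⟩ := Nat.exists_eq_add_of_le hK
    rw [add_comm, pow_add, mul_assoc]
    exact (congrArg _ hN).trans (mul_zero _)
  · intro g f y
    obtain ⟨N, z, hN⟩ := exists_map_eq_mul_pow hU g f ((affineBasis p hU).D_mul_le_left g f) y
    filter_upwards [Filter.eventually_ge_atTop N] with K hK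
    obtain ⟨j, rfl⟩ := Nat.exists_eq_add_of_le hK
    have h1 : Fn.res ((affineBasis p hU).D_mul_le_left g f)
        (show Fn (structureSheaf p) ((affineBasis p hU).D g) from z) =
        y * Fn.res ((affineBasis p hU).D_mul_le_left g f)
          (Fn.res ((affineBasis p hU).D_le g) f) ^ N := by
      rw [← map_pow]
      exact hN.symm
    refine ⟨Fn.res ((affineBasis p hU).D_le g) f ^ j *
      (show Fn (structureSheaf p) ((affineBasis p hU).D g) from z), ?_⟩
    rw [map_mul, h1, map_pow, Fn.res_res, RingHom.id_apply, pow_add]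
    ring

end Affine

section Artinian

variable {k : Type u} [Field k] {A : Type u} [CommRing A] [IsLocalRing A] [IsArtinianRing A]
  [Algebra k A] (ε : A →ₐ[k] k)
include ε

omit [IsArtinianRing A] in
lemma ker_eq_maximalIdeal : RingHom.ker ε = IsLocalRing.maximalIdeal A :=
  IsLocalRing.eq_maximalIdeal (RingHom.ker_isMaximal_of_surjective ε fun c =>
    ⟨algebraMap k A c, by simp⟩)

lemma isNilpotent_of_eq_zero (a : A) (ha : ε a = 0) : IsNilpotent a := by
  have h1 : a ∈ IsLocalRing.maximalIdeal A := ker_eq_maximalIdeal ε ▸ ha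
  rw [← IsLocalRing.jacobson_eq_maximalIdeal ⊥ bot_ne_top] at h1
  obtain ⟨n, hn⟩ := IsArtinianRing.isNilpotent_jacobson_bot (R := A)
  exact ⟨n, by simpa [hn] using Ideal.pow_mem_pow h1 n⟩

/-- A local Artinian algebra with residue field `k` is finite dimensional. -/
lemma finite_of_isArtinianRing : Module.Finite k A := by
  have hres : ∀ a : A, a - algebraMap k A (ε a) ∈ IsLocalRing.maximalIdeal A := fun a => by
    rw [← ker_eq_maximalIdeal ε, RingHom.mem_ker]
    simp
  -- The induction is along finite length. A simple quotient is the residue field of `A`, which is a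
  -- line over `k` because every `a` is congruent to the scalar `ε a`.
  have key : ∀ (N : Type u) [AddCommGroup N] [Module A N], IsFiniteLength A N →
      ∀ [Module k N] [IsScalarTower k A N], Module.Finite k N := by
    intro N _ _ h
    induction h with
    | of_subsingleton => intros; infer_instance
    | @of_simple_quotient M _ _ N hsimple hN ih =>
      intro _ _
      obtain ⟨I, hI, ⟨e⟩⟩ := isSimpleModule_iff_quot_maximal.mp hsimple
      rw [IsLocalRing.eq_maximalIdeal hI] at e
      have h1 : Module.Finite k (A ⧸ IsLocalRing.maximalIdeal A) := by
        refine Module.Finite.of_surjective (Algebra.linearMap k _) fun x => ?_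
        obtain ⟨a, rfl⟩ := Ideal.Quotient.mk_surjective x
        exact ⟨ε a, (Ideal.Quotient.eq.mpr (hres a)).symm⟩
      have h2 : Module.Finite k (M ⧸ N) := Module.Finite.equiv (e.restrictScalars k).symm
      have h3 : Module.Finite k (M ⧸ N.restrictScalars k) :=
        Module.Finite.equiv (Submodule.Quotient.restrictScalarsEquiv k N).symm
      have h4 : Module.Finite k (N.restrictScalars k) := ih
      exact Module.Finite.of_submodule_quotient (N.restrictScalars k)
  exact key A ((isArtinianRing_iff_isFiniteLength A).mp inferInstance)

end Artinian

/-! ### Connections and endomorphisms of `F ⊗ B` -/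

section Operators

variable {k : Type u} [Field k] {T : TopCat.{u}} {R : AlgPresheaf k T} {P : PoissonStructure R}
  (E : PoissonBundle P) {A B : Type u} [CommRing A] [Algebra k A] [CommRing B] [Algebra k B]

/-- `C` is a Poisson connection, not necessarily flat, on `F ⊗ B` over `U` that induces the given
connection on `F`. -/
structure IsConnOn (ε : B →ₐ[k] k) {U : Opens T}
    (C : ∀ V, V ≤ U → Fn R V →ₗ[k] Module.End B (B ⊗[k] Sec E.M V)) : Prop where
  conn_mul : ∀ V h f g x, C V h (f * g) x = act B f (C V h g x) + act B g (C V h f x)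
  conn_act : ∀ V h f g x, C V h f (act B g x) = act B (P.br V f g) x + act B g (C V h f x)
  conn_res : ∀ {W V : Opens T} (hWV : W ≤ V) (h : V ≤ U) f x,
    resB B hWV (C V h f x) = C W (hWV.trans h) (Fn.res hWV f) (resB B hWV x)
  conn_slice : ∀ V h f x, slice ε.toLinearMap (C V h f x) = E.conn V f (slice ε.toLinearMap x)

/-- `θ` is an endomorphism of `F ⊗ B` over `U` that induces the identity on `F`. -/
structure IsHomOn (ε : B →ₐ[k] k) {U : Opens T}
    (θ : ∀ V, V ≤ U → Module.End B (B ⊗[k] Sec E.M V)) : Prop where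
  hom_act : ∀ V h g x, θ V h (act B g x) = act B g (θ V h x)
  hom_res : ∀ {W V : Opens T} (hWV : W ≤ V) (h : V ≤ U) x,
    resB B hWV (θ V h x) = θ W (hWV.trans h) (resB B hWV x)
  hom_slice : ∀ V h x, slice ε.toLinearMap (θ V h x) = slice ε.toLinearMap x

variable {E}

lemma IsConnOn.restrict {ε : B →ₐ[k] k} {U U' : Opens T} (hU : U' ≤ U)
    {C : ∀ V, V ≤ U → Fn R V →ₗ[k] Module.End B (B ⊗[k] Sec E.M V)} (hC : IsConnOn E ε C) :
    IsConnOn E ε fun V (h : V ≤ U') => C V (h.trans hU) :=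
  ⟨fun _ _ => hC.conn_mul _ _, fun _ _ => hC.conn_act _ _, fun h _ => hC.conn_res h _, fun _ _ => hC.conn_slice _ _⟩

lemma IsHomOn.restrict {ε : B →ₐ[k] k} {U U' : Opens T} (hU : U' ≤ U)
    {θ : ∀ V, V ≤ U → Module.End B (B ⊗[k] Sec E.M V)} (hθ : IsHomOn E ε θ) :
    IsHomOn E ε fun V (h : V ≤ U') => θ V (h.trans hU) :=
  ⟨fun _ _ => hθ.hom_act _ _, fun h _ => hθ.hom_res h _, fun _ _ => hθ.hom_slice _ _⟩

lemma IsHomOn.one {ε : B →ₐ[k] k} {U : Opens T} :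
    IsHomOn E ε fun V (_ : V ≤ U) => (1 : Module.End B (B ⊗[k] Sec E.M V)) :=
  ⟨fun _ _ _ _ => rfl, fun _ _ _ => rfl, fun _ _ _ => rfl⟩

lemma IsHomOn.comp {ε : B →ₐ[k] k} {U : Opens T}
    {θ θ' : ∀ V, V ≤ U → Module.End B (B ⊗[k] Sec E.M V)} (hθ : IsHomOn E ε θ)
    (hθ' : IsHomOn E ε θ') : IsHomOn E ε fun V h => θ V h * θ' V h :=
  ⟨fun V h g x => by simp only [Module.End.mul_apply, hθ'.hom_act, hθ.hom_act],
    fun hWV h x => by simp only [Module.End.mul_apply, hθ'.hom_res, hθ.hom_res],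
    fun V h x => by simp only [Module.End.mul_apply, hθ'.hom_slice, hθ.hom_slice]⟩

lemma act_sub_left {V : Opens T} {M : PMod R} (f g : Fn R V) (x : B ⊗[k] Sec M V) :
    act B (f - g) x = act B f x - act B g x := by
  simp [act]

lemma act_eq_smul {V : Opens T} {M : PMod R} (f : Fn R V) (x : B ⊗[k] Sec M V) :
    act B f x = (tm 1 f : Fn (baseChange R B) V) • x := by
  rw [tm_smul, one_smul]

lemma slice_act {V : Opens T} {M : PMod R} (l : B →ₗ[k] k) (f : Fn R V) (x : B ⊗[k] Sec M V) :
    slice l (act B f x) = f • slice l x := by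
  induction x using tensor_induction with
  | h0 => simp
  | ha x y hx hy => simp only [map_add, hx, hy, smul_add]
  | ht b m => rw [act_tmul, slice_tmul, slice_tmul, smul_comm]

/-- The connection of `F`, extended to `F ⊗ B`. -/
def constConn (E : PoissonBundle P) (B : Type u) [CommRing B] [Algebra k B] (V : Opens T) :
    Fn R V →ₗ[k] Module.End B (B ⊗[k] Sec E.M V) :=
  LinearMap.baseChangeHom k B (Sec E.M V) (Sec E.M V) ∘ₗ E.conn V

lemma constConn_tmul {V : Opens T} (f : Fn R V) (b : B) (m : Sec E.M V) :
    constConn E B V f (b ⊗ₜ m) = b ⊗ₜ E.conn V f m := rfl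

lemma isConnOn_constConn (ε : B →ₐ[k] k) (U : Opens T) :
    IsConnOn E ε fun V (_ : V ≤ U) => constConn E B V where
  conn_mul V h f g x := by
    induction x using tensor_induction with
    | h0 => simp
    | ha x y hx hy => simp only [map_add, hx, hy]; abel
    | ht b m => simp only [constConn_tmul, E.conn_mul, act_tmul, TensorProduct.tmul_add]
  conn_act V h f g x := by
    induction x using tensor_induction with
    | h0 => simp
    | ha x y hx hy => simp only [map_add, hx, hy]; abel
    | ht b m => simp only [constConn_tmul, E.conn_smul, act_tmul, TensorProduct.tmul_add]
  conn_res hWV h f x := by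
    induction x using tensor_induction with
    | h0 => simp
    | ha x y hx hy => simp only [map_add, hx, hy]
    | ht b m => simp only [constConn_tmul, resB_tmul, E.res_conn]
  conn_slice V h f x := by
    induction x using tensor_induction with
    | h0 => simp
    | ha x y hx hy => simp only [map_add, hx, hy]
    | ht b m => simp only [constConn_tmul, slice_tmul, map_smul]

/-! ### Lifting of operators -/

/-- The extension of a `k`-linear map `F → F ⊗ B` to `F ⊗ B`. -/
def extend {G : Type u} [AddCommGroup G] [Module k G] :
    (G →ₗ[k] B ⊗[k] G) →ₗ[k] Module.End B (B ⊗[k] G) where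
  toFun n := n.liftBaseChange B
  map_add' m n := by ext; simp
  map_smul' c n := by ext; simp

lemma extend_tmul {G : Type u} [AddCommGroup G] [Module k G] (n : G →ₗ[k] B ⊗[k] G) (b : B)
    (m : G) : extend n (b ⊗ₜ m) = b • n m :=
  LinearMap.liftBaseChange_tmul (A := B) n b m

lemma exists_linear_section (μ : B →ₐ[k] A) (hμ : Function.Surjective μ) (ε : A →ₐ[k] k) :
    ∃ s : A →ₗ[k] B, (∀ a, μ (s a) = a) ∧ s 1 = 1 := by
  obtain ⟨s, hs⟩ := μ.toLinearMap.exists_rightInverse_of_surjective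
    (LinearMap.range_eq_top.mpr hμ)
  have hs' : ∀ a, μ (s a) = a := fun a => congr($hs a)
  -- The correction normalizes the value at `1`, since `ε 1 = 1`. It does not affect `μ (s a) = a`,
  -- since `μ (1 - s 1) = 0`.
  refine ⟨s + ε.toLinearMap.smulRight (1 - s 1), fun a => ?_, ?_⟩
  · simp [hs']
  · simp

/-- The operator on `F ⊗ B` that lifts an operator on `F ⊗ A`. -/
def liftOp (s : A →ₗ[k] B) (G : Type u) [AddCommGroup G] [Module k G] :
    Module.End A (A ⊗[k] G) →ₗ[k] Module.End B (B ⊗[k] G) where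
  toFun N := extend (LinearMap.rTensor G s ∘ₗ N.restrictScalars k ∘ₗ
    TensorProduct.mk k A G 1)
  map_add' m n := by
    rw [← map_add]
    congr 1
    ext
    simp
  map_smul' c n := by
    rw [← map_smul]
    congr 1
    ext
    simp

lemma liftOp_tmul (s : A →ₗ[k] B) {G : Type u} [AddCommGroup G] [Module k G]
    (N : Module.End A (A ⊗[k] G)) (b : B) (m : G) :
    liftOp s G N (b ⊗ₜ m) = b • LinearMap.rTensor G s (N (1 ⊗ₜ m)) :=
  extend_tmul _ _ _

lemma rTensor_algHom_smul (μ : B →ₐ[k] A) {G : Type u} [AddCommGroup G] [Module k G] (b : B)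
    (x : B ⊗[k] G) : LinearMap.rTensor G μ.toLinearMap (b • x) =
      μ b • LinearMap.rTensor G μ.toLinearMap x := by
  induction x using TensorProduct.induction_on with
  | zero => simp
  | add x y hx hy => simp only [smul_add, map_add, hx, hy]
  | tmul c m => simp [TensorProduct.smul_tmul']

lemma rTensor_rTensor_section (μ : B →ₐ[k] A) {s : A →ₗ[k] B} (hs : ∀ a, μ (s a) = a)
    {G : Type u} [AddCommGroup G] [Module k G] (x : A ⊗[k] G) :
    LinearMap.rTensor G μ.toLinearMap (LinearMap.rTensor G s x) = x := by
  induction x using TensorProduct.induction_on with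
  | zero => simp
  | add x y hx hy => simp only [map_add, hx, hy]
  | tmul c m => simp [hs]

lemma rTensor_liftOp (μ : B →ₐ[k] A) {s : A →ₗ[k] B} (hs : ∀ a, μ (s a) = a)
    {G : Type u} [AddCommGroup G] [Module k G] (N : Module.End A (A ⊗[k] G)) (x : B ⊗[k] G) :
    LinearMap.rTensor G μ.toLinearMap (liftOp s G N x) =
      N (LinearMap.rTensor G μ.toLinearMap x) := by
  induction x using TensorProduct.induction_on with
  | zero => simp
  | add x y hx hy => simp only [map_add, hx, hy]
  | tmul b m =>
    rw [liftOp_tmul, rTensor_algHom_smul, rTensor_rTensor_section μ hs, ← map_smul,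
      TensorProduct.smul_tmul']
    simp

variable {M : PMod R}

lemma act_smul {V : Opens T} (f : Fn R V) (b : B) (x : B ⊗[k] Sec M V) :
    act B f (b • x) = b • act B f x := map_smul _ _ _

/-- The section `s` is only linear, so `liftOp s` does not respect composition in general. It does
respect composition with `act`, which preserves `1 ⊗ F` and commutes with a change of coefficients.
For this reason the Leibniz rules survive lifting, while flatness and the cocycle condition need
not. -/
lemma liftOp_act (s : A →ₗ[k] B) {V : Opens T} (N N' : Module.End A (A ⊗[k] Sec M V))
    (g : Fn R V) (h : ∀ x, N (act A g x) = N' x) (x : B ⊗[k] Sec M V) :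
    liftOp s _ N (act B g x) = liftOp s _ N' x := by
  induction x using tensor_induction with
  | h0 => simp
  | ha x y hx hy => simp only [map_add, hx, hy]
  | ht b m => rw [act_tmul, liftOp_tmul, liftOp_tmul, ← h, act_tmul]

lemma act_liftOp (s : A →ₗ[k] B) {V : Opens T} (N N' : Module.End A (A ⊗[k] Sec M V))
    (g : Fn R V) (h : ∀ x, act A g (N x) = N' x) (x : B ⊗[k] Sec M V) :
    act B g (liftOp s _ N x) = liftOp s _ N' x := by
  induction x using tensor_induction with
  | h0 => simp
  | ha x y hx hy => simp only [map_add, hx, hy]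
  | ht b m => rw [liftOp_tmul, liftOp_tmul, ← h, act_smul, rTensor_act]

lemma resB_liftOp (s : A →ₗ[k] B) {W V : Opens T} (hWV : W ≤ V)
    (N : Module.End A (A ⊗[k] Sec M V)) (N' : Module.End A (A ⊗[k] Sec M W))
    (h : ∀ x, resB A hWV (N x) = N' (resB A hWV x)) (x : B ⊗[k] Sec M V) :
    resB B hWV (liftOp s _ N x) = liftOp s _ N' (resB B hWV x) := by
  induction x using tensor_induction with
  | h0 => simp
  | ha x y hx hy => simp only [map_add, hx, hy]
  | ht b m => rw [resB_tmul, liftOp_tmul, liftOp_tmul, ← resB_tmul, ← h, map_smul, resB_rTensor]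

/-- The normalization `s 1 = 1` is needed here: in the Leibniz rule the multiplication by `{f, g}`
must lift to itself. -/
lemma liftOp_act_self (s : A →ₗ[k] B) (hs : s 1 = 1) {V : Opens T} (g : Fn R V)
    (x : B ⊗[k] Sec M V) : liftOp s _ (act A g) x = act B g x := by
  induction x using tensor_induction with
  | h0 => simp
  | ha x y hx hy => simp only [map_add, hx, hy]
  | ht b m =>
    rw [liftOp_tmul, act_tmul, act_tmul, LinearMap.rTensor_tmul, hs, TensorProduct.smul_tmul',
      smul_eq_mul, mul_one]

variable {U : Opens T} (μ : B →ₐ[k] A) {s : A →ₗ[k] B} (hs : ∀ a, μ (s a) = a) (hs1 : s 1 = 1)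
  {ε : A →ₐ[k] k}
include hs

lemma IsHomOn.lift {θ : ∀ V, V ≤ U → Module.End A (A ⊗[k] Sec E.M V)} (hθ : IsHomOn E ε θ) :
    IsHomOn E (ε.comp μ) fun V h => liftOp s (Sec E.M V) (θ V h) where
  hom_act V h g x := by
    rw [liftOp_act s (θ V h) (θ V h * act A g) g (fun x => rfl),
      act_liftOp s (θ V h) (θ V h * act A g) g (fun x => (hθ.hom_act V h g x).symm)]
  hom_res hWV h x := resB_liftOp s hWV _ _ (hθ.hom_res hWV h) x
  hom_slice V h x := by
    rw [← slice_rTensor, rTensor_liftOp μ hs, hθ.hom_slice, slice_rTensor]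

include hs1

lemma IsConnOn.lift {C : ∀ V, V ≤ U → Fn R V →ₗ[k] Module.End A (A ⊗[k] Sec E.M V)}
    (hC : IsConnOn E ε C) : IsConnOn E (ε.comp μ) fun V h => liftOp s (Sec E.M V) ∘ₗ C V h where
  conn_mul V h f g x := by
    simp only [LinearMap.comp_apply]
    rw [act_liftOp s (C V h g) (act A f * C V h g) f (fun x => rfl),
      act_liftOp s (C V h f) (act A g * C V h f) g (fun x => rfl), ← LinearMap.add_apply,
      ← map_add]
    congr 2
    exact LinearMap.ext fun y => hC.conn_mul V h f g y
  conn_act V h f g x := by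
    simp only [LinearMap.comp_apply]
    rw [← liftOp_act_self s hs1 (P.br V f g), act_liftOp s (C V h f) (act A g * C V h f) g (fun x => rfl),
      liftOp_act s (C V h f) (act A (P.br V f g) + act A g * C V h f) g (fun x => hC.conn_act V h f g x),
      map_add, LinearMap.add_apply]
  conn_res hWV h f x := resB_liftOp s hWV _ _ (hC.conn_res hWV h f) x
  conn_slice V h f x := by
    rw [← slice_rTensor, LinearMap.comp_apply, rTensor_liftOp μ hs, hC.conn_slice, slice_rTensor]

end Operators

/-! ### Operators with values in `t ⊗ F` -/

section Small

variable {k : Type u} [Field k] {T : TopCat.{u}} {R : AlgPresheaf k T} {P : PoissonStructure R}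
  {E : PoissonBundle P} {A B : Type u} [CommRing A] [Algebra k A] [CommRing B] [Algebra k B]

/-- `B → A` is surjective, its kernel is the line spanned by `t`, and `B` acts on it through `ε`. -/
structure IsSmall (μ : B →ₐ[k] A) (ε : B →ₐ[k] k) (t : B) : Prop where
  surj : Function.Surjective μ
  ne_zero : t ≠ 0
  ker : ∀ b, μ b = 0 → ∃ c : k, b = c • t
  mul : ∀ b, t * b = ε b • t
  map_eq_zero : μ t = 0

variable {M : PMod R} {μ : B →ₐ[k] A} {ε : B →ₐ[k] k} {t : B}

lemma IsPolyvector.map_smul_k {p : ℕ} {U : Opens T} {D : Op M p U} (hD : IsPolyvector D)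
    (V : Set.Iic U) (f : Fin p → Fn R V.1) (c : k) (m : Sec M V.1) :
    D V f (c • m) = c • D V f m := by
  rw [← algebraMap_smul (Fn R V.1) c m, hD.map_smul, algebraMap_smul]

/-- An operator is determined by its values on `1 ⊗ F`. -/
lemma eq_tmul_slice_of_one (ht : ∀ b, t * b = ε b • t) {V : Opens T}
    {N : Module.End B (B ⊗[k] Sec M V)} {D : Sec M V → Sec M V}
    (hadd : ∀ m n, D (m + n) = D m + D n) (hsmul : ∀ (c : k) m, D (c • m) = c • D m)
    (h : ∀ m, N (1 ⊗ₜ m) = t ⊗ₜ D m) (x : B ⊗[k] Sec M V) :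
    N x = t ⊗ₜ D (slice ε.toLinearMap x) := by
  induction x using tensor_induction with
  | h0 =>
    rw [map_zero, map_zero, ← zero_smul k (0 : Sec M V), hsmul, zero_smul, TensorProduct.tmul_zero]
  | ha x y hx hy => rw [map_add, map_add, hadd, TensorProduct.tmul_add, hx, hy]
  | ht b m =>
    have : b ⊗ₜ[k] m = b • (1 ⊗ₜ m) := by rw [TensorProduct.smul_tmul', smul_eq_mul, mul_one]
    rw [this, map_smul, h, ← this, slice_tmul, hsmul, TensorProduct.tmul_smul,
      TensorProduct.smul_tmul', TensorProduct.smul_tmul', smul_eq_mul, mul_comm b t, ht]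
    rfl

/-- The operator `x ↦ t ⊗ D(x)` given by a polyvector `D`. -/
def polyOp (ht : ∀ b, t * b = ε b • t) {p : ℕ} {U : Opens T} {D : Op M p U} (hD : IsPolyvector D)
    (V : Opens T) (h : V ≤ U) (f : Fin p → Fn R V) : Module.End B (B ⊗[k] Sec M V) where
  toFun x := t ⊗ₜ D ⟨V, h⟩ f (slice ε.toLinearMap x)
  map_add' x y := by rw [map_add, hD.map_add, TensorProduct.tmul_add]
  map_smul' b x := by
    have : slice ε.toLinearMap (b • x) = ε b • slice ε.toLinearMap x := by
      induction x using tensor_induction with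
      | h0 => simp
      | ha x y hx hy => simp only [smul_add, map_add, hx, hy]
      | ht c m => simp [TensorProduct.smul_tmul', mul_smul]
    rw [this, hD.map_smul_k, TensorProduct.tmul_smul, TensorProduct.smul_tmul', ← ht,
      RingHom.id_apply, TensorProduct.smul_tmul', smul_eq_mul, mul_comm]

lemma polyOp_apply (ht : ∀ b, t * b = ε b • t) {p : ℕ} {U : Opens T} {D : Op M p U}
    (hD : IsPolyvector D) (V : Opens T) (h : V ≤ U) (f : Fin p → Fn R V) (x : B ⊗[k] Sec M V) :
    polyOp ht hD V h f x = t ⊗ₜ D ⟨V, h⟩ f (slice ε.toLinearMap x) := rfl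

lemma rTensor_tmul_eq_zero (hμ : IsSmall μ ε t) {V : Opens T} (m : Sec M V) :
    LinearMap.rTensor (Sec M V) μ.toLinearMap (t ⊗ₜ m) = 0 := by
  simp [hμ.map_eq_zero]

/-- A multiderivation on `F ⊗ B` that vanishes on `F ⊗ A` comes from a polyvector on `F`. -/
lemma exists_polyvector (hμ : IsSmall μ ε t) {p : ℕ} {U : Opens T}
    (N : ∀ V, V ≤ U → (Fin p → Fn R V) → Module.End B (B ⊗[k] Sec M V))
    (hN : ∀ V h f x, LinearMap.rTensor (Sec M V) μ.toLinearMap (N V h f x) = 0)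
    (hact : ∀ V h f g x, N V h f (act B g x) = act B g (N V h f x))
    (hadd : ∀ V h (f : Fin p → Fn R V) i a b x, N V h (Function.update f i (a + b)) x =
      N V h (Function.update f i a) x + N V h (Function.update f i b) x)
    (hsmul : ∀ V h (f : Fin p → Fn R V) i (c : k) a x, N V h (Function.update f i (c • a)) x =
      c • N V h (Function.update f i a) x)
    (hmul : ∀ V h (f : Fin p → Fn R V) i a b x, N V h (Function.update f i (a * b)) x =
      act B a (N V h (Function.update f i b) x) + act B b (N V h (Function.update f i a) x))
    (halt : ∀ V h (f : Fin p → Fn R V) i j x, i ≠ j → f i = f j → N V h f x = 0)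
    (hres : ∀ {W V : Opens T} (hWV : W ≤ V) (h : V ≤ U) f x, resB B hWV (N V h f x) =
      N W (hWV.trans h) (fun i => Fn.res hWV (f i)) (resB B hWV x)) :
    ∃ D : Op M p U, D ∈ polyvectors M p U ∧ ∀ V (h : V ≤ U) f x,
      N V h f x = t ⊗ₜ D ⟨V, h⟩ f (slice ε.toLinearMap x) := by
  -- The values on `1 ⊗ F` lie in the kernel `t ⊗ F` of reduction to `A`, which defines `D`. Each
  -- axiom of a polyvector then follows from the injectivity of `t ⊗ -`.
  have key : ∀ V h f m, ∃ m' : Sec M V, N V h f (1 ⊗ₜ m) = t ⊗ₜ m' := fun V h f m =>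
    exists_tmul_of_rTensor_eq_zero μ hμ.surj hμ.ne_zero hμ.ker _ (hN V h f _)
  choose D hD using key
  have inj := fun V => tmul_injective (M := M) (V := V) hμ.ne_zero
  have h_map_add : ∀ V h f m n, D V h f (m + n) = D V h f m + D V h f n := fun V h f m n => by
    refine inj V ?_
    simp only [TensorProduct.tmul_add, ← hD, map_add]
  have h_map_smul : ∀ V h f g m, D V h f (g • m) = g • D V h f m := fun V h f g m => by
    refine inj V ?_
    dsimp only
    rw [← act_tmul, ← hD, ← hD, ← act_tmul, hact]
  have h_add : ∀ V h (f : Fin p → Fn R V) i a b m, D V h (Function.update f i (a + b)) m =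
      D V h (Function.update f i a) m + D V h (Function.update f i b) m :=
    fun V h f i a b m => by
      refine inj V ?_
      simp only [TensorProduct.tmul_add, ← hD, hadd]
  have h_smul : ∀ V h (f : Fin p → Fn R V) i (c : k) a m,
      D V h (Function.update f i (c • a)) m = c • D V h (Function.update f i a) m :=
    fun V h f i c a m => by
      refine inj V ?_
      simp only [TensorProduct.tmul_smul, ← hD, hsmul]
  have h_mul : ∀ V h (f : Fin p → Fn R V) i a b m, D V h (Function.update f i (a * b)) m =
      a • D V h (Function.update f i b) m + b • D V h (Function.update f i a) m :=
    fun V h f i a b m => by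
      refine inj V ?_
      simp only [TensorProduct.tmul_add, ← act_tmul, ← hD, hmul]
  have h_alt : ∀ V h (f : Fin p → Fn R V) i j m, i ≠ j → f i = f j → D V h f m = 0 :=
    fun V h f i j m hij hf => by
      refine inj V ?_
      simp only [← hD, halt V h f i j _ hij hf, TensorProduct.tmul_zero]
  have h_res : ∀ {W V : Opens T} (hWV : W ≤ V) (h : V ≤ U) f m, Sec.res hWV (D V h f m) =
      D W (hWV.trans h) (fun i => Fn.res hWV (f i)) (Sec.res hWV m) := fun {W V} hWV h f m => by
    refine inj W ?_
    dsimp only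
    rw [← hD, ← resB_tmul, ← resB_tmul, ← hres hWV h, hD]
  have hpoly : IsPolyvector fun (V : Set.Iic U) f m => D V.1 V.2 f m :=
    ⟨fun V => h_map_add V.1 V.2, fun V => h_map_smul V.1 V.2, fun V => h_add V.1 V.2,
      fun V => h_smul V.1 V.2, fun V => h_mul V.1 V.2, fun V => h_alt V.1 V.2,
      fun {W V} hWV => h_res hWV V.2⟩
  refine ⟨fun V f m => D V.1 V.2 f m, hpoly, fun V h f x => ?_⟩
  exact eq_tmul_slice_of_one hμ.mul (hpoly.map_add ⟨V, h⟩ f) (hpoly.map_smul_k ⟨V, h⟩ f)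
    (hD V h f) x

variable {U : Opens T}

lemma cons_update_zero {V : Opens T} (f : Fin 1 → Fn R V) (i : Fin 1) (a : Fn R V) :
    Function.update f i a 0 = a := by
  rw [Subsingleton.elim i 0, Function.update_self]

/-- The difference of two endomorphisms that agree on `F ⊗ A`. -/
lemma IsHomOn.exists_polyvector (hμ : IsSmall μ ε t)
    {θ θ' : ∀ V, V ≤ U → Module.End B (B ⊗[k] Sec E.M V)} (hθ : IsHomOn E ε θ)
    (hθ' : IsHomOn E ε θ') (h0 : ∀ V h x, LinearMap.rTensor (Sec E.M V) μ.toLinearMap (θ V h x) =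
      LinearMap.rTensor (Sec E.M V) μ.toLinearMap (θ' V h x)) :
    ∃ D : Op E.M 0 U, D ∈ polyvectors E.M 0 U ∧ ∀ V (h : V ≤ U) x,
      θ V h x - θ' V h x = t ⊗ₜ D ⟨V, h⟩ ![] (slice ε.toLinearMap x) := by
  obtain ⟨D, hD, h⟩ := PoissonBundles.exists_polyvector hμ (p := 0) (fun V h _ => θ V h - θ' V h)
    (fun V h f x => by rw [LinearMap.sub_apply, map_sub, h0, sub_self])
    (fun V h f g x => by simp only [LinearMap.sub_apply, hθ.hom_act, hθ'.hom_act, map_sub])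
    (fun _ _ _ i => i.elim0) (fun _ _ _ i => i.elim0) (fun _ _ _ i => i.elim0)
    (fun _ _ _ i => i.elim0)
    (fun hWV h f x => by simp only [LinearMap.sub_apply, map_sub, hθ.hom_res, hθ'.hom_res])
  exact ⟨D, hD, fun V hV x => h V hV ![] x⟩

/-- The failure of an endomorphism to be compatible with connections. -/
lemma IsConnOn.exists_polyvector (hμ : IsSmall μ ε t)
    {C C' : ∀ V, V ≤ U → Fn R V →ₗ[k] Module.End B (B ⊗[k] Sec E.M V)}
    {θ : ∀ V, V ≤ U → Module.End B (B ⊗[k] Sec E.M V)} (hC : IsConnOn E ε C)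
    (hC' : IsConnOn E ε C') (hθ : IsHomOn E ε θ)
    (h0 : ∀ V h f x, LinearMap.rTensor (Sec E.M V) μ.toLinearMap (C V h f (θ V h x)) =
      LinearMap.rTensor (Sec E.M V) μ.toLinearMap (θ V h (C' V h f x))) :
    ∃ D : Op E.M 1 U, D ∈ polyvectors E.M 1 U ∧ ∀ V (h : V ≤ U) f x,
      C V h f (θ V h x) - θ V h (C' V h f x) = t ⊗ₜ D ⟨V, h⟩ ![f] (slice ε.toLinearMap x) := by
  obtain ⟨D, hD, h⟩ := PoissonBundles.exists_polyvector hμ (p := 1)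
    (fun V h f => C V h (f 0) * θ V h - θ V h * C' V h (f 0))
    (fun V h f x => by
      simp only [LinearMap.sub_apply, Module.End.mul_apply, map_sub, h0, sub_self])
    (fun V h f g x => by
      simp only [LinearMap.sub_apply, Module.End.mul_apply, hθ.hom_act, hC.conn_act, hC'.conn_act,
        map_sub, map_add]
      abel)
    (fun V h f i a b x => by
      simp only [cons_update_zero, LinearMap.sub_apply, Module.End.mul_apply, map_add,
        LinearMap.add_apply]
      abel)
    (fun V h f i c a x => by
      simp only [cons_update_zero, LinearMap.sub_apply, Module.End.mul_apply, map_smul,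
        LinearMap.smul_apply, smul_sub, LinearMap.map_smul_of_tower])
    (fun V h f i a b x => by
      simp only [cons_update_zero, LinearMap.sub_apply, Module.End.mul_apply, hC.conn_mul,
        hC'.conn_mul, hθ.hom_act, map_add, map_sub]
      abel)
    (fun V h f i j x hij => absurd (Subsingleton.elim i j) hij)
    (fun hWV h f x => by
      simp only [LinearMap.sub_apply, Module.End.mul_apply, map_sub, hC.conn_res, hC'.conn_res,
        hθ.hom_res])
  exact ⟨D, hD, fun V hV f x => h V hV ![f] x⟩

/-- The curvature of a connection. -/
def curv {V : Opens T} (P : PoissonStructure R)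
    (C : Fn R V →ₗ[k] Module.End B (B ⊗[k] Sec M V)) (f g : Fn R V) :
    Module.End B (B ⊗[k] Sec M V) :=
  C f * C g - C g * C f - C (P.br V f g)

lemma curv_apply {V : Opens T} (C : Fn R V →ₗ[k] Module.End B (B ⊗[k] Sec M V)) (f g : Fn R V)
    (x : B ⊗[k] Sec M V) : curv P C f g x = C f (C g x) - C g (C f x) - C (P.br V f g) x := rfl

lemma br_mul_right {V : Opens T} (f g h : Fn R V) :
    P.br V f (g * h) = g * P.br V f h + h * P.br V f g := by
  rw [P.skew, P.leibniz, P.skew V f h, P.skew V f g]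
  ring

lemma curv_swap {V : Opens T} (C : Fn R V →ₗ[k] Module.End B (B ⊗[k] Sec M V)) (f g : Fn R V) :
    curv P C f g = - curv P C g f := by
  rw [curv, curv, P.skew V f g, map_neg]
  abel

/-- In the expansion the mixed terms `{f, a} C(b)` and `{f, b} C(a)` cancel against those of the
connection along `{f, a b}`. -/
lemma IsConnOn.curv_mul_right
    {C : ∀ V, V ≤ U → Fn R V →ₗ[k] Module.End B (B ⊗[k] Sec E.M V)} (hC : IsConnOn E ε C)
    {V : Opens T} (h : V ≤ U) (f a b : Fn R V) (x : B ⊗[k] Sec E.M V) :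
    curv P (C V h) f (a * b) x =
      act B a (curv P (C V h) f b x) + act B b (curv P (C V h) f a x) := by
  simp only [curv_apply, hC.conn_mul, hC.conn_act, br_mul_right, map_add, map_sub,
    LinearMap.add_apply]
  abel

lemma br_jacobi {V : Opens T} (f g h : Fn R V) :
    P.br V (P.br V f g) h = P.br V f (P.br V g h) - P.br V g (P.br V f h) := by
  have := P.jacobi V f g h
  rw [P.skew V h f, P.skew V h (P.br V f g), map_neg] at this
  rw [sub_eq_add_neg, ← sub_eq_zero, ← neg_eq_zero, ← this]
  abel

/-- The first-order terms cancel in pairs, and the remaining multiple of `x` vanishes by the Jacobi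
identity for `f`, `g`, `a`. -/
lemma IsConnOn.curv_act
    {C : ∀ V, V ≤ U → Fn R V →ₗ[k] Module.End B (B ⊗[k] Sec E.M V)} (hC : IsConnOn E ε C)
    {V : Opens T} (h : V ≤ U) (f g a : Fn R V) (x : B ⊗[k] Sec E.M V) :
    curv P (C V h) f g (act B a x) = act B a (curv P (C V h) f g x) := by
  simp only [curv_apply, hC.conn_act, br_jacobi, act_sub_left, map_add, map_sub]
  abel

/-- The curvature of a connection that is flat on `F ⊗ A`. -/
lemma IsConnOn.exists_curv_polyvector (hμ : IsSmall μ ε t)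
    {C : ∀ V, V ≤ U → Fn R V →ₗ[k] Module.End B (B ⊗[k] Sec E.M V)} (hC : IsConnOn E ε C)
    (h0 : ∀ V h f g x,
      LinearMap.rTensor (Sec E.M V) μ.toLinearMap (curv P (C V h) f g x) = 0)
    (halt : ∀ V (f : Fn R V), P.br V f f = 0) :
    ∃ D : Op E.M 2 U, D ∈ polyvectors E.M 2 U ∧ ∀ V (h : V ≤ U) f g x,
      curv P (C V h) f g x = t ⊗ₜ D ⟨V, h⟩ ![f, g] (slice ε.toLinearMap x) := by
  -- Linearity is proved in the second argument only; `curv_swap` transfers it to the first one.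
  have hadd : ∀ V h (f a b : Fn R V),
      curv P (C V h) f (a + b) = curv P (C V h) f a + curv P (C V h) f b := by
    intro V h f a b
    simp only [curv, map_add, mul_add, add_mul]
    abel
  have hsmul : ∀ V h (f : Fn R V) (c : k) (a : Fn R V),
      curv P (C V h) f (c • a) = c • curv P (C V h) f a := by
    intro V h f c a
    refine LinearMap.ext fun x => ?_
    simp only [curv_apply, map_smul, LinearMap.smul_apply, smul_sub, LinearMap.map_smul_of_tower]
  obtain ⟨D, hD, h⟩ := PoissonBundles.exists_polyvector hμ (p := 2)
    (fun V h f => curv P (C V h) (f 0) (f 1)) (fun V h f x => h0 V h _ _ x)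
    (fun V h f g x => hC.curv_act h _ _ _ _)
    (fun V h f i a b x => by
      fin_cases i
      · simp only [Fin.zero_eta, Function.update_self, ne_eq, one_ne_zero,
          not_false_eq_true, Function.update_of_ne]
        rw [curv_swap, hadd, curv_swap _ a, curv_swap _ b]
        exact neg_add _ _
      · simp only [Fin.mk_one, Function.update_self, ne_eq, zero_ne_one,
          not_false_eq_true, Function.update_of_ne]
        rw [hadd]
        rfl)
    (fun V h f i c a x => by
      fin_cases i
      · simp only [Fin.zero_eta, Function.update_self, ne_eq, one_ne_zero,
          not_false_eq_true, Function.update_of_ne]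
        rw [curv_swap, hsmul, curv_swap _ a]
        exact (smul_neg c (curv P (C V h) (f 1) a x)).symm
      · simp only [Fin.mk_one, Function.update_self, ne_eq, zero_ne_one,
          not_false_eq_true, Function.update_of_ne]
        rw [hsmul]
        rfl)
    (fun V h f i a b x => by
      fin_cases i
      · simp only [Fin.zero_eta, Function.update_self, ne_eq, one_ne_zero,
          not_false_eq_true, Function.update_of_ne]
        rw [curv_swap, LinearMap.neg_apply, hC.curv_mul_right, curv_swap _ a, curv_swap _ b,
          LinearMap.neg_apply, LinearMap.neg_apply, map_neg, map_neg, neg_add]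
      · simp only [Fin.mk_one, Function.update_self, ne_eq, zero_ne_one,
          not_false_eq_true, Function.update_of_ne]
        rw [hC.curv_mul_right])
    (fun V h f i j x hij hf => by
      have : f 0 = f 1 := by
        fin_cases i <;> fin_cases j <;> first | exact absurd rfl hij | exact hf | exact hf.symm
      rw [this, curv_apply, halt, map_zero, LinearMap.zero_apply]
      simp)
    (fun hWV h f x => by
      simp only [curv_apply, map_sub, hC.conn_res, P.res_br])
  exact ⟨D, hD, fun V hV f g x => h V hV ![f, g] x⟩

/-- Skew-symmetry gives `2 {f, f} = 0`, and `2` is invertible in `k`. The alternating property is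
what makes the curvature a bivector. -/
lemma br_self [CharZero k] {V : Opens T} (f : Fn R V) : P.br V f f = 0 := by
  have h : (2 : k) • P.br V f f = 0 := by
    rw [two_smul]
    nth_rewrite 1 [P.skew]
    exact neg_add_cancel _
  exact (smul_eq_zero_iff_right (two_ne_zero)).mp h

/-! Perturbations. -/

lemma slice_tmul_eq_zero (ht : ε t = 0) {V : Opens T} (m : Sec M V) :
    slice ε.toLinearMap (t ⊗ₜ[k] m) = 0 := by
  simp [ht]

lemma update_single {V : Opens T} (a b : Fn R V) : Function.update ![a] 0 b = ![b] := by
  ext i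
  rw [Subsingleton.elim i 0]
  rfl

/-- `polyOp` for polyvectors of degree one. -/
def polyConn (ht : ∀ b, t * b = ε b • t) {D : Op M 1 U} (hD : IsPolyvector D)
    (V : Opens T) (h : V ≤ U) : Fn R V →ₗ[k] Module.End B (B ⊗[k] Sec M V) where
  toFun f := polyOp ht hD V h ![f]
  map_add' f g := by
    refine LinearMap.ext fun x => ?_
    have := hD.add ⟨V, h⟩ ![f] 0 f g
    simp only [update_single] at this
    simp only [LinearMap.add_apply, polyOp_apply, this, TensorProduct.tmul_add]
  map_smul' c f := by
    refine LinearMap.ext fun x => ?_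
    have := hD.smul ⟨V, h⟩ ![f] 0 c f
    simp only [update_single] at this
    simp only [LinearMap.smul_apply, polyOp_apply, this, TensorProduct.tmul_smul,
      RingHom.id_apply]

lemma IsConnOn.add_polyOp (hμ : IsSmall μ ε t) (ht : ε t = 0)
    {C : ∀ V, V ≤ U → Fn R V →ₗ[k] Module.End B (B ⊗[k] Sec E.M V)} (hC : IsConnOn E ε C)
    {D : Op E.M 1 U} (hD : IsPolyvector D) :
    IsConnOn E ε fun V h => C V h + polyConn hμ.mul hD V h := by
  refine ⟨?_, ?_, ?_, ?_⟩
  · intro V h f g x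
    have := hD.mul ⟨V, h⟩ ![f] 0 f g
    simp only [update_single] at this
    change C V h (f * g) x + t ⊗ₜ D ⟨V, h⟩ ![f * g] _ =
      act B f (C V h g x + t ⊗ₜ D ⟨V, h⟩ ![g] _) + act B g (C V h f x + t ⊗ₜ D ⟨V, h⟩ ![f] _)
    rw [this, hC.conn_mul, TensorProduct.tmul_add, map_add, map_add, act_tmul, act_tmul]
    abel
  · intro V h f g x
    change C V h f (act B g x) + t ⊗ₜ D ⟨V, h⟩ ![f] _ =
      act B _ x + act B g (C V h f x + t ⊗ₜ D ⟨V, h⟩ ![f] _)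
    rw [hC.conn_act, slice_act, hD.map_smul, map_add, act_tmul, add_assoc]
  · intro W V hWV h f x
    change resB B hWV (C V h f x + t ⊗ₜ D ⟨V, h⟩ ![f] _) =
      C W _ _ _ + t ⊗ₜ D ⟨W, _⟩ ![Fn.res hWV f] _
    rw [map_add, hC.conn_res, resB_tmul, hD.res (W := ⟨W, hWV.trans h⟩) (V := ⟨V, h⟩) hWV,
      res_slice]
    congr 3
    ext i
    rw [Subsingleton.elim i 0]
    rfl
  · intro V h f x
    change slice _ (C V h f x + t ⊗ₜ D ⟨V, h⟩ ![f] _) = _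
    rw [map_add, hC.conn_slice, slice_tmul_eq_zero ht, add_zero]

lemma IsHomOn.add_polyOp (hμ : IsSmall μ ε t) (ht : ε t = 0)
    {θ : ∀ V, V ≤ U → Module.End B (B ⊗[k] Sec E.M V)} (hθ : IsHomOn E ε θ)
    {D : Op E.M 0 U} (hD : IsPolyvector D) :
    IsHomOn E ε fun V h => θ V h + polyOp hμ.mul hD V h ![] where
  hom_act V h g x := by
    simp only [LinearMap.add_apply, polyOp_apply, hθ.hom_act, slice_act, hD.map_smul, map_add,
      act_tmul]
  hom_res {W V} hWV h x := by
    simp only [LinearMap.add_apply, polyOp_apply, map_add, hθ.hom_res, resB_tmul, ← res_slice]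
    rw [hD.res (W := ⟨W, hWV.trans h⟩) (V := ⟨V, h⟩) hWV]
    congr 3
    exact Subsingleton.elim _ _
  hom_slice V h x := by
    simp only [LinearMap.add_apply, polyOp_apply, map_add, hθ.hom_slice,
      slice_tmul_eq_zero ht, add_zero]

/-! Operators on `t ⊗ F`. -/

/-- Since `t ⊗ m = t • (1 ⊗ m)` and `t` is killed by the kernel of `ε`, only the connection induced
on `F` matters. All lifts therefore act alike on `t ⊗ F`, and no terms quadratic in `t` appear in
the computations with defects. -/
lemma IsConnOn.apply_tmul (hμ : IsSmall μ ε t)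
    {C : ∀ V, V ≤ U → Fn R V →ₗ[k] Module.End B (B ⊗[k] Sec E.M V)} (hC : IsConnOn E ε C)
    {V : Opens T} (h : V ≤ U) (f : Fn R V) (m : Sec E.M V) :
    C V h f (t ⊗ₜ m) = t ⊗ₜ E.conn V f m := by
  have : t ⊗ₜ[k] m = t • (1 ⊗ₜ m) := by rw [TensorProduct.smul_tmul', smul_eq_mul, mul_one]
  rw [this, map_smul, smul_eq_tmul_slice ε hμ.mul, hC.conn_slice]
  simp

lemma IsHomOn.apply_tmul (hμ : IsSmall μ ε t)
    {θ : ∀ V, V ≤ U → Module.End B (B ⊗[k] Sec E.M V)} (hθ : IsHomOn E ε θ)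
    {V : Opens T} (h : V ≤ U) (m : Sec E.M V) : θ V h (t ⊗ₜ m) = t ⊗ₜ m := by
  have : t ⊗ₜ[k] m = t • (1 ⊗ₜ m) := by rw [TensorProduct.smul_tmul', smul_eq_mul, mul_one]
  rw [this, map_smul, smul_eq_tmul_slice ε hμ.mul, hθ.hom_slice]
  simp [TensorProduct.smul_tmul']

end Small

/-! ### The total complex in low degrees -/

section Formulas

variable {k : Type u} [CommRing k] {T : TopCat.{u}} {R : AlgPresheaf k T} {P : PoissonStructure R}
  (E : PoissonBundle P) {U : Opens T}

lemma dPoisson_zero (D : Op E.M 0 U) (V : Set.Iic U) (f : Fn R V.1) (m : Sec E.M V.1) :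
    dPoisson E 0 U D V ![f] m = homConn E f (D V ![]) m := by
  simp [dPoisson]

lemma dPoisson_one (D : Op E.M 1 U) (V : Set.Iic U) (f g : Fn R V.1) (m : Sec E.M V.1) :
    dPoisson E 1 U D V ![f, g] m =
      homConn E f (D V ![g]) m - homConn E g (D V ![f]) m - D V ![P.br V.1 f g] m := by
  have h1 : Fin.removeNth 1 ![f, g] = ![f] := by
    ext i; fin_cases i; rfl
  have h2 : ∀ a b : Fn R V.1, Function.update ![a] 0 b = ![b] := fun a b => by
    ext i; fin_cases i; rfl
  simp [dPoisson, Fin.sum_univ_two, h1, h2]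
  abel

lemma dPoisson_two (D : Op E.M 2 U) (V : Set.Iic U) (f g h : Fn R V.1) (m : Sec E.M V.1) :
    dPoisson E 2 U D V ![f, g, h] m =
      homConn E f (D V ![g, h]) m - homConn E g (D V ![f, h]) m + homConn E h (D V ![f, g]) m -
        D V ![P.br V.1 f g, h] m + D V ![P.br V.1 f h, g] m + D V ![f, P.br V.1 g h] m := by
  have h1 : Fin.removeNth 1 ![f, g, h] = ![f, h] := by
    ext i; fin_cases i <;> rfl
  have h2 : Fin.removeNth 2 ![f, g, h] = ![f, g] := by
    ext i; fin_cases i <;> rfl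
  have h3 : ∀ a b c : Fn R V.1, Function.update ![a, b] 0 c = ![c, b] := fun a b c => by
    ext i; fin_cases i <;> rfl
  have h4 : ∀ a b c : Fn R V.1, Function.update ![a, b] 1 c = ![a, c] := fun a b c => by
    ext i; fin_cases i <;> rfl
  simp [dPoisson, Fin.sum_univ_two, Fin.sum_univ_three, h1, h2, h3, h4]
  abel

variable {ι : Type u} (𝒰 : ι → Opens T) (c : Cochains E 𝒰)

lemma cech_apply (p q : ℕ) (s : Fin (q + 2) → ι) (V : Opens T) (h : V ≤ inter 𝒰 s)
    (f : Fin p → Fn R V) (m : Sec E.M V) : cech E 𝒰 p q (c p q) s ⟨V, h⟩ f m =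
      ∑ i : Fin (q + 2), (-1 : ℤ) ^ (i : ℕ) •
        c p q (i.removeNth s) ⟨V, h.trans (inter_le_face 𝒰 s i)⟩ f m := by
  simp only [cech, AddMonoidHom.coe_mk, ZeroHom.coe_mk, Finset.sum_apply, Pi.smul_apply]
  rfl

lemma dTotal_succ_zero (p : ℕ) (s : Fin 1 → ι) :
    dTotal E 𝒰 c (p + 1) 0 s = dPoisson E p _ (c p 0 s) := by
  simp [dTotal, vertical, horizontal]

lemma dTotal_zero_succ (q : ℕ) (s : Fin (q + 2) → ι) :
    dTotal E 𝒰 c 0 (q + 1) s = (-1 : ℤ) ^ (0 + q + 1) • cech E 𝒰 0 q (c 0 q) s := by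
  simp [dTotal, vertical, horizontal]

lemma dTotal_succ_succ (p q : ℕ) (s : Fin (q + 2) → ι) :
    dTotal E 𝒰 c (p + 1) (q + 1) s = dPoisson E p _ (c p (q + 1) s) +
      (-1 : ℤ) ^ (p + 1 + q + 1) • cech E 𝒰 (p + 1) q (c (p + 1) q) s := by
  simp [dTotal, vertical, horizontal]

variable {E 𝒰} {c}

lemma dTotal_eq_zero {n : ℤ} (hc : c ∈ total E 𝒰 n) (p q : ℕ) (hpq : (p + q : ℤ) ≠ n + 1) :
    dTotal E 𝒰 c p q = 0 := by
  funext s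
  rcases p with _ | p <;> rcases q with _ | q
  · simp [dTotal, vertical, horizontal]
  · rw [dTotal_zero_succ, hc.2 _ _ (by push_cast at hpq ⊢; omega)]
    simp
  · rw [dTotal_succ_zero, hc.2 _ _ (by push_cast at hpq ⊢; omega)]
    simp
  · rw [dTotal_succ_succ, hc.2 _ _ (by push_cast at hpq ⊢; omega),
      hc.2 _ _ (by push_cast at hpq ⊢; omega)]
    simp

/-- The cochain of total degree `2` with the given components. -/
def cochainTwo (S : ∀ s : Fin 1 → ι, Op E.M 2 (inter 𝒰 s)) (Q : ∀ s : Fin 2 → ι, Op E.M 1 (inter 𝒰 s))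
    (G : ∀ s : Fin 3 → ι, Op E.M 0 (inter 𝒰 s)) : Cochains E 𝒰
  | 2, 0 => S
  | 1, 1 => Q
  | 0, 2 => G
  | _, _ => 0

lemma cochainTwo_mem {S : ∀ s : Fin 1 → ι, Op E.M 2 (inter 𝒰 s)}
    {Q : ∀ s : Fin 2 → ι, Op E.M 1 (inter 𝒰 s)} {G : ∀ s : Fin 3 → ι, Op E.M 0 (inter 𝒰 s)}
    (hS : ∀ s, S s ∈ polyvectors E.M 2 _) (hQ : ∀ s, Q s ∈ polyvectors E.M 1 _)
    (hG : ∀ s, G s ∈ polyvectors E.M 0 _) : cochainTwo S Q G ∈ total E 𝒰 2 := by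
  refine ⟨fun p q => ?_, fun p q => ?_⟩ <;> unfold cochainTwo <;> split
  · exact hS
  · exact hQ
  · exact hG
  · exact fun _ => zero_mem _
  · exact fun h => absurd rfl h
  · exact fun h => absurd rfl h
  · exact fun h => absurd rfl h
  · exact fun _ => rfl

/-- The cochain of total degree `1` with the given components. -/
def cochainOne (Q : ∀ s : Fin 1 → ι, Op E.M 1 (inter 𝒰 s))
    (G : ∀ s : Fin 2 → ι, Op E.M 0 (inter 𝒰 s)) : Cochains E 𝒰
  | 1, 0 => Q
  | 0, 1 => G
  | _, _ => 0

lemma cochainOne_mem {Q : ∀ s : Fin 1 → ι, Op E.M 1 (inter 𝒰 s)}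
    {G : ∀ s : Fin 2 → ι, Op E.M 0 (inter 𝒰 s)} (hQ : ∀ s, Q s ∈ polyvectors E.M 1 _)
    (hG : ∀ s, G s ∈ polyvectors E.M 0 _) : cochainOne Q G ∈ total E 𝒰 1 := by
  refine ⟨fun p q => ?_, fun p q => ?_⟩ <;> unfold cochainOne <;> split
  · exact hQ
  · exact hG
  · exact fun _ => zero_mem _
  · exact fun h => absurd rfl h
  · exact fun h => absurd rfl h
  · exact fun _ => rfl

/-- The cochain of total degree `0` with the given component. -/
def cochainZero (H : ∀ s : Fin 1 → ι, Op E.M 0 (inter 𝒰 s)) : Cochains E 𝒰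
  | 0, 0 => H
  | _, _ => 0

lemma cochainZero_mem {H : ∀ s : Fin 1 → ι, Op E.M 0 (inter 𝒰 s)}
    (hH : ∀ s, H s ∈ polyvectors E.M 0 _) : cochainZero H ∈ total E 𝒰 0 := by
  refine ⟨fun p q => ?_, fun p q => ?_⟩ <;> unfold cochainZero <;> split
  · exact hH
  · exact fun _ => zero_mem _
  · exact fun h => absurd rfl h
  · exact fun _ => rfl

lemma eq_vec_zero {α : Type*} (f : Fin 0 → α) : f = ![] := Subsingleton.elim _ _

lemma eq_vec_one {α : Type*} (f : Fin 1 → α) : f = ![f 0] := by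
  ext i; fin_cases i; rfl

lemma eq_vec_two {α : Type*} (f : Fin 2 → α) : f = ![f 0, f 1] := by
  ext i; fin_cases i <;> rfl

lemma eq_vec_three {α : Type*} (f : Fin 3 → α) : f = ![f 0, f 1, f 2] := by
  ext i; fin_cases i <;> rfl

end Formulas

/-! ### Local data and their defects -/

section LocData

variable {k : Type u} [Field k] {T : TopCat.{u}} {R : AlgPresheaf k T} {P : PoissonStructure R}
  {A B : Type u} [CommRing A] [Algebra k A] [CommRing B] [Algebra k B] {ι : Type u}

/-- Connections on the `F|_{U_α} ⊗ B` and endomorphisms of the `F|_{U_α ∩ U_β} ⊗ B`, which induce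
the given connection and the identity on `F`. -/
structure LocData (E : PoissonBundle P) (ε : B →ₐ[k] k) (𝒰 : ι → Opens T) where
  conn (α : ι) (V : Opens T) (h : V ≤ 𝒰 α) : Fn R V →ₗ[k] Module.End B (B ⊗[k] Sec E.M V)
  isConn : ∀ α, IsConnOn E ε (conn α)
  trans (α β : ι) (V : Opens T) (h : V ≤ 𝒰 α ⊓ 𝒰 β) : Module.End B (B ⊗[k] Sec E.M V)
  isHom : ∀ α β, IsHomOn E ε (trans α β)

variable {E : PoissonBundle P} {ε : B →ₐ[k] k} {𝒰 : ι → Opens T} {μ : B →ₐ[k] A} {t : B}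

/-- The total `2`-cochain `c` is the defect of `L`. -/
structure LocData.IsDefect (L : LocData E ε 𝒰) (t : B) (c : Cochains E 𝒰) : Prop where
  curvature : ∀ (s : Fin 1 → ι) (V : Opens T) (h : V ≤ inter 𝒰 s) (f g : Fn R V)
    (x : B ⊗[k] Sec E.M V), curv P (L.conn (s 0) V (h.trans (inter_le 𝒰 s 0))) f g x =
      t ⊗ₜ (- c 2 0 s ⟨V, h⟩ ![f, g] (slice ε.toLinearMap x))
  compat : ∀ (s : Fin 2 → ι) (V : Opens T) (h : V ≤ inter 𝒰 s) (f : Fn R V)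
    (x : B ⊗[k] Sec E.M V),
    let h0 := h.trans (inter_le 𝒰 s 0)
    let h1 := h.trans (inter_le 𝒰 s 1)
    L.conn (s 0) V h0 f (L.trans (s 0) (s 1) V (le_inf h0 h1) x) -
      L.trans (s 0) (s 1) V (le_inf h0 h1) (L.conn (s 1) V h1 f x) =
        t ⊗ₜ c 1 1 s ⟨V, h⟩ ![f] (slice ε.toLinearMap x)
  cocycle : ∀ (s : Fin 3 → ι) (V : Opens T) (h : V ≤ inter 𝒰 s) (x : B ⊗[k] Sec E.M V),
    let h0 := h.trans (inter_le 𝒰 s 0)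
    let h1 := h.trans (inter_le 𝒰 s 1)
    let h2 := h.trans (inter_le 𝒰 s 2)
    L.trans (s 0) (s 1) V (le_inf h0 h1) (L.trans (s 1) (s 2) V (le_inf h1 h2) x) -
      L.trans (s 0) (s 2) V (le_inf h0 h2) x =
        t ⊗ₜ c 0 2 s ⟨V, h⟩ ![] (slice ε.toLinearMap x)

/-- The total `1`-cochain `b` is the failure of the `θ α` to be an isomorphism from `L'` to `L`. -/
structure LocData.IsGauge (L L' : LocData E ε 𝒰)
    (θ : ∀ α V, V ≤ 𝒰 α → Module.End B (B ⊗[k] Sec E.M V)) (t : B) (b : Cochains E 𝒰) : Prop where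
  conn : ∀ (s : Fin 1 → ι) (V : Opens T) (h : V ≤ inter 𝒰 s) (f : Fn R V)
    (x : B ⊗[k] Sec E.M V),
    let h0 := h.trans (inter_le 𝒰 s 0)
    L.conn (s 0) V h0 f (θ (s 0) V h0 x) - θ (s 0) V h0 (L'.conn (s 0) V h0 f x) =
      t ⊗ₜ (- b 1 0 s ⟨V, h⟩ ![f] (slice ε.toLinearMap x))
  trans : ∀ (s : Fin 2 → ι) (V : Opens T) (h : V ≤ inter 𝒰 s) (x : B ⊗[k] Sec E.M V),
    let h0 := h.trans (inter_le 𝒰 s 0)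
    let h1 := h.trans (inter_le 𝒰 s 1)
    L.trans (s 0) (s 1) V (le_inf h0 h1) (θ (s 1) V h1 x) -
      θ (s 0) V h0 (L'.trans (s 0) (s 1) V (le_inf h0 h1) x) =
        t ⊗ₜ b 0 1 s ⟨V, h⟩ ![] (slice ε.toLinearMap x)

/-- The two sides agree on `F ⊗ A`. -/
structure LocData.IsStrictMod (L : LocData E ε 𝒰) (μ : B →ₐ[k] A) : Prop where
  curvature : ∀ α V h f g x,
    LinearMap.rTensor (Sec E.M V) μ.toLinearMap (curv P (L.conn α V h) f g x) = 0
  compat : ∀ α β V hα hβ f x,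
    LinearMap.rTensor (Sec E.M V) μ.toLinearMap
      (L.conn α V hα f (L.trans α β V (le_inf hα hβ) x)) =
    LinearMap.rTensor (Sec E.M V) μ.toLinearMap
      (L.trans α β V (le_inf hα hβ) (L.conn β V hβ f x))
  cocycle : ∀ α β γ V hα hβ hγ x,
    LinearMap.rTensor (Sec E.M V) μ.toLinearMap
      (L.trans α β V (le_inf hα hβ) (L.trans β γ V (le_inf hβ hγ) x)) =
    LinearMap.rTensor (Sec E.M V) μ.toLinearMap (L.trans α γ V (le_inf hα hγ) x)

/-- The three failures vanish on `F ⊗ A`, so each of them is `t` times a polyvector. The sign of the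
component of type `(2, 0)` is the one that makes the total cochain closed. -/
lemma LocData.IsStrictMod.exists_isDefect [CharZero k] {L : LocData E ε 𝒰}
    (hL : L.IsStrictMod μ) (hμ : IsSmall μ ε t) :
    ∃ c : Cochains E 𝒰, c ∈ total E 𝒰 2 ∧ L.IsDefect t c := by
  have hS : ∀ s : Fin 1 → ι, _ := fun s =>
    ((L.isConn (s 0)).restrict (inter_le 𝒰 s 0)).exists_curv_polyvector hμ
      (fun V h f g x => hL.curvature _ V _ f g x) (fun V f => br_self f)
  have hQ : ∀ s : Fin 2 → ι, _ := fun s =>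
    ((L.isConn (s 0)).restrict (inter_le 𝒰 s 0)).exists_polyvector hμ
      ((L.isConn (s 1)).restrict (inter_le 𝒰 s 1))
      ((L.isHom (s 0) (s 1)).restrict (le_inf (inter_le 𝒰 s 0) (inter_le 𝒰 s 1)))
      (fun V h f x => hL.compat _ _ V (h.trans (inter_le 𝒰 s 0)) (h.trans (inter_le 𝒰 s 1)) f x)
  have hG : ∀ s : Fin 3 → ι, _ := fun s =>
    (((L.isHom (s 0) (s 1)).restrict (le_inf (inter_le 𝒰 s 0) (inter_le 𝒰 s 1))).comp
      ((L.isHom (s 1) (s 2)).restrict (le_inf (inter_le 𝒰 s 1) (inter_le 𝒰 s 2)))).exists_polyvector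
        hμ ((L.isHom (s 0) (s 2)).restrict (le_inf (inter_le 𝒰 s 0) (inter_le 𝒰 s 2)))
        (fun V h x => hL.cocycle _ _ _ V (h.trans (inter_le 𝒰 s 0)) (h.trans (inter_le 𝒰 s 1))
          (h.trans (inter_le 𝒰 s 2)) x)
  choose S hS1 hS2 using hS
  choose Q hQ1 hQ2 using hQ
  choose G hG1 hG2 using hG
  refine ⟨cochainTwo (fun s => - S s) Q G, cochainTwo_mem (fun s => neg_mem (hS1 s)) hQ1 hG1,
    ⟨?_, ?_, ?_⟩⟩
  · intro s V h f g x
    refine (hS2 s V h f g x).trans ?_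
    simp [cochainTwo]
  · exact fun s V h f x => hQ2 s V h f x
  · exact fun s V h x => hG2 s V h x

/-- If the `θ α` intertwine the data over `A`, their failure to do so over `B` is again `t` times
polyvectors, now of total degree `1`. -/
lemma LocData.exists_isGauge {L L' : LocData E ε 𝒰} (hμ : IsSmall μ ε t)
    {θ : ∀ α V, V ≤ 𝒰 α → Module.End B (B ⊗[k] Sec E.M V)} (hθ : ∀ α, IsHomOn E ε (θ α))
    (hconn : ∀ α V h f x, LinearMap.rTensor (Sec E.M V) μ.toLinearMap
      (L.conn α V h f (θ α V h x)) =
        LinearMap.rTensor (Sec E.M V) μ.toLinearMap (θ α V h (L'.conn α V h f x)))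
    (htrans : ∀ α β V hα hβ x, LinearMap.rTensor (Sec E.M V) μ.toLinearMap
      (L.trans α β V (le_inf hα hβ) (θ β V hβ x)) =
        LinearMap.rTensor (Sec E.M V) μ.toLinearMap
          (θ α V hα (L'.trans α β V (le_inf hα hβ) x))) :
    ∃ b : Cochains E 𝒰, b ∈ total E 𝒰 1 ∧ L.IsGauge L' θ t b := by
  have hQ : ∀ s : Fin 1 → ι, _ := fun s =>
    ((L.isConn (s 0)).restrict (inter_le 𝒰 s 0)).exists_polyvector hμ
      ((L'.isConn (s 0)).restrict (inter_le 𝒰 s 0)) ((hθ (s 0)).restrict (inter_le 𝒰 s 0))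
      (fun V h f x => hconn _ V (h.trans (inter_le 𝒰 s 0)) f x)
  have hG : ∀ s : Fin 2 → ι, _ := fun s =>
    (((L.isHom (s 0) (s 1)).restrict (le_inf (inter_le 𝒰 s 0) (inter_le 𝒰 s 1))).comp
      ((hθ (s 1)).restrict (inter_le 𝒰 s 1))).exists_polyvector
        hμ (((hθ (s 0)).restrict (inter_le 𝒰 s 0)).comp
          ((L'.isHom (s 0) (s 1)).restrict (le_inf (inter_le 𝒰 s 0) (inter_le 𝒰 s 1))))
        (fun V h x => htrans _ _ V (h.trans (inter_le 𝒰 s 0)) (h.trans (inter_le 𝒰 s 1)) x)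
  choose Q hQ1 hQ2 using hQ
  choose G hG1 hG2 using hG
  refine ⟨cochainOne (fun s => - Q s) G, cochainOne_mem (fun s => neg_mem (hQ1 s)) hG1, ⟨?_, ?_⟩⟩
  · intro s V h f x
    refine (hQ2 s V h f x).trans ?_
    simp [cochainOne]
  · exact fun s V h x => hG2 s V h x

end LocData

/-! ### The defect is a cocycle -/

section Defect

variable {k : Type u} [Field k] {T : TopCat.{u}} {R : AlgPresheaf k T} {P : PoissonStructure R}
  {A B : Type u} [CommRing A] [Algebra k A] [CommRing B] [Algebra k B] {ι : Type u}
  {E : PoissonBundle P} {ε : B →ₐ[k] k} {𝒰 : ι → Opens T} {μ : B →ₐ[k] A} {t : B}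

lemma slice_one_tmul {M : PMod R} {V : Opens T} (m : Sec M V) :
    slice ε.toLinearMap ((1 : B) ⊗ₜ[k] m) = m := by
  simp

/-- On `t ⊗ F` any lift of `∇` may be used, so the connections to the left and to the right of the
operator can be chosen independently. In the cocycle computations they belong to different charts.
-/
lemma tmul_homConn (hμ : IsSmall μ ε t) {U U' : Opens T}
    {C : ∀ V, V ≤ U → Fn R V →ₗ[k] Module.End B (B ⊗[k] Sec E.M V)}
    {C' : ∀ V, V ≤ U' → Fn R V →ₗ[k] Module.End B (B ⊗[k] Sec E.M V)} (hC : IsConnOn E ε C)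
    (hC' : IsConnOn E ε C') {V : Opens T} (h : V ≤ U) (h' : V ≤ U') (f : Fn R V)
    {N : B ⊗[k] Sec E.M V → B ⊗[k] Sec E.M V} {D : Sec E.M V → Sec E.M V}
    (hN : ∀ x, N x = t ⊗ₜ D (slice ε.toLinearMap x)) (m : Sec E.M V) :
    t ⊗ₜ homConn E f D m = C V h f (N (1 ⊗ₜ m)) - N (C' V h' f (1 ⊗ₜ m)) := by
  rw [hN, hN, hC'.conn_slice, slice_one_tmul, hC.apply_tmul hμ, ← TensorProduct.tmul_sub]
  rfl

/-- After applying `t ⊗ -` every component of the cochain is an expression in composed operators.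
The four components of `dc = 0` become the Bianchi identity, the comparison of curvatures in two
charts, the compatibility of a composite transition with the connections, and the associativity of a
triple composite. -/
theorem LocData.IsDefect.mem_cocycles {L : LocData E ε 𝒰} {c : Cochains E 𝒰}
    (hL : L.IsDefect t c) (hμ : IsSmall μ ε t) (hc : c ∈ total E 𝒰 2) : c ∈ cocycles E 𝒰 2 := by
  refine ⟨hc, ?_⟩
  change dTotal E 𝒰 c = 0
  funext p q
  by_cases hpq : (p + q : ℤ) = 2 + 1
  swap
  · exact dTotal_eq_zero hc p q hpq
  funext s ⟨V, (h : V ≤ inter 𝒰 s)⟩ f m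
  refine tmul_injective (M := E.M) (V := V) hμ.ne_zero ?_
  change t ⊗ₜ dTotal E 𝒰 c p q s ⟨V, h⟩ f m = t ⊗ₜ (0 : Sec E.M V)
  rw [TensorProduct.tmul_zero]
  obtain ⟨rfl, rfl⟩ | ⟨rfl, rfl⟩ | ⟨rfl, rfl⟩ | ⟨rfl, rfl⟩ :
      p = 3 ∧ q = 0 ∨ p = 2 ∧ q = 1 ∨ p = 1 ∧ q = 2 ∨ p = 0 ∧ q = 3 := by omega
  · obtain ⟨f0, f1, f2, rfl⟩ : ∃ f0 f1 f2, f = ![f0, f1, f2] := ⟨_, _, _, eq_vec_three f⟩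
    rw [dTotal_succ_zero, dPoisson_two]
    have hS : ∀ g g' x, t ⊗ₜ c 2 0 s ⟨V, h⟩ ![g, g'] (slice ε.toLinearMap x) =
        - curv P (L.conn (s 0) V (h.trans (inter_le 𝒰 s 0))) g g' x := fun g g' x => by
      rw [hL.curvature s V h, TensorProduct.tmul_neg, neg_neg]
    have hS1 : ∀ g g', t ⊗ₜ c 2 0 s ⟨V, h⟩ ![g, g'] m =
        - curv P (L.conn (s 0) V (h.trans (inter_le 𝒰 s 0))) g g' (1 ⊗ₜ m) := fun g g' => by
      rw [← hS, slice_one_tmul]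
    have hH : ∀ f g g', t ⊗ₜ homConn E f (c 2 0 s ⟨V, h⟩ ![g, g']) m = _ := fun f g g' =>
      tmul_homConn hμ (L.isConn (s 0)) (L.isConn (s 0)) (h.trans (inter_le 𝒰 s 0))
        (h.trans (inter_le 𝒰 s 0)) f (fun x => (hS g g' x).symm) m
    simp only [TensorProduct.tmul_add, TensorProduct.tmul_sub]
    erw [hH, hH, hH, hS1, hS1, hS1]
    simp only [curv_apply, map_neg, map_sub]
    -- The Jacobi identity expresses the iterated brackets through `{f0, {f1, f2}}` and `{f1, {f0,
    -- f2}}`. What remains is the Jacobi identity for commutators of operators.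
    rw [br_jacobi, P.skew V (P.br V f0 f2) f1]
    simp only [map_neg, map_sub, LinearMap.neg_apply, LinearMap.sub_apply]
    abel
  · obtain ⟨f0, f1, rfl⟩ : ∃ f0 f1, f = ![f0, f1] := ⟨_, _, eq_vec_two f⟩
    have h0 := h.trans (inter_le 𝒰 s 0)
    have h1 := h.trans (inter_le 𝒰 s 1)
    have hS : ∀ i h', t ⊗ₜ c 2 0 (Fin.removeNth i s) ⟨V, h'⟩ ![f0, f1] m = - curv P
        (L.conn (Fin.removeNth i s 0) V (h'.trans (inter_le 𝒰 _ 0))) f0 f1 (1 ⊗ₜ m) := by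
      intro i h'
      rw [hL.curvature (Fin.removeNth i s) V h', slice_one_tmul, TensorProduct.tmul_neg, neg_neg]
    -- Transition functions act as the identity on `F`. They can thus be composed on the left,
    -- acting on `t ⊗ F`, or on the right, acting before the slice, without changing the value. The
    -- placements here produce `F ∘ curv` from one chart and `curv ∘ F` from the other, so that both
    -- match the terms from the middle component.
    have hS0 : ∀ h', t ⊗ₜ c 2 0 (Fin.removeNth 0 s) ⟨V, h'⟩ ![f0, f1] m =
        - L.trans (s 0) (s 1) V (le_inf h0 h1) (curv P (L.conn (s 1) V h1) f0 f1 (1 ⊗ₜ m)) := by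
      intro h'
      have hF := (L.isHom (s 0) (s 1)).apply_tmul hμ (le_inf h0 h1)
        (c 2 0 (Fin.removeNth 0 s) ⟨V, h'⟩ ![f0, f1] m)
      rw [hS, map_neg] at hF
      rw [hS]
      exact hF.symm
    have hS1 : ∀ h', t ⊗ₜ c 2 0 (Fin.removeNth 1 s) ⟨V, h'⟩ ![f0, f1] m =
        - curv P (L.conn (s 0) V h0) f0 f1 (L.trans (s 0) (s 1) V (le_inf h0 h1) (1 ⊗ₜ m)) := by
      intro h'
      have := hL.curvature (Fin.removeNth 1 s) V h' f0 f1
        (L.trans (s 0) (s 1) V (le_inf h0 h1) (1 ⊗ₜ m))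
      rw [(L.isHom (s 0) (s 1)).hom_slice, slice_one_tmul, TensorProduct.tmul_neg] at this
      exact neg_eq_iff_eq_neg.mp this.symm
    have hQ := fun g x => (hL.compat s V h g x).symm
    have hQ1 : ∀ g, t ⊗ₜ c 1 1 s ⟨V, h⟩ ![g] m =
        L.conn (s 0) V h0 g (L.trans (s 0) (s 1) V (le_inf h0 h1) (1 ⊗ₜ m)) -
          L.trans (s 0) (s 1) V (le_inf h0 h1) (L.conn (s 1) V h1 g (1 ⊗ₜ m)) := fun g => by
      have := hQ g (1 ⊗ₜ m)
      rw [slice_one_tmul] at this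
      exact this
    have hH : ∀ f g, t ⊗ₜ homConn E f (c 1 1 s ⟨V, h⟩ ![g]) m = _ := fun f g =>
      tmul_homConn hμ (L.isConn (s 0)) (L.isConn (s 1)) h0 h1 f (fun x => (hQ g x).symm) m
    rw [dTotal_succ_succ]
    change t ⊗ₜ (dPoisson E 1 _ (c 1 1 s) ⟨V, h⟩ ![f0, f1] m +
      (-1 : ℤ) ^ (1 + 1 + 0 + 1) • cech E 𝒰 2 0 (c 2 0) s ⟨V, h⟩ ![f0, f1] m) = _
    rw [cech_apply, dPoisson_one, Fin.sum_univ_two]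
    simp only [TensorProduct.tmul_add, TensorProduct.tmul_sub, TensorProduct.tmul_smul, Fin.val_zero,
      Fin.val_one]
    erw [hH, hH, hS0, hS1, hQ1]
    simp only [curv_apply, map_sub]
    norm_num
    abel
  · obtain ⟨f0, rfl⟩ : ∃ f0, f = ![f0] := ⟨_, eq_vec_one f⟩
    have h0 := h.trans (inter_le 𝒰 s 0)
    have h1 := h.trans (inter_le 𝒰 s 1)
    have h2 := h.trans (inter_le 𝒰 s 2)
    have h01 := le_inf h0 h1
    have h02 := le_inf h0 h2
    have h12 := le_inf h1 h2
    -- The term without the index `s 0` is composed with the first transition function on the left,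
    -- and below the term without `s 2` is composed with the second one on the right. The sum then
    -- telescopes.
    have hQ0 : ∀ h', t ⊗ₜ c 1 1 (Fin.removeNth 0 s) ⟨V, h'⟩ ![f0] m =
        L.trans (s 0) (s 1) V h01 (L.conn (s 1) V h1 f0 (L.trans (s 1) (s 2) V h12 (1 ⊗ₜ m)) -
          L.trans (s 1) (s 2) V h12 (L.conn (s 2) V h2 f0 (1 ⊗ₜ m))) := by
      intro h'
      have := hL.compat (Fin.removeNth 0 s) V h' f0 (1 ⊗ₜ m)
      rw [slice_one_tmul] at this
      rw [← (L.isHom (s 0) (s 1)).apply_tmul hμ h01, ← this]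
      rfl
    have hQ1 : ∀ h', t ⊗ₜ c 1 1 (Fin.removeNth 1 s) ⟨V, h'⟩ ![f0] m =
        L.conn (s 0) V h0 f0 (L.trans (s 0) (s 2) V h02 (1 ⊗ₜ m)) -
          L.trans (s 0) (s 2) V h02 (L.conn (s 2) V h2 f0 (1 ⊗ₜ m)) := by
      intro h'
      have := hL.compat (Fin.removeNth 1 s) V h' f0 (1 ⊗ₜ m)
      rw [slice_one_tmul] at this
      exact this.symm
    have hQ2 : ∀ h', t ⊗ₜ c 1 1 (Fin.removeNth 2 s) ⟨V, h'⟩ ![f0] m =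
        L.conn (s 0) V h0 f0 (L.trans (s 0) (s 1) V h01 (L.trans (s 1) (s 2) V h12 (1 ⊗ₜ m))) -
          L.trans (s 0) (s 1) V h01 (L.conn (s 1) V h1 f0
            (L.trans (s 1) (s 2) V h12 (1 ⊗ₜ m))) := by
      intro h'
      have := hL.compat (Fin.removeNth 2 s) V h' f0 (L.trans (s 1) (s 2) V h12 (1 ⊗ₜ m))
      rw [(L.isHom (s 1) (s 2)).hom_slice, slice_one_tmul] at this
      exact this.symm
    have hG := fun x => (hL.cocycle s V h x).symm
    have hH := tmul_homConn hμ (L.isConn (s 0)) (L.isConn (s 2)) h0 h2 f0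
      (fun x => (hG x).symm) m
    rw [dTotal_succ_succ]
    change t ⊗ₜ (dPoisson E 0 _ (c 0 2 s) ⟨V, h⟩ ![f0] m +
      (-1 : ℤ) ^ (0 + 1 + 1 + 1) • cech E 𝒰 1 1 (c 1 1) s ⟨V, h⟩ ![f0] m) = _
    rw [cech_apply, dPoisson_zero, Fin.sum_univ_three]
    simp only [TensorProduct.tmul_add, TensorProduct.tmul_smul, Fin.val_zero, Fin.val_one,
      Fin.val_two]
    erw [hH, hQ0, hQ1, hQ2]
    simp only [map_sub]
    norm_num
    abel
  · obtain rfl : f = ![] := eq_vec_zero f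
    have h0 := h.trans (inter_le 𝒰 s 0)
    have h1 := h.trans (inter_le 𝒰 s 1)
    have h2 := h.trans (inter_le 𝒰 s 2)
    have h3 := h.trans (inter_le 𝒰 s 3)
    -- Only the two outer faces are composed with a transition function, the first on the left and
    -- the last on the right. All terms then cancel by associativity.
    have hG0 : ∀ h', t ⊗ₜ c 0 2 (Fin.removeNth 0 s) ⟨V, h'⟩ ![] m =
        L.trans (s 0) (s 1) V (le_inf h0 h1) (L.trans (s 1) (s 2) V (le_inf h1 h2)
          (L.trans (s 2) (s 3) V (le_inf h2 h3) (1 ⊗ₜ m)) -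
            L.trans (s 1) (s 3) V (le_inf h1 h3) (1 ⊗ₜ m)) := by
      intro h'
      have := hL.cocycle (Fin.removeNth 0 s) V h' (1 ⊗ₜ m)
      rw [slice_one_tmul] at this
      rw [← (L.isHom (s 0) (s 1)).apply_tmul hμ (le_inf h0 h1), ← this]
      rfl
    have hG1 : ∀ h', t ⊗ₜ c 0 2 (Fin.removeNth 1 s) ⟨V, h'⟩ ![] m =
        L.trans (s 0) (s 2) V (le_inf h0 h2) (L.trans (s 2) (s 3) V (le_inf h2 h3) (1 ⊗ₜ m)) -
          L.trans (s 0) (s 3) V (le_inf h0 h3) (1 ⊗ₜ m) := by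
      intro h'
      have := hL.cocycle (Fin.removeNth 1 s) V h' (1 ⊗ₜ m)
      rw [slice_one_tmul] at this
      exact this.symm
    have hG2 : ∀ h', t ⊗ₜ c 0 2 (Fin.removeNth 2 s) ⟨V, h'⟩ ![] m =
        L.trans (s 0) (s 1) V (le_inf h0 h1) (L.trans (s 1) (s 3) V (le_inf h1 h3) (1 ⊗ₜ m)) -
          L.trans (s 0) (s 3) V (le_inf h0 h3) (1 ⊗ₜ m) := by
      intro h'
      have := hL.cocycle (Fin.removeNth 2 s) V h' (1 ⊗ₜ m)
      rw [slice_one_tmul] at this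
      exact this.symm
    have hG3 : ∀ h', t ⊗ₜ c 0 2 (Fin.removeNth 3 s) ⟨V, h'⟩ ![] m =
        L.trans (s 0) (s 1) V (le_inf h0 h1) (L.trans (s 1) (s 2) V (le_inf h1 h2)
          (L.trans (s 2) (s 3) V (le_inf h2 h3) (1 ⊗ₜ m))) -
          L.trans (s 0) (s 2) V (le_inf h0 h2)
            (L.trans (s 2) (s 3) V (le_inf h2 h3) (1 ⊗ₜ m)) := by
      intro h'
      have := hL.cocycle (Fin.removeNth 3 s) V h' (L.trans (s 2) (s 3) V (le_inf h2 h3) (1 ⊗ₜ m))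
      rw [(L.isHom (s 2) (s 3)).hom_slice, slice_one_tmul] at this
      exact this.symm
    rw [dTotal_zero_succ]
    change t ⊗ₜ ((-1 : ℤ) ^ (0 + 2 + 1) • cech E 𝒰 0 2 (c 0 2) s ⟨V, h⟩ ![] m) = _
    rw [cech_apply, Fin.sum_univ_four]
    simp only [TensorProduct.tmul_add, TensorProduct.tmul_smul, Fin.val_zero, Fin.val_one,
      Fin.val_two]
    erw [hG0, hG1, hG2, hG3]
    simp only [map_sub]
    norm_num
    abel

/-- Conjugation by `θ` would carry the equations of `L'` to those of `L` if `θ` intertwined the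
data; the error terms are linear in `b` because `t` times the maximal ideal vanishes, and they add
up to `db`. The same formula serves for changes of trivialization, for perturbations with `θ = 1`,
and for the closedness of first-order cochains. -/
theorem LocData.IsGauge.dTotal_eq {L L' : LocData E ε 𝒰}
    {θ : ∀ α V, V ≤ 𝒰 α → Module.End B (B ⊗[k] Sec E.M V)} {b c c' : Cochains E 𝒰}
    (hb : L.IsGauge L' θ t b) (hL : L.IsDefect t c) (hL' : L'.IsDefect t c')
    (hθ : ∀ α, IsHomOn E ε (θ α)) (hμ : IsSmall μ ε t) (hb1 : b ∈ total E 𝒰 1)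
    (hc : c ∈ total E 𝒰 2) (hc' : c' ∈ total E 𝒰 2) : dTotal E 𝒰 b = c - c' := by
  funext p q
  by_cases hpq : (p + q : ℤ) = 2
  swap
  · rw [dTotal_eq_zero hb1 p q hpq, Pi.sub_apply, Pi.sub_apply, hc.2 p q hpq, hc'.2 p q hpq,
      sub_zero]
  funext s ⟨V, (h : V ≤ inter 𝒰 s)⟩ f m
  refine tmul_injective (M := E.M) (V := V) hμ.ne_zero ?_
  change t ⊗ₜ dTotal E 𝒰 b p q s ⟨V, h⟩ f m =
    t ⊗ₜ (c p q s ⟨V, h⟩ f m - c' p q s ⟨V, h⟩ f m : Sec E.M V)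
  rw [TensorProduct.tmul_sub]
  obtain ⟨rfl, rfl⟩ | ⟨rfl, rfl⟩ | ⟨rfl, rfl⟩ :
      p = 2 ∧ q = 0 ∨ p = 1 ∧ q = 1 ∨ p = 0 ∧ q = 2 := by omega
  · obtain ⟨f0, f1, rfl⟩ : ∃ f0 f1, f = ![f0, f1] := ⟨_, _, eq_vec_two f⟩
    have h0 := h.trans (inter_le 𝒰 s 0)
    -- The defect of `L` is evaluated after `θ` and that of `L'` before `θ`. Both are allowed
    -- because `θ` induces the identity on `F` and on `t ⊗ F`.
    have hS : t ⊗ₜ c 2 0 s ⟨V, h⟩ ![f0, f1] m =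
        - curv P (L.conn (s 0) V h0) f0 f1 (θ (s 0) V h0 (1 ⊗ₜ m)) := by
      have := hL.curvature s V h f0 f1 (θ (s 0) V h0 (1 ⊗ₜ m))
      rw [(hθ (s 0)).hom_slice, slice_one_tmul, TensorProduct.tmul_neg] at this
      exact neg_eq_iff_eq_neg.mp this.symm
    have hS' : t ⊗ₜ c' 2 0 s ⟨V, h⟩ ![f0, f1] m =
        - θ (s 0) V h0 (curv P (L'.conn (s 0) V h0) f0 f1 (1 ⊗ₜ m)) := by
      have := hL'.curvature s V h f0 f1 (1 ⊗ₜ m)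
      rw [slice_one_tmul, TensorProduct.tmul_neg] at this
      rw [this, map_neg, (hθ (s 0)).apply_tmul hμ, neg_neg]
    have hQ : ∀ g x, t ⊗ₜ b 1 0 s ⟨V, h⟩ ![g] (slice ε.toLinearMap x) =
        θ (s 0) V h0 (L'.conn (s 0) V h0 g x) - L.conn (s 0) V h0 g (θ (s 0) V h0 x) := by
      intro g x
      have := hb.conn s V h g x
      rw [TensorProduct.tmul_neg] at this
      rw [← neg_sub]
      exact neg_eq_iff_eq_neg.mp this.symm
    have hQ1 : ∀ g, t ⊗ₜ b 1 0 s ⟨V, h⟩ ![g] m =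
        θ (s 0) V h0 (L'.conn (s 0) V h0 g (1 ⊗ₜ m)) -
          L.conn (s 0) V h0 g (θ (s 0) V h0 (1 ⊗ₜ m)) := fun g => by
      have := hQ g (1 ⊗ₜ m)
      rw [slice_one_tmul] at this
      exact this
    have hH : ∀ f g, t ⊗ₜ homConn E f (b 1 0 s ⟨V, h⟩ ![g]) m = _ := fun f g =>
      tmul_homConn hμ (L.isConn (s 0)) (L'.isConn (s 0)) h0 h0 f (fun x => (hQ g x).symm) m
    rw [dTotal_succ_zero, hS, hS', dPoisson_one]
    simp only [TensorProduct.tmul_sub]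
    erw [hH, hH, hQ1]
    simp only [curv_apply, map_sub]
    abel
  · obtain ⟨f0, rfl⟩ : ∃ f0, f = ![f0] := ⟨_, eq_vec_one f⟩
    have h0 := h.trans (inter_le 𝒰 s 0)
    have h1 := h.trans (inter_le 𝒰 s 1)
    have h01 := le_inf h0 h1
    have hQ : t ⊗ₜ c 1 1 s ⟨V, h⟩ ![f0] m =
        L.conn (s 0) V h0 f0 (L.trans (s 0) (s 1) V h01 (θ (s 1) V h1 (1 ⊗ₜ m))) -
          L.trans (s 0) (s 1) V h01 (L.conn (s 1) V h1 f0 (θ (s 1) V h1 (1 ⊗ₜ m))) := by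
      have := hL.compat s V h f0 (θ (s 1) V h1 (1 ⊗ₜ m))
      rw [(hθ (s 1)).hom_slice, slice_one_tmul] at this
      exact this.symm
    have hQ' : t ⊗ₜ c' 1 1 s ⟨V, h⟩ ![f0] m =
        θ (s 0) V h0 (L'.conn (s 0) V h0 f0 (L'.trans (s 0) (s 1) V h01 (1 ⊗ₜ m)) -
          L'.trans (s 0) (s 1) V h01 (L'.conn (s 1) V h1 f0 (1 ⊗ₜ m))) := by
      have := hL'.compat s V h f0 (1 ⊗ₜ m)
      rw [slice_one_tmul] at this
      rw [this, (hθ (s 0)).apply_tmul hμ]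
    have hB : ∀ i h', t ⊗ₜ[k] b 1 0 (Fin.removeNth i s) ⟨V, h'⟩ ![f0] m =
        - (t ⊗ₜ (- b 1 0 (Fin.removeNth i s) ⟨V, h'⟩ ![f0] m)) := fun i h' => by
      rw [TensorProduct.tmul_neg, neg_neg]
    have hB0 : ∀ h', t ⊗ₜ b 1 0 (Fin.removeNth 0 s) ⟨V, h'⟩ ![f0] m =
        - L.trans (s 0) (s 1) V h01 (L.conn (s 1) V h1 f0 (θ (s 1) V h1 (1 ⊗ₜ m)) -
          θ (s 1) V h1 (L'.conn (s 1) V h1 f0 (1 ⊗ₜ m))) := by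
      intro h'
      have := hb.conn (Fin.removeNth 0 s) V h' f0 (1 ⊗ₜ m)
      rw [slice_one_tmul] at this
      rw [hB, ← (L.isHom (s 0) (s 1)).apply_tmul hμ h01, ← this]
      rfl
    have hB1 : ∀ h', t ⊗ₜ b 1 0 (Fin.removeNth 1 s) ⟨V, h'⟩ ![f0] m =
        - (L.conn (s 0) V h0 f0 (θ (s 0) V h0 (L'.trans (s 0) (s 1) V h01 (1 ⊗ₜ m))) -
          θ (s 0) V h0 (L'.conn (s 0) V h0 f0 (L'.trans (s 0) (s 1) V h01 (1 ⊗ₜ m)))) := by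
      intro h'
      have := hb.conn (Fin.removeNth 1 s) V h' f0 (L'.trans (s 0) (s 1) V h01 (1 ⊗ₜ m))
      rw [(L'.isHom (s 0) (s 1)).hom_slice, slice_one_tmul] at this
      rw [hB, ← this]
      rfl
    have hG := fun x => (hb.trans s V h x).symm
    have hH := tmul_homConn hμ (L.isConn (s 0)) (L'.isConn (s 1)) h0 h1 f0
      (fun x => (hG x).symm) m
    rw [dTotal_succ_succ, hQ, hQ']
    change t ⊗ₜ (dPoisson E 0 _ (b 0 1 s) ⟨V, h⟩ ![f0] m +
      (-1 : ℤ) ^ (0 + 1 + 0 + 1) • cech E 𝒰 1 0 (b 1 0) s ⟨V, h⟩ ![f0] m) = _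
    rw [cech_apply, dPoisson_zero, Fin.sum_univ_two]
    simp only [TensorProduct.tmul_add, TensorProduct.tmul_smul, Fin.val_zero, Fin.val_one]
    erw [hH, hB0, hB1]
    simp only [map_sub]
    norm_num
    abel
  · obtain rfl : f = ![] := eq_vec_zero f
    have h0 := h.trans (inter_le 𝒰 s 0)
    have h1 := h.trans (inter_le 𝒰 s 1)
    have h2 := h.trans (inter_le 𝒰 s 2)
    have h01 := le_inf h0 h1
    have h02 := le_inf h0 h2
    have h12 := le_inf h1 h2
    have hG : t ⊗ₜ c 0 2 s ⟨V, h⟩ ![] m =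
        L.trans (s 0) (s 1) V h01 (L.trans (s 1) (s 2) V h12 (θ (s 2) V h2 (1 ⊗ₜ m))) -
          L.trans (s 0) (s 2) V h02 (θ (s 2) V h2 (1 ⊗ₜ m)) := by
      have := hL.cocycle s V h (θ (s 2) V h2 (1 ⊗ₜ m))
      rw [(hθ (s 2)).hom_slice, slice_one_tmul] at this
      exact this.symm
    have hG' : t ⊗ₜ c' 0 2 s ⟨V, h⟩ ![] m =
        θ (s 0) V h0 (L'.trans (s 0) (s 1) V h01 (L'.trans (s 1) (s 2) V h12 (1 ⊗ₜ m)) -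
          L'.trans (s 0) (s 2) V h02 (1 ⊗ₜ m)) := by
      have := hL'.cocycle s V h (1 ⊗ₜ m)
      rw [slice_one_tmul] at this
      rw [this, (hθ (s 0)).apply_tmul hμ]
    have hB0 : ∀ h', t ⊗ₜ b 0 1 (Fin.removeNth 0 s) ⟨V, h'⟩ ![] m =
        L.trans (s 0) (s 1) V h01 (L.trans (s 1) (s 2) V h12 (θ (s 2) V h2 (1 ⊗ₜ m)) -
          θ (s 1) V h1 (L'.trans (s 1) (s 2) V h12 (1 ⊗ₜ m))) := by
      intro h'
      have := hb.trans (Fin.removeNth 0 s) V h' (1 ⊗ₜ m)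
      rw [slice_one_tmul] at this
      rw [← (L.isHom (s 0) (s 1)).apply_tmul hμ h01, ← this]
      rfl
    have hB1 : ∀ h', t ⊗ₜ b 0 1 (Fin.removeNth 1 s) ⟨V, h'⟩ ![] m =
        L.trans (s 0) (s 2) V h02 (θ (s 2) V h2 (1 ⊗ₜ m)) -
          θ (s 0) V h0 (L'.trans (s 0) (s 2) V h02 (1 ⊗ₜ m)) := by
      intro h'
      have := hb.trans (Fin.removeNth 1 s) V h' (1 ⊗ₜ m)
      rw [slice_one_tmul] at this
      exact this.symm
    have hB2 : ∀ h', t ⊗ₜ b 0 1 (Fin.removeNth 2 s) ⟨V, h'⟩ ![] m =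
        L.trans (s 0) (s 1) V h01 (θ (s 1) V h1 (L'.trans (s 1) (s 2) V h12 (1 ⊗ₜ m))) -
          θ (s 0) V h0 (L'.trans (s 0) (s 1) V h01 (L'.trans (s 1) (s 2) V h12 (1 ⊗ₜ m))) := by
      intro h'
      have := hb.trans (Fin.removeNth 2 s) V h' (L'.trans (s 1) (s 2) V h12 (1 ⊗ₜ m))
      rw [(L'.isHom (s 1) (s 2)).hom_slice, slice_one_tmul] at this
      exact this.symm
    rw [dTotal_zero_succ, hG, hG']
    change t ⊗ₜ ((-1 : ℤ) ^ (0 + 1 + 1) • cech E 𝒰 0 1 (b 0 1) s ⟨V, h⟩ ![] m) = _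
    rw [cech_apply, Fin.sum_univ_three]
    simp only [TensorProduct.tmul_add, TensorProduct.tmul_smul, Fin.val_zero, Fin.val_one,
      Fin.val_two]
    erw [hB0, hB1, hB2]
    simp only [map_sub]
    norm_num
    abel

end Defect

/-! ### Perturbations of local data -/

section Perturb

variable {k : Type u} [Field k] {T : TopCat.{u}} {R : AlgPresheaf k T} {P : PoissonStructure R}
  {A B : Type u} [CommRing A] [Algebra k A] [CommRing B] [Algebra k B] {ι : Type u}
  {E : PoissonBundle P} {ε : B →ₐ[k] k} {𝒰 : ι → Opens T} {μ : B →ₐ[k] A} {t : B}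

lemma IsPolyvector.restrict {M : PMod R} {p : ℕ} {U V : Opens T} (h : V ≤ U) {D : Op M p U}
    (hD : IsPolyvector D) : IsPolyvector (Op.restrict h D) :=
  ⟨fun W => hD.map_add ⟨W.1, W.2.trans h⟩, fun W => hD.map_smul ⟨W.1, W.2.trans h⟩,
    fun W => hD.add ⟨W.1, W.2.trans h⟩, fun W => hD.smul ⟨W.1, W.2.trans h⟩,
    fun W => hD.mul ⟨W.1, W.2.trans h⟩, fun W => hD.alt ⟨W.1, W.2.trans h⟩,
    fun {W W'} hW => hD.res (W := ⟨W.1, W.2.trans h⟩) (V := ⟨W'.1, W'.2.trans h⟩) hW⟩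

lemma le_inter_const (α : ι) {q : ℕ} : 𝒰 α ≤ inter 𝒰 (fun _ : Fin (q + 1) => α) :=
  le_iInf fun _ => le_rfl

lemma le_inter_pair (α β : ι) : 𝒰 α ⊓ 𝒰 β ≤ inter 𝒰 ![α, β] :=
  le_iInf fun i => by fin_cases i; exacts [inf_le_left, inf_le_right]

lemma isHomOn_one_add (hμ : IsSmall μ ε t) (ht : ε t = 0) {U : Opens T} {D : Op E.M 0 U}
    (hD : IsPolyvector D) :
    IsHomOn E ε fun V h => (1 : Module.End B (B ⊗[k] Sec E.M V)) + polyOp hμ.mul hD V h ![] :=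
  IsHomOn.add_polyOp hμ ht IsHomOn.one hD

/-- Local data changed by a cochain with values in `(t)`. -/
def LocData.perturb (L : LocData E ε 𝒰) (hμ : IsSmall μ ε t) (ht : ε t = 0) {b : Cochains E 𝒰}
    (hb : b ∈ total E 𝒰 1) : LocData E ε 𝒰 where
  conn α V h := L.conn α V h +
    polyConn hμ.mul (IsPolyvector.restrict (le_inter_const α) (hb.1 1 0 fun _ => α)) V h
  isConn α := (L.isConn α).add_polyOp hμ ht
    (IsPolyvector.restrict (le_inter_const α) (hb.1 1 0 fun _ => α))
  -- The transition functions are changed by `-b` and the connections by `+b`. These signs match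
  -- `IsGauge`, which records the difference of connections with a minus sign.
  trans α β V h := L.trans α β V h +
    polyOp hμ.mul (IsPolyvector.restrict (le_inter_pair α β) (neg_mem (hb.1 0 1 ![α, β]))) V h ![]
  isHom α β := (L.isHom α β).add_polyOp hμ ht
    (IsPolyvector.restrict (le_inter_pair α β) (neg_mem (hb.1 0 1 ![α, β])))

lemma LocData.isGauge_perturb (L : LocData E ε 𝒰) (hμ : IsSmall μ ε t) (ht : ε t = 0)
    {b : Cochains E 𝒰} (hb : b ∈ total E 𝒰 1) :
    L.IsGauge (L.perturb hμ ht hb) (fun _ _ _ => 1) t b := by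
  constructor
  · intro s V h f x
    obtain ⟨α, rfl⟩ : ∃ α, s = fun _ => α := ⟨s 0, funext fun i => by rw [Subsingleton.elim i 0]⟩
    change L.conn α V _ f x - (L.conn α V _ f x + t ⊗ₜ b 1 0 _ ⟨V, _⟩ ![f] _) = _
    rw [sub_add_cancel_left, TensorProduct.tmul_neg]
  · intro s V h x
    obtain ⟨α, β, rfl⟩ : ∃ α β, s = ![α, β] := ⟨_, _, eq_vec_two s⟩
    change L.trans α β V _ x - (L.trans α β V _ x + t ⊗ₜ (- b 0 1 _ ⟨V, _⟩ ![] _)) = _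
    rw [sub_add_cancel_left, TensorProduct.tmul_neg, neg_neg]
    rfl

lemma LocData.IsGauge.symm_one {L L' : LocData E ε 𝒰} {b : Cochains E 𝒰}
    (hb : L.IsGauge L' (fun _ _ _ => 1) t b) : L'.IsGauge L (fun _ _ _ => 1) t (-b) := by
  constructor
  · intro s V h f x
    have := hb.conn s V h f x
    simp only [Module.End.one_apply] at this ⊢
    rw [← neg_sub, this, ← TensorProduct.tmul_neg]
    rfl
  · intro s V h x
    have := hb.trans s V h x
    simp only [Module.End.one_apply] at this ⊢
    rw [← neg_sub, this, ← TensorProduct.tmul_neg]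
    rfl

/-- Local data that satisfy all the conditions for gluing. -/
structure LocData.IsStrict (L : LocData E ε 𝒰) : Prop where
  flat : ∀ α V h f g x, curv P (L.conn α V h) f g x = 0
  compat : ∀ α β V hα hβ f x,
    L.conn α V hα f (L.trans α β V (le_inf hα hβ) x) =
      L.trans α β V (le_inf hα hβ) (L.conn β V hβ f x)
  cocycle : ∀ α β γ V hα hβ hγ x,
    L.trans α β V (le_inf hα hβ) (L.trans β γ V (le_inf hβ hγ) x) =
      L.trans α γ V (le_inf hα hγ) x

lemma LocData.IsStrict.isStrictMod {L : LocData E ε 𝒰} (hL : L.IsStrict) (μ : B →ₐ[k] A) :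
    L.IsStrictMod μ :=
  ⟨fun α V h f g x => by rw [hL.flat, map_zero],
    fun α β V hα hβ f x => congrArg _ (hL.compat α β V hα hβ f x),
    fun α β γ V hα hβ hγ x => congrArg _ (hL.cocycle α β γ V hα hβ hγ x)⟩

lemma LocData.IsStrict.isDefect {L : LocData E ε 𝒰} (hL : L.IsStrict) (t : B) :
    L.IsDefect t 0 := by
  constructor
  · intro s V h f g x
    rw [hL.flat]
    exact ((congrArg _ neg_zero).trans (TensorProduct.tmul_zero _ _)).symm
  · intro s V h f x h0 h1
    rw [hL.compat _ _ V h0 h1, sub_self]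
    exact (TensorProduct.tmul_zero _ _).symm
  · intro s V h x h0 h1 h2
    rw [hL.cocycle _ _ _ V h0 h1 h2, sub_self]
    exact (TensorProduct.tmul_zero _ _).symm

lemma LocData.IsDefect.isStrict {L : LocData E ε 𝒰} (hL : L.IsDefect t 0) : L.IsStrict := by
  constructor
  · intro α V h f g x
    exact (hL.curvature (fun _ => α) V (h.trans (le_inter_const α)) f g x).trans
      ((congrArg _ neg_zero).trans (TensorProduct.tmul_zero _ _))
  · intro α β V hα hβ f x
    exact sub_eq_zero.mp ((hL.compat ![α, β] V ((le_inf hα hβ).trans (le_inter_pair α β)) f x).trans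
      (TensorProduct.tmul_zero _ _))
  · intro α β γ V hα hβ hγ x
    have h : V ≤ inter 𝒰 ![α, β, γ] := le_iInf fun i => by fin_cases i; exacts [hα, hβ, hγ]
    exact sub_eq_zero.mp ((hL.cocycle ![α, β, γ] V h x).trans (TensorProduct.tmul_zero _ _))

/-- A lifted connection preserves the kernel `t ⊗ F` of reduction, so it descends to `F ⊗ A`. -/
lemma IsConnOn.rTensor_congr (hμ : IsSmall μ ε t) {U V : Opens T} (h : V ≤ U)
    {C : ∀ V, V ≤ U → Fn R V →ₗ[k] Module.End B (B ⊗[k] Sec E.M V)} (hC : IsConnOn E ε C)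
    (f : Fn R V) {x y : B ⊗[k] Sec E.M V} (hxy : LinearMap.rTensor (Sec E.M V) μ.toLinearMap x =
      LinearMap.rTensor (Sec E.M V) μ.toLinearMap y) :
    LinearMap.rTensor (Sec E.M V) μ.toLinearMap (C V h f x) =
      LinearMap.rTensor (Sec E.M V) μ.toLinearMap (C V h f y) := by
  obtain ⟨m, hm⟩ := exists_tmul_of_rTensor_eq_zero μ hμ.surj hμ.ne_zero hμ.ker (x - y)
    (by rw [map_sub, hxy, sub_self])
  rw [← sub_eq_zero, ← map_sub, ← map_sub, hm, hC.apply_tmul hμ, rTensor_tmul_eq_zero hμ]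

lemma IsHomOn.rTensor_congr (hμ : IsSmall μ ε t) {U V : Opens T} (h : V ≤ U)
    {θ : ∀ V, V ≤ U → Module.End B (B ⊗[k] Sec E.M V)} (hθ : IsHomOn E ε θ)
    {x y : B ⊗[k] Sec E.M V} (hxy : LinearMap.rTensor (Sec E.M V) μ.toLinearMap x =
      LinearMap.rTensor (Sec E.M V) μ.toLinearMap y) :
    LinearMap.rTensor (Sec E.M V) μ.toLinearMap (θ V h x) =
      LinearMap.rTensor (Sec E.M V) μ.toLinearMap (θ V h y) := by
  obtain ⟨m, hm⟩ := exists_tmul_of_rTensor_eq_zero μ hμ.surj hμ.ne_zero hμ.ker (x - y)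
    (by rw [map_sub, hxy, sub_self])
  rw [← sub_eq_zero, ← map_sub, ← map_sub, hm, hθ.apply_tmul hμ, rTensor_tmul_eq_zero hμ]

lemma LocData.IsGauge.rTensor_conn {L L' : LocData E ε 𝒰} {b : Cochains E 𝒰}
    (hb : L.IsGauge L' (fun _ _ _ => 1) t b) (hμ : IsSmall μ ε t) (α : ι) (V : Opens T)
    (h : V ≤ 𝒰 α) (f : Fn R V) (x : B ⊗[k] Sec E.M V) :
    LinearMap.rTensor (Sec E.M V) μ.toLinearMap (L'.conn α V h f x) =
      LinearMap.rTensor (Sec E.M V) μ.toLinearMap (L.conn α V h f x) := by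
  have := hb.conn (fun _ => α) V (h.trans (le_inter_const α)) f x
  rw [eq_comm, ← sub_eq_zero, ← map_sub]
  exact (congrArg _ this).trans (rTensor_tmul_eq_zero hμ _)

lemma LocData.IsGauge.rTensor_trans {L L' : LocData E ε 𝒰} {b : Cochains E 𝒰}
    (hb : L.IsGauge L' (fun _ _ _ => 1) t b) (hμ : IsSmall μ ε t) (α β : ι) (V : Opens T)
    (h : V ≤ 𝒰 α ⊓ 𝒰 β) (x : B ⊗[k] Sec E.M V) :
    LinearMap.rTensor (Sec E.M V) μ.toLinearMap (L'.trans α β V h x) =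
      LinearMap.rTensor (Sec E.M V) μ.toLinearMap (L.trans α β V h x) := by
  have := hb.trans ![α, β] V (h.trans (le_inter_pair α β)) x
  rw [eq_comm, ← sub_eq_zero, ← map_sub]
  exact (congrArg _ this).trans (rTensor_tmul_eq_zero hμ _)

lemma LocData.IsGauge.isStrictMod {L L' : LocData E ε 𝒰} {b : Cochains E 𝒰}
    (hb : L.IsGauge L' (fun _ _ _ => 1) t b) (hL : L.IsStrictMod μ) (hμ : IsSmall μ ε t) :
    L'.IsStrictMod μ := by
  have hcc : ∀ α V h f g x, LinearMap.rTensor (Sec E.M V) μ.toLinearMap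
      (L'.conn α V h f (L'.conn α V h g x)) =
        LinearMap.rTensor (Sec E.M V) μ.toLinearMap (L.conn α V h f (L.conn α V h g x)) :=
    fun α V h f g x => (hb.rTensor_conn hμ α V h f _).trans
      ((L.isConn α).rTensor_congr hμ h f (hb.rTensor_conn hμ α V h g x))
  refine ⟨fun α V h f g x => ?_, fun α β V hα hβ f x => ?_, fun α β γ V hα hβ hγ x => ?_⟩
  · rw [curv_apply, map_sub, map_sub, hcc, hcc, hb.rTensor_conn hμ, ← map_sub, ← map_sub]
    exact hL.curvature α V h f g x
  · rw [hb.rTensor_conn hμ, hb.rTensor_trans hμ,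
      (L.isConn α).rTensor_congr hμ hα f (hb.rTensor_trans hμ α β V (le_inf hα hβ) x),
      (L.isHom α β).rTensor_congr hμ (le_inf hα hβ) (hb.rTensor_conn hμ β V hβ f x)]
    exact hL.compat α β V hα hβ f x
  · rw [hb.rTensor_trans hμ, hb.rTensor_trans hμ,
      (L.isHom α β).rTensor_congr hμ (le_inf hα hβ) (hb.rTensor_trans hμ β γ V (le_inf hβ hγ) x)]
    exact hL.cocycle α β γ V hα hβ hγ x

/-- If `c'` is the defect of the perturbed data, then `db = c - c'`. The hypothesis `db = c` leaves
`c' = 0`, and data without defect are strict. -/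
lemma LocData.IsGauge.isStrict [CharZero k] {L L' : LocData E ε 𝒰} {b c : Cochains E 𝒰}
    (hb : L.IsGauge L' (fun _ _ _ => 1) t b) (hL : L.IsStrictMod μ) (hμ : IsSmall μ ε t)
    (hb1 : b ∈ total E 𝒰 1) (hc : c ∈ total E 𝒰 2) (hcL : L.IsDefect t c)
    (hbc : dTotal E 𝒰 b = c) : L'.IsStrict := by
  obtain ⟨c', hc', hcL'⟩ := (hb.isStrictMod hL hμ).exists_isDefect hμ
  have := hb.dTotal_eq hcL hcL' (fun α => IsHomOn.one) hμ hb1 hc hc'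
  rw [hbc, eq_comm, sub_eq_self] at this
  subst this
  exact hcL'.isStrict

/-- The constant local data. -/
def LocData.const (E : PoissonBundle P) (ε : B →ₐ[k] k) (𝒰 : ι → Opens T) : LocData E ε 𝒰 where
  conn _ V _ := constConn E B V
  isConn α := isConnOn_constConn ε (𝒰 α)
  trans _ _ _ _ := 1
  isHom _ _ := IsHomOn.one

lemma LocData.isStrict_const : (LocData.const E ε 𝒰).IsStrict := by
  refine ⟨fun α V h f g x => ?_, fun α β V hα hβ f x => rfl, fun α β γ V hα hβ hγ x => rfl⟩
  change curv P (constConn E B V) f g x = 0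
  induction x using tensor_induction with
  | h0 => rw [map_zero]
  | ha x y hx hy => rw [map_add, hx, hy, add_zero]
  | ht b m =>
    rw [curv_apply, constConn_tmul, constConn_tmul, constConn_tmul, constConn_tmul, constConn_tmul,
      E.flat, TensorProduct.tmul_add]
    abel

/-- The effect of a gauge transformation `1 + t H` on `1`-cochains. -/
lemma LocData.IsGauge.conn_sub {L L' L₀ : LocData E ε 𝒰} {b b' H : Cochains E 𝒰}
    (hb : L.IsGauge L₀ (fun _ _ _ => 1) t b) (hb' : L'.IsGauge L₀ (fun _ _ _ => 1) t b')
    (hμ : IsSmall μ ε t) {θ : ∀ α V, V ≤ 𝒰 α → Module.End B (B ⊗[k] Sec E.M V)}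
    (hθ : ∀ (s : Fin 1 → ι) (V : Opens T) (h : V ≤ inter 𝒰 s) (x : B ⊗[k] Sec E.M V),
      θ (s 0) V (h.trans (inter_le 𝒰 s 0)) x =
        x + t ⊗ₜ H 0 0 s ⟨V, h⟩ ![] (slice ε.toLinearMap x))
    (s : Fin 1 → ι) (V : Opens T) (h : V ≤ inter 𝒰 s) (f : Fn R V) (x : B ⊗[k] Sec E.M V) :
    L.conn (s 0) V (h.trans (inter_le 𝒰 s 0)) f (θ (s 0) V (h.trans (inter_le 𝒰 s 0)) x) -
      θ (s 0) V (h.trans (inter_le 𝒰 s 0)) (L'.conn (s 0) V (h.trans (inter_le 𝒰 s 0)) f x) =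
    t ⊗ₜ ((dTotal E 𝒰 H - (b - b')) 1 0 s ⟨V, h⟩ ![f] (slice ε.toLinearMap x)) := by
  have h1 := hb.conn s V h f x
  have h2 := hb'.conn s V h f x
  simp only [Module.End.one_apply, TensorProduct.tmul_neg] at h1 h2
  rw [hθ s V h, hθ s V h, map_add, (L.isConn _).apply_tmul hμ, (L'.isConn _).conn_slice]
  change _ = t ⊗ₜ[k] (dTotal E 𝒰 H 1 0 s ⟨V, h⟩ ![f] _ -
    (b 1 0 s ⟨V, h⟩ ![f] _ - b' 1 0 s ⟨V, h⟩ ![f] _) : Sec E.M V)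
  rw [dTotal_succ_zero, dPoisson_zero, TensorProduct.tmul_sub, TensorProduct.tmul_sub, homConn,
    TensorProduct.tmul_sub, sub_eq_iff_eq_add.mp h1, sub_eq_iff_eq_add.mp h2]
  abel

/-- The sign is opposite to that for connections, again because of the minus sign in the first
component of `IsGauge`. -/
lemma LocData.IsGauge.trans_sub {L L' L₀ : LocData E ε 𝒰} {b b' H : Cochains E 𝒰}
    (hb : L.IsGauge L₀ (fun _ _ _ => 1) t b) (hb' : L'.IsGauge L₀ (fun _ _ _ => 1) t b')
    (hμ : IsSmall μ ε t) {θ : ∀ α V, V ≤ 𝒰 α → Module.End B (B ⊗[k] Sec E.M V)}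
    (hθ : ∀ (s : Fin 1 → ι) (V : Opens T) (h : V ≤ inter 𝒰 s) (x : B ⊗[k] Sec E.M V),
      θ (s 0) V (h.trans (inter_le 𝒰 s 0)) x =
        x + t ⊗ₜ H 0 0 s ⟨V, h⟩ ![] (slice ε.toLinearMap x))
    (s : Fin 2 → ι) (V : Opens T) (h : V ≤ inter 𝒰 s) (x : B ⊗[k] Sec E.M V) :
    let h0 := h.trans (inter_le 𝒰 s 0)
    let h1 := h.trans (inter_le 𝒰 s 1)
    L.trans (s 0) (s 1) V (le_inf h0 h1) (θ (s 1) V h1 x) -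
      θ (s 0) V h0 (L'.trans (s 0) (s 1) V (le_inf h0 h1) x) =
    t ⊗ₜ ((b - b' - dTotal E 𝒰 H) 0 1 s ⟨V, h⟩ ![] (slice ε.toLinearMap x)) := by
  intro h0 h1
  have e1 := hb.trans s V h x
  have e2 := hb'.trans s V h x
  simp only [Module.End.one_apply] at e1 e2
  -- Deleting the index `1` leaves the chart `s 0`, and deleting the index `0` leaves `s 1`. In this
  -- form the two values of `H` are the terms of the Čech differential.
  have t0 := hθ (Fin.removeNth 1 s) V (h.trans (inter_le_face 𝒰 s 1))
    (L'.trans (s 0) (s 1) V (le_inf h0 h1) x)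
  have t1 := hθ (Fin.removeNth 0 s) V (h.trans (inter_le_face 𝒰 s 0)) x
  erw [t0, t1]
  rw [map_add, (L.isHom _ _).apply_tmul hμ, (L'.isHom _ _).hom_slice]
  change _ = t ⊗ₜ[k] ((b 0 1 s ⟨V, h⟩ ![] _ - b' 0 1 s ⟨V, h⟩ ![] _) -
    dTotal E 𝒰 H 0 1 s ⟨V, h⟩ ![] _ : Sec E.M V)
  rw [dTotal_zero_succ]
  change _ = t ⊗ₜ[k] ((b 0 1 s ⟨V, h⟩ ![] _ - b' 0 1 s ⟨V, h⟩ ![] _) -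
    ((-1 : ℤ) ^ (0 + 0 + 1) • cech E 𝒰 0 0 (H 0 0) s ⟨V, h⟩ ![] _) : Sec E.M V)
  rw [cech_apply, Fin.sum_univ_two, sub_eq_iff_eq_add.mp e1, sub_eq_iff_eq_add.mp e2]
  simp only [TensorProduct.tmul_add, TensorProduct.tmul_sub, TensorProduct.tmul_smul, Fin.val_zero,
    Fin.val_one]
  norm_num
  abel

end Perturb

/-! ### Local data of a trivialized deformation -/

section Triv

variable {k : Type u} [Field k] {T : TopCat.{u}} {R : AlgPresheaf k T} {P : PoissonStructure R}
  {A B : Type u} [CommRing A] [Algebra k A] [CommRing B] [Algebra k B] {ι : Type u}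
  {E : PoissonBundle P} {ε : A →ₐ[k] k} {𝒰 : ι → Opens T} {U U' : Opens T}
  {D : Deformation E ε}

lemma LocalTriv.equiv_fn_smul (φ : LocalTriv D U) (V : Opens T) (h : V ≤ U)
    (r : Fn (baseChange R A) V) (x : A ⊗[k] Sec E.M V) :
    φ.equiv V h (r • x) = r • φ.equiv V h x := by
  induction r using Fn.induction with
  | h0 => rw [zero_smul, zero_smul, map_zero]
  | ha r r' hr hr' => rw [add_smul, add_smul, map_add, hr, hr']
  | ht a f =>
    induction x using tensor_induction with
    | h0 => rw [smul_zero, map_zero, smul_zero]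
    | ha x y hx hy => rw [smul_add, map_add, map_add, smul_add, hx, hy]
    | ht b m => rw [tm_smul_tmul, φ.equiv_smul]

lemma LocalTriv.equiv_act (φ : LocalTriv D U) (V : Opens T) (h : V ≤ U)
    (f : Fn R V) (x : A ⊗[k] Sec E.M V) :
    φ.equiv V h (act A f x) = (tm 1 f : Fn (baseChange R A) V) • φ.equiv V h x := by
  rw [act_eq_smul, φ.equiv_fn_smul]

lemma LocalTriv.equiv_base_smul (φ : LocalTriv D U) (V : Opens T) (h : V ≤ U)
    (a : A) (x : A ⊗[k] Sec E.M V) : φ.equiv V h (a • x) = a • φ.equiv V h x := by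
  rw [← algebraMap_smul (Fn (baseChange R A) V) a x, φ.equiv_fn_smul, algebraMap_smul]

lemma LocalTriv.res_equiv_apply (φ : LocalTriv D U) {W V : Opens T} (hWV : W ≤ V) (h : V ≤ U)
    (x : A ⊗[k] Sec E.M V) :
    Sec.res hWV (φ.equiv V h x) = φ.equiv W (hWV.trans h) (resB A hWV x) := by
  induction x using tensor_induction with
  | h0 => simp only [map_zero]
  | ha x y hx hy => simp only [map_add, hx, hy]
  | ht b m => rw [φ.res_equiv, resB_tmul]

lemma LocalTriv.restr_equiv_apply (φ : LocalTriv D U) (V : Opens T) (h : V ≤ U)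
    (x : A ⊗[k] Sec E.M V) : D.restr.hom V (φ.equiv V h x) = slice ε.toLinearMap x := by
  induction x using tensor_induction with
  | h0 => simp only [map_zero]
  | ha x y hx hy => simp only [map_add, hx, hy]
  | ht b m => rw [φ.restr_equiv, slice_tmul]; rfl

/-- Multiplication by an element of `A` commutes with the connection. -/
lemma conn_base_smul {M' : PoissonBundle (P.baseChange A)} (V : Opens T)
    (r : Fn (baseChange R A) V) (a : A) (x : Sec M'.M V) :
    M'.conn V r (a • x) = a • M'.conn V r x := map_smul _ _ _

/-- The change of trivialization `φ⁻¹ φ'`. -/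
def LocalTriv.change (φ : LocalTriv D U) (φ' : LocalTriv D U') (V : Opens T) (h : V ≤ U)
    (h' : V ≤ U') : Module.End A (A ⊗[k] Sec E.M V) where
  toFun x := (φ.equiv V h).symm (φ'.equiv V h' x)
  map_add' x y := by rw [map_add, map_add]
  map_smul' a x := by
    rw [φ'.equiv_base_smul, RingHom.id_apply, AddEquiv.symm_apply_eq, φ.equiv_base_smul,
      AddEquiv.apply_symm_apply]

lemma LocalTriv.equiv_change (φ : LocalTriv D U) (φ' : LocalTriv D U') (V : Opens T) (h : V ≤ U)
    (h' : V ≤ U') (x : A ⊗[k] Sec E.M V) :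
    φ.equiv V h (φ.change φ' V h h' x) = φ'.equiv V h' x :=
  (φ.equiv V h).apply_symm_apply _

lemma LocalTriv.isHomOn_change (φ : LocalTriv D U) (φ' : LocalTriv D U') {U₀ : Opens T}
    (hU : U₀ ≤ U) (hU' : U₀ ≤ U') :
    IsHomOn E ε fun V (h : V ≤ U₀) => φ.change φ' V (h.trans hU) (h.trans hU') where
  hom_act V h f x := by
    refine (φ.equiv V (h.trans hU)).injective ?_
    rw [φ.equiv_act, φ.equiv_change, φ.equiv_change, φ'.equiv_act]
  hom_res {W V} hWV h x := by
    refine (φ.equiv W (hWV.trans (h.trans hU))).injective ?_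
    rw [← φ.res_equiv_apply hWV (h.trans hU), φ.equiv_change, φ.equiv_change,
      ← φ'.res_equiv_apply]
  hom_slice V h x := by
    rw [← φ.restr_equiv_apply V (h.trans hU), φ.equiv_change, φ'.restr_equiv_apply]

/-- The connection of `D` in the trivialization `φ`. -/
def LocalTriv.conn (φ : LocalTriv D U) (V : Opens T) (h : V ≤ U) :
    Fn R V →ₗ[k] Module.End A (A ⊗[k] Sec E.M V) where
  toFun f :=
    { toFun := fun x => (φ.equiv V h).symm (D.bundle.conn V (tm 1 f) (φ.equiv V h x))
      map_add' := fun x y => by rw [map_add, map_add, map_add]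
      map_smul' := fun a x => by
        rw [φ.equiv_base_smul, RingHom.id_apply, AddEquiv.symm_apply_eq, φ.equiv_base_smul,
          AddEquiv.apply_symm_apply, conn_base_smul] }
  map_add' f g := by
    refine LinearMap.ext fun x => (φ.equiv V h).injective ?_
    simp only [LinearMap.coe_mk, AddHom.coe_mk, LinearMap.add_apply, tm_add_right, map_add,
      AddEquiv.apply_symm_apply]
  map_smul' c f := by
    refine LinearMap.ext fun x => (φ.equiv V h).injective ?_
    have h1 : (tm 1 (c • f) : Fn (baseChange R A) V) = algebraMap k A c • tm 1 f := by
      change (1 : A) ⊗ₜ[k] (c • f) = (algebraMap k A c * 1) ⊗ₜ[k] f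
      rw [← TensorProduct.smul_tmul, Algebra.smul_def]
    have h2 : ∀ y : A ⊗[k] Sec E.M V, c • y = algebraMap k A c • y := fun y =>
      (algebraMap_smul A c y).symm
    simp only [LinearMap.coe_mk, AddHom.coe_mk, RingHom.id_apply, LinearMap.smul_apply, h1, h2,
      φ.equiv_base_smul, map_smul, AddEquiv.apply_symm_apply]

lemma LocalTriv.equiv_conn (φ : LocalTriv D U) (V : Opens T) (h : V ≤ U) (f : Fn R V)
    (x : A ⊗[k] Sec E.M V) :
    φ.equiv V h (φ.conn V h f x) = D.bundle.conn V (tm 1 f) (φ.equiv V h x) :=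
  (φ.equiv V h).apply_symm_apply _

lemma LocalTriv.isConnOn_conn (φ : LocalTriv D U) : IsConnOn E ε φ.conn where
  conn_mul V h f g x := by
    refine (φ.equiv V h).injective ?_
    have : (tm 1 (f * g) : Fn (baseChange R A) V) = tm 1 f * tm 1 g := by rw [tm_mul_tm, one_mul]
    simp only [map_add, φ.equiv_act, φ.equiv_conn, this, D.bundle.conn_mul]
  conn_act V h f g x := by
    refine (φ.equiv V h).injective ?_
    have : (P.baseChange A).br V (tm 1 f) (tm 1 g) = tm 1 (P.br V f g) :=
      (bracketBaseChange_tm P V 1 1 f g).trans (by rw [one_mul])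
    simp only [map_add, φ.equiv_act, φ.equiv_conn, D.bundle.conn_smul, this]
  conn_res {W V} hWV h f x := by
    refine (φ.equiv W (hWV.trans h)).injective ?_
    rw [← φ.res_equiv_apply hWV h, φ.equiv_conn, φ.equiv_conn, D.bundle.res_conn, res_tm,
      ← φ.res_equiv_apply hWV h]
  conn_slice V h f x := by
    rw [← φ.restr_equiv_apply V h, φ.equiv_conn, D.restr.hom_conn, specialize_tm, map_one, one_smul,
      φ.restr_equiv_apply]

/-- The local data of a deformation with trivializations. -/
def Deformation.locData (D : Deformation E ε) (φ : ∀ α, LocalTriv D (𝒰 α)) :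
    LocData E ε 𝒰 where
  conn α := (φ α).conn
  isConn α := (φ α).isConnOn_conn
  trans α β V h := (φ α).change (φ β) V (h.trans inf_le_left) (h.trans inf_le_right)
  isHom α β := (φ α).isHomOn_change (φ β) inf_le_left inf_le_right

lemma Deformation.isStrict_locData (D : Deformation E ε) (φ : ∀ α, LocalTriv D (𝒰 α)) :
    (D.locData φ).IsStrict where
  flat α V h f g x := by
    refine ((φ α).equiv V h).injective ?_
    have : (P.baseChange A).br V (tm 1 f) (tm 1 g) = tm 1 (P.br V f g) :=
      (bracketBaseChange_tm P V 1 1 f g).trans (by rw [one_mul])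
    change (φ α).equiv V h ((φ α).conn V h f ((φ α).conn V h g x) -
      (φ α).conn V h g ((φ α).conn V h f x) - (φ α).conn V h (P.br V f g) x) = _
    simp only [map_sub, (φ α).equiv_conn, map_zero]
    rw [D.bundle.flat, this]
    abel
  compat α β V hα hβ f x := by
    refine ((φ α).equiv V hα).injective ?_
    change (φ α).equiv V hα ((φ α).conn V hα f ((φ α).change (φ β) V hα hβ x)) =
      (φ α).equiv V hα ((φ α).change (φ β) V hα hβ ((φ β).conn V hβ f x))
    simp only [(φ α).equiv_conn, (φ α).equiv_change, (φ β).equiv_conn]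
  cocycle α β γ V hα hβ hγ x := by
    refine ((φ α).equiv V hα).injective ?_
    change (φ α).equiv V hα ((φ α).change (φ β) V hα hβ ((φ β).change (φ γ) V hβ hγ x)) =
      (φ α).equiv V hα ((φ α).change (φ γ) V hα hγ x)
    simp only [LocalTriv.equiv_change]

lemma Deformation.locData_conn_change (D : Deformation E ε) (φ φ' : ∀ α, LocalTriv D (𝒰 α))
    (α : ι) (V : Opens T) (h : V ≤ 𝒰 α) (f : Fn R V) (x : A ⊗[k] Sec E.M V) :
    (D.locData φ).conn α V h f ((φ α).change (φ' α) V h h x) =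
      (φ α).change (φ' α) V h h ((D.locData φ').conn α V h f x) := by
  refine ((φ α).equiv V h).injective ?_
  change (φ α).equiv V h ((φ α).conn V h f _) = (φ α).equiv V h
    ((φ α).change (φ' α) V h h ((φ' α).conn V h f x))
  simp only [LocalTriv.equiv_change, LocalTriv.equiv_conn]

lemma Deformation.locData_trans_change (D : Deformation E ε) (φ φ' : ∀ α, LocalTriv D (𝒰 α))
    (α β : ι) (V : Opens T) (hα : V ≤ 𝒰 α) (hβ : V ≤ 𝒰 β) (x : A ⊗[k] Sec E.M V) :
    (D.locData φ).trans α β V (le_inf hα hβ) ((φ β).change (φ' β) V hβ hβ x) =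
      (φ α).change (φ' α) V hα hα ((D.locData φ').trans α β V (le_inf hα hβ) x) := by
  refine ((φ α).equiv V hα).injective ?_
  change (φ α).equiv V hα ((φ α).change (φ β) V hα hβ _) = (φ α).equiv V hα
    ((φ α).change (φ' α) V hα hα ((φ' α).change (φ' β) V hα hβ x))
  simp only [LocalTriv.equiv_change]

/-! ### Local lifts -/

variable {μ : B →ₐ[k] A} {t : B}

lemma LocalLift.rTensor_conn (L : LocalLift μ D 𝒰) (α : ι) (V : Opens T) (h : V ≤ 𝒰 α)
    (f : Fn R V) (x : B ⊗[k] Sec E.M V) :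
    LinearMap.rTensor (Sec E.M V) μ.toLinearMap (L.conn α V h f x) =
      (D.locData L.triv).conn α V h f (LinearMap.rTensor (Sec E.M V) μ.toLinearMap x) := by
  refine ((L.triv α).equiv V h).injective ?_
  rw [L.conn_reduce]
  exact ((L.triv α).equiv_conn V h f _).symm

lemma LocalLift.rTensor_trans (L : LocalLift μ D 𝒰) (α β : ι) (V : Opens T) (hα : V ≤ 𝒰 α)
    (hβ : V ≤ 𝒰 β) (x : B ⊗[k] Sec E.M V) :
    LinearMap.rTensor (Sec E.M V) μ.toLinearMap (L.trans α β V hα hβ x) =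
      (D.locData L.triv).trans α β V (le_inf hα hβ)
        (LinearMap.rTensor (Sec E.M V) μ.toLinearMap x) := by
  refine ((L.triv α).equiv V hα).injective ?_
  rw [L.trans_reduce]
  exact ((L.triv α).equiv_change (L.triv β) V hα hβ _).symm

/-- The local data of a local lift. -/
def LocalLift.toLocData (L : LocalLift μ D 𝒰) : LocData E (ε.comp μ) 𝒰 where
  conn := L.conn
  isConn α :=
    { conn_mul := fun V h f g x => LinearMap.congr_fun (L.conn_mul α V h f g) x
      conn_act := fun V h f g x => LinearMap.congr_fun (L.conn_act α V h f g) x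
      conn_res := fun hWV h f x => L.res_conn α hWV h f x
      conn_slice := fun V h f x => by
        rw [← slice_rTensor, L.rTensor_conn, ((D.locData L.triv).isConn α).conn_slice,
          slice_rTensor] }
  trans α β V h := L.trans α β V (h.trans inf_le_left) (h.trans inf_le_right)
  isHom α β :=
    { hom_act := fun V h g x => LinearMap.congr_fun (L.trans_act α β V _ _ g) x
      hom_res := fun hWV h x => L.res_trans α β hWV _ _ x
      hom_slice := fun V h x => by
        rw [← slice_rTensor, L.rTensor_trans, ((D.locData L.triv).isHom α β).hom_slice,
          slice_rTensor] }

/-- Reduction to `A` carries the lifted operators to those of the deformation, which satisfy the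
three equations exactly. -/
lemma LocalLift.isStrictMod (L : LocalLift μ D 𝒰) : L.toLocData.IsStrictMod μ where
  curvature α V h f g x := by
    have := (D.isStrict_locData L.triv).flat α V h f g
      (LinearMap.rTensor (Sec E.M V) μ.toLinearMap x)
    rw [curv_apply] at this ⊢
    change LinearMap.rTensor (Sec E.M V) μ.toLinearMap (L.conn α V h f (L.conn α V h g x) -
      L.conn α V h g (L.conn α V h f x) - L.conn α V h (P.br V f g) x) = 0
    rw [map_sub, map_sub]
    simp only [L.rTensor_conn]
    exact this
  compat α β V hα hβ f x := by
    change LinearMap.rTensor (Sec E.M V) μ.toLinearMap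
      (L.conn α V hα f (L.trans α β V hα hβ x)) = LinearMap.rTensor (Sec E.M V) μ.toLinearMap
        (L.trans α β V hα hβ (L.conn β V hβ f x))
    simp only [L.rTensor_conn, L.rTensor_trans]
    exact (D.isStrict_locData L.triv).compat α β V hα hβ f _
  cocycle α β γ V hα hβ hγ x := by
    change LinearMap.rTensor (Sec E.M V) μ.toLinearMap
      (L.trans α β V hα hβ (L.trans β γ V hβ hγ x)) = LinearMap.rTensor (Sec E.M V) μ.toLinearMap
        (L.trans α γ V hα hγ x)
    simp only [L.rTensor_trans]
    exact (D.isStrict_locData L.triv).cocycle α β γ V hα hβ hγ _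

lemma LocalLift.isDefect {L : LocalLift μ D 𝒰} {c : Cochains E 𝒰} (h : L.toLocData.IsDefect t c) :
    L.IsDefect t c where
  curvature s V hV f g m := by
    have := h.curvature s V hV f g (1 ⊗ₜ m)
    rw [slice_one_tmul] at this
    exact this
  compat s V hV f m := by
    have := h.compat s V hV f (1 ⊗ₜ m)
    rw [slice_one_tmul] at this
    exact this
  cocycle s V hV m := by
    have := h.cocycle s V hV (1 ⊗ₜ m)
    rw [slice_one_tmul] at this
    exact this

/-- The local lift given by local data over `B` that reduce to those of `D`. -/
def LocalLift.ofLocData (φ : ∀ α, LocalTriv D (𝒰 α)) (L : LocData E (ε.comp μ) 𝒰)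
    (hconn : ∀ α V h f x, LinearMap.rTensor (Sec E.M V) μ.toLinearMap (L.conn α V h f x) =
      (D.locData φ).conn α V h f (LinearMap.rTensor (Sec E.M V) μ.toLinearMap x))
    (htrans : ∀ α β V h x, LinearMap.rTensor (Sec E.M V) μ.toLinearMap (L.trans α β V h x) =
      (D.locData φ).trans α β V h (LinearMap.rTensor (Sec E.M V) μ.toLinearMap x)) :
    LocalLift μ D 𝒰 where
  triv := φ
  conn := L.conn
  conn_mul α V h f g := LinearMap.ext fun x => (L.isConn α).conn_mul V h f g x
  conn_act α V h f g := LinearMap.ext fun x => (L.isConn α).conn_act V h f g x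
  res_conn α _ _ hWV h f x := (L.isConn α).conn_res hWV h f x
  conn_reduce α V h f x := by
    rw [hconn]
    exact (φ α).equiv_conn V h f _
  trans α β V hα hβ := L.trans α β V (le_inf hα hβ)
  trans_act α β V hα hβ g := LinearMap.ext fun x => (L.isHom α β).hom_act V _ g x
  res_trans α β _ _ hWV hα hβ x := (L.isHom α β).hom_res hWV _ x
  trans_reduce α β V hα hβ x := by
    rw [htrans]
    exact (φ α).equiv_change (φ β) V hα hβ _

/-- The connections and transition functions over `A` are lifted along a normalized linear section
of `μ`. No equation that is quadratic in the operators has to be preserved. -/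
lemma LocalLift.nonempty (hμ : Function.Surjective μ) (φ : ∀ α, LocalTriv D (𝒰 α)) :
    Nonempty (LocalLift μ D 𝒰) := by
  obtain ⟨s, hs, hs1⟩ := exists_linear_section μ hμ ε
  exact ⟨LocalLift.ofLocData φ
    { conn := fun α V h => liftOp s (Sec E.M V) ∘ₗ (D.locData φ).conn α V h
      isConn := fun α => ((D.locData φ).isConn α).lift μ hs hs1
      trans := fun α β V h => liftOp s (Sec E.M V) ((D.locData φ).trans α β V h)
      isHom := fun α β => ((D.locData φ).isHom α β).lift μ hs }
    (fun α V h f x => rTensor_liftOp μ hs _ x) (fun α β V h x => rTensor_liftOp μ hs _ x)⟩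

/-- The class of the defect does not depend on the local lift. -/
lemma LocalLift.exists_dTotal_eq (hμ : IsSmall μ (ε.comp μ) t) (L L' : LocalLift μ D 𝒰)
    {c c' : Cochains E 𝒰} (hc : c ∈ total E 𝒰 2) (hc' : c' ∈ total E 𝒰 2)
    (h : L.toLocData.IsDefect t c) (h' : L'.toLocData.IsDefect t c') :
    ∃ b ∈ total E 𝒰 1, dTotal E 𝒰 b = c - c' := by
  obtain ⟨s, hs, -⟩ := exists_linear_section μ hμ.surj ε
  -- The two local lifts may come from different trivializations. A linear lift of the change of
  -- trivialization intertwines them over `A`.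
  have hθ : ∀ α, IsHomOn E (ε.comp μ) fun V (h : V ≤ 𝒰 α) =>
      liftOp s (Sec E.M V) ((L.triv α).change (L'.triv α) V h h) := fun α =>
    ((L.triv α).isHomOn_change (L'.triv α) le_rfl le_rfl).lift μ hs
  obtain ⟨b, hb, hbL⟩ := LocData.exists_isGauge (L := L.toLocData) (L' := L'.toLocData) hμ hθ
    (fun α V h f x => by
      rw [rTensor_liftOp μ hs]
      refine (L.rTensor_conn α V h f _).trans ?_
      rw [rTensor_liftOp μ hs, D.locData_conn_change]
      exact congrArg _ (L'.rTensor_conn α V h f x).symm)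
    (fun α β V hα hβ x => by
      rw [rTensor_liftOp μ hs]
      refine (L.rTensor_trans α β V hα hβ _).trans ?_
      rw [rTensor_liftOp μ hs, D.locData_trans_change]
      exact congrArg _ (L'.rTensor_trans α β V hα hβ x).symm)
  exact ⟨b, hb, hbL.dTotal_eq h h' hθ hμ hb hc hc'⟩

end Triv

/-! ### Gluing restriction morphisms -/

section GlueRestriction

variable {S S' : Type u} [CommRing S] [CommRing S'] {T : TopCat.{u}}
  {R : AlgPresheaf S T} {R' : AlgPresheaf S' T} {P : PoissonStructure R}
  {P' : PoissonStructure R'} {φ : ∀ U, Fn R' U →+* Fn R U} {E' : PoissonBundle P'}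
  {E : PoissonBundle P} {ι : Type u} {𝒰 : ι → Opens T}

/-- The maps on charts glue because they agree on overlaps. The conditions of a restriction morphism
are either identities in a sheaf or statements about small neighbourhoods, so they are inherited
from the charts. -/
lemma exists_restriction (hφ : ∀ {V U : Opens T} (h : V ≤ U) f,
      Fn.res h (φ U f) = φ V (Fn.res h f)) (h𝒰 : ⨆ α, 𝒰 α = ⊤)
    (ψ : ∀ α V, V ≤ 𝒰 α → Sec E'.M V → Sec E.M V)
    (h_add : ∀ α V h x y, ψ α V h (x + y) = ψ α V h x + ψ α V h y)
    (h_smul : ∀ α V h f x, ψ α V h (f • x) = φ V f • ψ α V h x)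
    (h_res : ∀ α {W V : Opens T} (hWV : W ≤ V) (h : V ≤ 𝒰 α) x,
      Sec.res hWV (ψ α V h x) = ψ α W (hWV.trans h) (Sec.res hWV x))
    (h_conn : ∀ α V h f x, ψ α V h (E'.conn V f x) = E.conn V (φ V f) (ψ α V h x))
    (h_agree : ∀ α β V (hα : V ≤ 𝒰 α) (hβ : V ≤ 𝒰 β) x, ψ α V hα x = ψ β V hβ x)
    (h_surj : ∀ α V h, Function.Surjective (ψ α V h))
    (h_ker : ∀ α V h x, ψ α V h x = 0 →
      x ∈ RingHom.ker (φ V) • (⊤ : Submodule (Fn R' V) (Sec E'.M V))) :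
    ∃ r : Restriction φ E' E, ∀ α V h x, r.hom V x = ψ α V h x := by
  obtain ⟨τ, hτ, hτψ⟩ := IsSheafOn.exists_glued_map (isSheafOn_sec E.isSheaf)
    (r := fun _ _ h => Sec.res h) (G := Sec E'.M) (fun h h' x => Sec.res_res _ h h' x)
    (U := ⊤) (𝒰 := 𝒰) h𝒰.ge ψ h_res h_agree
  have hle : ∀ U : Opens T, U ≤ ⨆ α, 𝒰 α := fun U => h𝒰 ▸ le_top
  have hex : ∀ U : Opens T, ∀ x ∈ U, ∃ V : Opens T, ∃ _ : V ≤ U, x ∈ V ∧ ∃ α, V ≤ 𝒰 α :=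
    fun U x hx => by
      obtain ⟨α, hα⟩ := exists_mem_of_le_iSup (hle U) hx
      exact ⟨U ⊓ 𝒰 α, inf_le_left, ⟨hx, hα⟩, α, inf_le_right⟩
  refine ⟨
    { hom := fun U => AddMonoidHom.mk' (τ U le_top) fun x y =>
        (isSheafOn_sec E.isSheaf).eq_of_cover (hle U) fun α W hW hWα => ?_
      hom_smul := fun U f m => (isSheafOn_sec E.isSheaf).eq_of_cover (hle U)
        fun α W hW hWα => ?_
      res_hom := fun h m => hτ h le_top m
      hom_conn := fun U f m => (isSheafOn_sec E.isSheaf).eq_of_cover (hle U)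
        fun α W hW hWα => ?_
      surj := fun U m x hx => ?_
      ker := fun U m hm x hx => ?_ }, fun α V h x => hτψ α V h le_top x⟩
  · rw [map_add]
    simp only [hτ, map_add, hτψ α W hWα, h_add]
  · change Sec.res hW (τ U le_top (f • m)) = Sec.res hW (φ U f • τ U le_top m)
    rw [Sec.res_smul, hτ, hτ, hτψ α W hWα, hτψ α W hWα, Sec.res_smul, h_smul, hφ]
  · change Sec.res hW (τ U le_top (E'.conn U f m)) = Sec.res hW (E.conn U (φ U f) (τ U le_top m))
    rw [E.res_conn, hτ, hτ, hτψ α W hWα, hτψ α W hWα, E'.res_conn, h_conn, hφ]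
  · obtain ⟨V, hV, hxV, α, hα⟩ := hex U x hx
    obtain ⟨m', hm'⟩ := h_surj α V hα (Sec.res hV m)
    exact ⟨V, hV, m', hxV, (hτψ α V hα le_top m').trans hm'⟩
  · obtain ⟨V, hV, hxV, α, hα⟩ := hex U x hx
    refine ⟨V, hV, hxV, h_ker α V hα _ ?_⟩
    rw [← hτψ α V hα le_top, ← hτ hV le_top]
    exact (congrArg _ hm).trans (map_zero _)

end GlueRestriction

/-! ### Linear extension of connections -/

section ExtConn

variable {k : Type u} [Field k] {T : TopCat.{u}} {R : AlgPresheaf k T} {P : PoissonStructure R}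
  {B : Type u} [CommRing B] [Algebra k B] {E : PoissonBundle P} {ε : B →ₐ[k] k} {U : Opens T}

/-- The `B`-linear extension of a connection. -/
def extConn {V : Opens T} (C : Fn R V →ₗ[k] Module.End B (B ⊗[k] Sec E.M V)) :
    Fn (baseChange R B) V →ₗ[B] Module.End B (B ⊗[k] Sec E.M V) :=
  LinearMap.liftBaseChange B C

lemma extConn_tm {V : Opens T} (C : Fn R V →ₗ[k] Module.End B (B ⊗[k] Sec E.M V)) (b : B)
    (f : Fn R V) : extConn C (tm b f) = b • C f :=
  LinearMap.liftBaseChange_tmul ..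

variable {C : ∀ V, V ≤ U → Fn R V →ₗ[k] Module.End B (B ⊗[k] Sec E.M V)}

lemma IsConnOn.extConn_mul (hC : IsConnOn E ε C) {V : Opens T} (h : V ≤ U)
    (r r' : Fn (baseChange R B) V) (x : B ⊗[k] Sec E.M V) :
    extConn (C V h) (r * r') x = r • extConn (C V h) r' x + r' • extConn (C V h) r x := by
  induction r using Fn.induction with
  | h0 => simp
  | ha r s hr hs =>
    simp only [add_mul, map_add, LinearMap.add_apply, hr, hs, add_smul, smul_add]
    abel
  | ht a f =>
    induction r' using Fn.induction with
    | h0 => simp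
    | ha r s hr hs =>
      simp only [mul_add, map_add, LinearMap.add_apply, hr, hs, add_smul, smul_add]
      abel
    | ht b g =>
      simp only [tm_mul_tm, extConn_tm, LinearMap.smul_apply, hC.conn_mul, tm_smul, act_smul,
        smul_add, smul_smul, mul_comm a b]

lemma IsConnOn.extConn_smul (hC : IsConnOn E ε C) {V : Opens T} (h : V ≤ U)
    (r r' : Fn (baseChange R B) V) (x : B ⊗[k] Sec E.M V) :
    extConn (C V h) r (r' • x) =
      (P.baseChange B).br V r r' • x + r' • extConn (C V h) r x := by
  change _ = bracketBaseChange P B V r r' • x + _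
  induction r using Fn.induction with
  | h0 => simp
  | ha r s hr hs =>
    simp only [map_add, LinearMap.add_apply, hr, hs, add_smul, smul_add]
    abel
  | ht a f =>
    induction r' using Fn.induction with
    | h0 => simp
    | ha r s hr hs =>
      simp only [map_add, hr, hs, add_smul]
      abel
    | ht b g =>
      simp only [bracketBaseChange_tm, extConn_tm, LinearMap.smul_apply, tm_smul, map_smul,
        hC.conn_act, smul_add, smul_smul, mul_comm a b]

lemma extConn_flat {V : Opens T} {C : Fn R V →ₗ[k] Module.End B (B ⊗[k] Sec E.M V)}
    (hC : ∀ f g x, curv P C f g x = 0) (r r' : Fn (baseChange R B) V) (x : B ⊗[k] Sec E.M V) :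
    extConn C r (extConn C r' x) =
      extConn C ((P.baseChange B).br V r r') x + extConn C r' (extConn C r x) := by
  change _ = extConn C (bracketBaseChange P B V r r') x + _
  induction r using Fn.induction with
  | h0 => simp
  | ha r s hr hs =>
    simp only [map_add, LinearMap.add_apply, hr, hs]
    abel
  | ht a f =>
    induction r' using Fn.induction with
    | h0 => simp
    | ha r s hr hs =>
      simp only [map_add, LinearMap.add_apply, hr, hs]
      abel
    | ht b g =>
      have := hC f g x
      rw [curv_apply, sub_sub, sub_eq_zero] at this
      simp only [bracketBaseChange_tm, extConn_tm, LinearMap.smul_apply, map_smul, this,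
        smul_add, smul_smul, mul_comm a b]
      abel

lemma IsConnOn.extConn_res (hC : IsConnOn E ε C) {W V : Opens T} (hWV : W ≤ V) (h : V ≤ U)
    (r : Fn (baseChange R B) V) (x : B ⊗[k] Sec E.M V) :
    resB B hWV (extConn (C V h) r x) =
      extConn (C W (hWV.trans h)) (Fn.res hWV r) (resB B hWV x) := by
  induction r using Fn.induction with
  | h0 => simp
  | ha r s hr hs => simp only [map_add, LinearMap.add_apply, hr, hs]
  | ht a f => simp only [res_tm, extConn_tm, LinearMap.smul_apply, map_smul, hC.conn_res]

lemma slice_algHom_smul {M : PMod R} {V : Opens T} (b : B) (x : B ⊗[k] Sec M V) :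
    slice ε.toLinearMap (b • x) = ε b • slice ε.toLinearMap x := by
  induction x using tensor_induction with
  | h0 => simp
  | ha x y hx hy => simp only [smul_add, map_add, hx, hy]
  | ht c m => simp [TensorProduct.smul_tmul', mul_smul]

lemma IsConnOn.extConn_slice (hC : IsConnOn E ε C) {V : Opens T} (h : V ≤ U)
    (r : Fn (baseChange R B) V) (x : B ⊗[k] Sec E.M V) :
    slice ε.toLinearMap (extConn (C V h) r x) =
      E.conn V (specialize ε V r) (slice ε.toLinearMap x) := by
  induction r using Fn.induction with
  | h0 => simp
  | ha r s hr hs => simp only [map_add, LinearMap.add_apply, hr, hs]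
  | ht a f =>
    simp only [extConn_tm, LinearMap.smul_apply, specialize_tm, map_smul, slice_algHom_smul,
      hC.conn_slice]

lemma extConn_comm {V : Opens T} {C C' : Fn R V →ₗ[k] Module.End B (B ⊗[k] Sec E.M V)}
    {θ : Module.End B (B ⊗[k] Sec E.M V)} (h : ∀ f x, C f (θ x) = θ (C' f x))
    (r : Fn (baseChange R B) V) (x : B ⊗[k] Sec E.M V) :
    extConn C r (θ x) = θ (extConn C' r x) := by
  induction r using Fn.induction with
  | h0 => simp
  | ha r s hr hs => simp only [map_add, LinearMap.add_apply, hr, hs]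
  | ht a f => simp only [extConn_tm, LinearMap.smul_apply, map_smul, h]

lemma IsHomOn.hom_smul {θ : ∀ V, V ≤ U → Module.End B (B ⊗[k] Sec E.M V)} (hθ : IsHomOn E ε θ)
    {V : Opens T} (h : V ≤ U) (r : Fn (baseChange R B) V) (x : B ⊗[k] Sec E.M V) :
    θ V h (r • x) = r • θ V h x := by
  induction r using Fn.induction with
  | h0 => simp
  | ha r s hr hs => simp only [add_smul, map_add, hr, hs]
  | ht a f => simp only [tm_smul, map_smul, hθ.hom_act]

end ExtConn

/-! ### Gluing local data -/

section GlueSec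

variable {k : Type u} [Field k] {T : TopCat.{u}} {R : AlgPresheaf k T} {P : PoissonStructure R}
  {B : Type u} [CommRing B] [Algebra k B] {ι : Type u}
  {E : PoissonBundle P} {ε : B →ₐ[k] k} {𝒰 : ι → Opens T}

/-- Sections over `V` of the module glued from the `F|_{U_α} ⊗ B`. -/
def LocData.sections (L : LocData E ε 𝒰) (V : Opens T) :
    AddSubgroup (∀ α, B ⊗[k] Sec E.M (V ⊓ 𝒰 α)) where
  carrier := {x | ∀ α β W (hW : W ≤ V) (hα : W ≤ 𝒰 α) (hβ : W ≤ 𝒰 β),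
    resB B (le_inf hW hα) (x α) = L.trans α β W (le_inf hα hβ) (resB B (le_inf hW hβ) (x β))}
  zero_mem' α β W hW hα hβ := by simp only [Pi.zero_apply, map_zero]
  add_mem' {x y} hx hy α β W hW hα hβ := by
    simp only [Pi.add_apply, map_add, hx α β W hW hα hβ, hy α β W hW hα hβ]
  neg_mem' {x} hx α β W hW hα hβ := by
    simp only [Pi.neg_apply, map_neg, hx α β W hW hα hβ]

/-- Sections over `V` of the glued module, as a type. -/
def LocData.Sections (L : LocData E ε 𝒰) (V : Opens T) : Type u := L.sections V

instance (L : LocData E ε 𝒰) (V : Opens T) : AddCommGroup (L.Sections V) :=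
  inferInstanceAs (AddCommGroup (L.sections V))

/-- The component over `U_α`. -/
def LocData.Sections.at {L : LocData E ε 𝒰} {V : Opens T} (α : ι) :
    L.Sections V →+ B ⊗[k] Sec E.M (V ⊓ 𝒰 α) :=
  (Pi.evalAddMonoidHom _ α).comp (L.sections V).subtype

lemma LocData.Sections.ext {L : LocData E ε 𝒰} {V : Opens T} {x y : L.Sections V}
    (h : ∀ α, x.at α = y.at α) : x = y := Subtype.ext (funext h)

lemma LocData.Sections.res_at {L : LocData E ε 𝒰} {V : Opens T} (x : L.Sections V) (α β : ι)
    (W : Opens T) (hW : W ≤ V) (hα : W ≤ 𝒰 α) (hβ : W ≤ 𝒰 β) :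
    resB B (le_inf hW hα) (x.at α) =
      L.trans α β W (le_inf hα hβ) (resB B (le_inf hW hβ) (x.at β)) :=
  x.2 α β W hW hα hβ

/-- Sections with given components. -/
def LocData.Sections.mk {L : LocData E ε 𝒰} {V : Opens T} (x : ∀ α, B ⊗[k] Sec E.M (V ⊓ 𝒰 α))
    (hx : ∀ α β W (hW : W ≤ V) (hα : W ≤ 𝒰 α) (hβ : W ≤ 𝒰 β), resB B (le_inf hW hα) (x α) =
      L.trans α β W (le_inf hα hβ) (resB B (le_inf hW hβ) (x β))) : L.Sections V := ⟨x, hx⟩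

instance (L : LocData E ε 𝒰) (V : Opens T) : Module (Fn (baseChange R B) V) (L.Sections V) where
  smul r x := .mk (fun α => (Fn.res inf_le_left r : Fn (baseChange R B) (V ⊓ 𝒰 α)) • x.at α)
    fun α β W hW hα hβ => by
      simp only [resB_smul, Fn.res_res, (L.isHom α β).hom_smul, x.res_at α β W hW hα hβ]
  one_smul x := LocData.Sections.ext fun α => by
    change (Fn.res inf_le_left (1 : Fn (baseChange R B) V) : Fn (baseChange R B) (V ⊓ 𝒰 α)) •
      x.at α = x.at α
    rw [map_one, one_smul]
  mul_smul r s x := LocData.Sections.ext fun α => by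
    change (Fn.res inf_le_left (r * s) : Fn (baseChange R B) (V ⊓ 𝒰 α)) • x.at α =
      (Fn.res inf_le_left r : Fn (baseChange R B) (V ⊓ 𝒰 α)) •
        (Fn.res inf_le_left s : Fn (baseChange R B) (V ⊓ 𝒰 α)) • x.at α
    rw [map_mul, mul_smul]
  smul_zero r := LocData.Sections.ext fun α => by
    change (Fn.res inf_le_left r : Fn (baseChange R B) (V ⊓ 𝒰 α)) •
      (0 : L.Sections V).at α = (0 : L.Sections V).at α
    rw [map_zero, smul_zero]
  smul_add r x y := LocData.Sections.ext fun α => by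
    change (Fn.res inf_le_left r : Fn (baseChange R B) (V ⊓ 𝒰 α)) • (x + y).at α =
      Fn.res inf_le_left r • x.at α + Fn.res inf_le_left r • y.at α
    rw [map_add, smul_add]
  add_smul r s x := LocData.Sections.ext fun α => by
    change (Fn.res inf_le_left (r + s) : Fn (baseChange R B) (V ⊓ 𝒰 α)) • x.at α =
      Fn.res inf_le_left r • x.at α + Fn.res inf_le_left s • x.at α
    rw [map_add, add_smul]
  zero_smul x := LocData.Sections.ext fun α => by
    change (Fn.res inf_le_left (0 : Fn (baseChange R B) V) : Fn (baseChange R B) (V ⊓ 𝒰 α)) •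
      x.at α = (0 : L.Sections V).at α
    rw [map_zero, zero_smul, map_zero]

lemma LocData.Sections.at_smul {L : LocData E ε 𝒰} {V : Opens T} (r : Fn (baseChange R B) V)
    (x : L.Sections V) (α : ι) :
    (r • x).at α = (Fn.res inf_le_left r : Fn (baseChange R B) (V ⊓ 𝒰 α)) • x.at α := rfl

/-- Restriction of glued sections. -/
def LocData.Sections.res {L : LocData E ε 𝒰} (V U : Opens T) (h : V ≤ U) :
    L.Sections U →+ L.Sections V where
  toFun x := .mk (fun α => resB B (inf_le_inf_right _ h) (x.at α)) fun α β W hW hα hβ => by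
    simp only [resB_resB, x.res_at α β W (hW.trans h) hα hβ]
  map_zero' := LocData.Sections.ext fun α => by
    change resB B (inf_le_inf_right _ h) ((0 : L.Sections U).at α) = (0 : L.Sections V).at α
    simp only [map_zero]
  map_add' x y := LocData.Sections.ext fun α => by
    change resB B (inf_le_inf_right _ h) ((x + y).at α) =
      resB B (inf_le_inf_right _ h) (x.at α) + resB B (inf_le_inf_right _ h) (y.at α)
    simp only [map_add]

lemma LocData.Sections.at_res {L : LocData E ε 𝒰} {V U : Opens T} (h : V ≤ U) (x : L.Sections U)
    (α : ι) : (LocData.Sections.res V U h x).at α = resB B (inf_le_inf_right _ h) (x.at α) := rfl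

/-- The glued module. -/
def LocData.glued (L : LocData E ε 𝒰) : PMod (baseChange R B) :=
  pmodMk L.Sections LocData.Sections.res
    (fun V U h r x => LocData.Sections.ext fun α => by
      rw [LocData.Sections.at_res, LocData.Sections.at_smul, LocData.Sections.at_smul,
        LocData.Sections.at_res, resB_smul, Fn.res_res, Fn.res_res])
    (fun U x => LocData.Sections.ext fun α => resB_self _)
    (fun W V U h h' x => LocData.Sections.ext fun α => resB_resB _ _ _)

/-- The components of a section of the glued module. -/
def LocData.at (L : LocData E ε 𝒰) {V : Opens T} (α : ι) (x : Sec L.glued V) :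
    B ⊗[k] Sec E.M (V ⊓ 𝒰 α) :=
  LocData.Sections.at (L := L) (V := V) α x

variable {L : LocData E ε 𝒰} {V : Opens T}

lemma LocData.at_add (α : ι) (x y : Sec L.glued V) : L.at α (x + y) = L.at α x + L.at α y :=
  map_add (LocData.Sections.at (L := L) (V := V) α) x y

lemma LocData.at_smul (α : ι) (r : Fn (baseChange R B) V) (x : Sec L.glued V) :
    L.at α (r • x) = (Fn.res inf_le_left r : Fn (baseChange R B) (V ⊓ 𝒰 α)) • L.at α x := rfl

lemma LocData.at_res {W : Opens T} (h : W ≤ V) (α : ι) (x : Sec L.glued V) :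
    L.at α (Sec.res h x) = resB B (inf_le_inf_right _ h) (L.at α x) := rfl

lemma LocData.at_ext {x y : Sec L.glued V} (h : ∀ α, L.at α x = L.at α y) : x = y :=
  LocData.Sections.ext (L := L) (V := V) h

lemma LocData.res_at (x : Sec L.glued V) (α β : ι) (W : Opens T) (hW : W ≤ V) (hα : W ≤ 𝒰 α)
    (hβ : W ≤ 𝒰 β) : resB B (le_inf hW hα) (L.at α x) =
      L.trans α β W (le_inf hα hβ) (resB B (le_inf hW hβ) (L.at β x)) :=
  LocData.Sections.res_at (L := L) (V := V) x α β W hW hα hβ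

lemma LocData.exists_section (x : ∀ α, B ⊗[k] Sec E.M (V ⊓ 𝒰 α))
    (hx : ∀ α β W (hW : W ≤ V) (hα : W ≤ 𝒰 α) (hβ : W ≤ 𝒰 β), resB B (le_inf hW hα) (x α) =
      L.trans α β W (le_inf hα hβ) (resB B (le_inf hW hβ) (x β))) :
    ∃ y : Sec L.glued V, ∀ α, L.at α y = x α :=
  ⟨LocData.Sections.mk (L := L) x hx, fun _ => rfl⟩

/-- The sheaf axioms hold in each chart, where finite dimensionality of `B` enters, and the matching
conditions between the components are themselves local. -/
lemma LocData.isSheaf_glued [Module.Finite k B] (L : LocData E ε 𝒰) :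
    TopCat.Presheaf.IsSheaf L.glued.presheaf := by
  have hE := isSheafOn_tensor (B := B) E.isSheaf
  refine isSheaf_of_isSheafOn
    { res_self := fun U x => Sec.res_self _ x
      res_res := fun h h' x => Sec.res_res _ h h' x
      eq_of_locally := fun {U} x y hxy => LocData.at_ext fun α => ?_
      glue := fun {κ} V U hV hU x hx => ?_ }
  · refine hE.eq_of_locally _ _ fun p hp => ?_
    obtain ⟨V, h, hpV, hV⟩ := hxy p hp.1
    exact ⟨V ⊓ 𝒰 α, inf_le_inf_right _ h, ⟨hpV, hp.2⟩, congrArg (L.at α) hV⟩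
  · have hcov : ∀ α, U ⊓ 𝒰 α ≤ ⨆ i, V i ⊓ 𝒰 α := fun α => by
      rw [← iSup_inf_eq]
      exact inf_le_inf_right _ hU
    have key : ∀ α, ∃ y : B ⊗[k] Sec E.M (U ⊓ 𝒰 α), ∀ i,
        resB B (inf_le_inf_right _ (hV i)) y = L.at α (x i) := fun α =>
      hE.glue (fun i => V i ⊓ 𝒰 α) (U ⊓ 𝒰 α) (fun i => inf_le_inf_right _ (hV i)) (hcov α)
        (fun i => L.at α (x i)) fun i j W hi hj => by
          have := congrArg (L.at α) (hx i j W (hi.trans inf_le_left) (hj.trans inf_le_left))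
          rw [LocData.at_res, LocData.at_res] at this
          have := congrArg (resB B (le_inf le_rfl (hi.trans inf_le_right))) this
          rwa [resB_resB, resB_resB] at this
    choose y hy using key
    -- The components have been glued chart by chart. That they match under the transition functions
    -- is checked on the cover, where it holds for the given sections.
    obtain ⟨z, hz⟩ := LocData.exists_section (L := L) y fun α β W hW hα hβ => by
      refine hE.eq_of_cover (V := V) (hW.trans hU) fun i W' hW' hi => ?_
      rw [resB_resB, (L.isHom α β).hom_res hW' (le_inf hα hβ), resB_resB]
      have := LocData.res_at (x i) α β W' hi (hW'.trans hα) (hW'.trans hβ)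
      rw [← hy, ← hy, resB_resB, resB_resB] at this
      exact this
    exact ⟨z, fun i => LocData.at_ext fun α => by rw [LocData.at_res, hz, hy]⟩

/-- Transport of sections from the chart `U_α` to the glued module. -/
lemma LocData.exists_chart (hL : L.IsStrict) (α : ι) (h : V ≤ 𝒰 α) (x : B ⊗[k] Sec E.M V) :
    ∃ y : Sec L.glued V, ∀ β, L.at β y =
      L.trans β α (V ⊓ 𝒰 β) (le_inf inf_le_right (inf_le_left.trans h)) (resB B inf_le_left x) :=
  LocData.exists_section _ fun β γ W hW hβ hγ => by
    rw [(L.isHom β α).hom_res (le_inf hW hβ), (L.isHom γ α).hom_res (le_inf hW hγ), resB_resB,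
      resB_resB, hL.cocycle β γ α W hβ hγ (hW.trans h)]

/-- The chart of the glued module over `U_α`. -/
def LocData.chart (L : LocData E ε 𝒰) (hL : L.IsStrict)
    (h1 : ∀ α V h x, L.trans α α V h x = x) (α : ι) (V : Opens T) (h : V ≤ 𝒰 α) :
    B ⊗[k] Sec E.M V ≃+ Sec L.glued V where
  toFun x := (LocData.exists_chart hL α h x).choose
  invFun y := resB B (le_inf le_rfl h) (L.at α y)
  left_inv x := by
    change resB B (le_inf le_rfl h) (L.at α (LocData.exists_chart hL α h x).choose) = x
    rw [(LocData.exists_chart hL α h x).choose_spec, (L.isHom α α).hom_res, h1, resB_resB,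
      resB_self]
  right_inv y := LocData.at_ext fun β => by
    change L.at β (LocData.exists_chart hL α h (resB B (le_inf le_rfl h) (L.at α y))).choose = _
    rw [(LocData.exists_chart hL α h _).choose_spec, resB_resB, ← LocData.res_at y β α
      (V ⊓ 𝒰 β) inf_le_left inf_le_right (inf_le_left.trans h), resB_self]
  map_add' x y := LocData.at_ext fun β => by
    rw [LocData.at_add, (LocData.exists_chart hL α h _).choose_spec,
      (LocData.exists_chart hL α h x).choose_spec, (LocData.exists_chart hL α h y).choose_spec,
      map_add, map_add]

lemma LocData.at_chart (hL : L.IsStrict) (h1 : ∀ α V h x, L.trans α α V h x = x) (α : ι)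
    (h : V ≤ 𝒰 α) (x : B ⊗[k] Sec E.M V) (β : ι) :
    L.at β (L.chart hL h1 α V h x) = L.trans β α (V ⊓ 𝒰 β)
      (le_inf inf_le_right (inf_le_left.trans h)) (resB B inf_le_left x) :=
  (LocData.exists_chart hL α h x).choose_spec β

lemma LocData.chart_symm (hL : L.IsStrict) (h1 : ∀ α V h x, L.trans α α V h x = x) (α : ι)
    (h : V ≤ 𝒰 α) (y : Sec L.glued V) :
    (L.chart hL h1 α V h).symm y = resB B (le_inf le_rfl h) (L.at α y) := rfl

lemma LocData.chart_smul (hL : L.IsStrict) (h1 : ∀ α V h x, L.trans α α V h x = x) (α : ι)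
    (h : V ≤ 𝒰 α) (r : Fn (baseChange R B) V) (x : B ⊗[k] Sec E.M V) :
    L.chart hL h1 α V h (r • x) = r • L.chart hL h1 α V h x :=
  LocData.at_ext fun β => by
    rw [LocData.at_smul, LocData.at_chart, LocData.at_chart, resB_smul, (L.isHom β α).hom_smul]

lemma LocData.res_chart (hL : L.IsStrict) (h1 : ∀ α V h x, L.trans α α V h x = x) (α : ι)
    {W : Opens T} (hWV : W ≤ V) (h : V ≤ 𝒰 α) (x : B ⊗[k] Sec E.M V) :
    Sec.res hWV (L.chart hL h1 α V h x) = L.chart hL h1 α W (hWV.trans h) (resB B hWV x) :=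
  LocData.at_ext fun β => by
    rw [LocData.at_res, LocData.at_chart, LocData.at_chart, (L.isHom β α).hom_res, resB_resB,
      resB_resB]

lemma LocData.chart_trans (hL : L.IsStrict) (h1 : ∀ α V h x, L.trans α α V h x = x) (α β : ι)
    (hα : V ≤ 𝒰 α) (hβ : V ≤ 𝒰 β) (x : B ⊗[k] Sec E.M V) :
    L.chart hL h1 α V hα (L.trans α β V (le_inf hα hβ) x) = L.chart hL h1 β V hβ x :=
  LocData.at_ext fun γ => by
    rw [LocData.at_chart, LocData.at_chart, (L.isHom α β).hom_res,
      hL.cocycle γ α β (V ⊓ 𝒰 γ) inf_le_right (inf_le_left.trans hα) (inf_le_left.trans hβ)]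

end GlueSec

/-! ### The deformation glued from strict local data -/

lemma mem_smul_top_of_map {Q M N : Type*} [CommRing Q] [AddCommGroup M] [Module Q M]
    [AddCommGroup N] [Module Q N] {I : Ideal Q} (e : M →+ N) (he : ∀ (r : Q) x, e (r • x) = r • e x)
    {x : M} (hx : x ∈ I • (⊤ : Submodule Q M)) : e x ∈ I • (⊤ : Submodule Q N) := by
  let l : M →ₗ[Q] N := { e with map_smul' := he }
  have : l x ∈ (I • (⊤ : Submodule Q M)).map l := Submodule.mem_map_of_mem hx
  rw [Submodule.map_smul''] at this
  exact Submodule.smul_mono le_rfl le_top this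

section GluedBundle

variable {k : Type u} [Field k] {T : TopCat.{u}} {R : AlgPresheaf k T} {P : PoissonStructure R}
  {B : Type u} [CommRing B] [Algebra k B] {ι : Type u}
  {E : PoissonBundle P} {ε : B →ₐ[k] k} {𝒰 : ι → Opens T} {L : LocData E ε 𝒰} {V : Opens T}

lemma LocData.at_base_smul (α : ι) (b : B) (x : Sec L.glued V) :
    L.at α (b • x) = b • L.at α x := by
  rw [← algebraMap_smul (Fn (baseChange R B) V) b x, L.at_smul, AlgHom.commutes, algebraMap_smul]

lemma LocData.exists_conn (hL : L.IsStrict) (r : Fn (baseChange R B) V) (x : Sec L.glued V) :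
    ∃ y : Sec L.glued V, ∀ α, L.at α y =
      extConn (L.conn α (V ⊓ 𝒰 α) inf_le_right) (Fn.res inf_le_left r) (L.at α x) :=
  LocData.exists_section _ fun α β W hW hα hβ => by
    rw [(L.isConn α).extConn_res (le_inf hW hα), (L.isConn β).extConn_res (le_inf hW hβ),
      LocData.res_at x α β W hW hα hβ, extConn_comm (hL.compat α β W hα hβ), Fn.res_res, Fn.res_res]

/-- The connection on the glued module, as a function. -/
def LocData.gluedConnFun (hL : L.IsStrict) (r : Fn (baseChange R B) V) (x : Sec L.glued V) :
    Sec L.glued V :=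
  (LocData.exists_conn hL r x).choose

lemma LocData.at_gluedConnFun (hL : L.IsStrict) (α : ι) (r : Fn (baseChange R B) V)
    (x : Sec L.glued V) : L.at α (LocData.gluedConnFun hL r x) =
      extConn (L.conn α (V ⊓ 𝒰 α) inf_le_right) (Fn.res inf_le_left r) (L.at α x) :=
  (LocData.exists_conn hL r x).choose_spec α

/-- The connection on the glued module. -/
def LocData.gluedConn (L : LocData E ε 𝒰) (hL : L.IsStrict) (V : Opens T) :
    Fn (baseChange R B) V →ₗ[B] Sec L.glued V →ₗ[B] Sec L.glued V :=
  LinearMap.mk₂ B (LocData.gluedConnFun hL)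
    (fun r s x => LocData.at_ext fun α => by
      simp only [LocData.at_add, LocData.at_gluedConnFun, map_add,
        LinearMap.add_apply])
    (fun b r x => LocData.at_ext fun α => by
      simp only [LocData.at_base_smul, LocData.at_gluedConnFun, map_smul,
        LinearMap.smul_apply])
    (fun r x y => LocData.at_ext fun α => by
      simp only [LocData.at_add, LocData.at_gluedConnFun, map_add])
    (fun b r x => LocData.at_ext fun α => by
      simp only [LocData.at_base_smul, LocData.at_gluedConnFun, map_smul])

lemma LocData.at_gluedConn (hL : L.IsStrict) (α : ι) (r : Fn (baseChange R B) V)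
    (x : Sec L.glued V) : L.at α (L.gluedConn hL V r x) =
      extConn (L.conn α (V ⊓ 𝒰 α) inf_le_right) (Fn.res inf_le_left r) (L.at α x) :=
  LocData.at_gluedConnFun hL α r x

lemma LocData.isLocallyFree_glued (hL : L.IsStrict) (h1 : ∀ α V h x, L.trans α α V h x = x)
    (h𝒰 : ⨆ α, 𝒰 α = ⊤) : IsLocallyFree L.glued := by
  intro x
  obtain ⟨α, hα⟩ := exists_mem_of_le_iSup h𝒰.ge (Opens.mem_top x)
  obtain ⟨U, hxU, n, e, he⟩ := E.locallyFree x
  refine ⟨U ⊓ 𝒰 α, ⟨hxU, hα⟩, n,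
    fun i => L.chart hL h1 α _ inf_le_right (1 ⊗ₜ Sec.res inf_le_left (e i)), fun V hV => ?_⟩
  have hb := bijective_sum_smul_one_tmul (B := B) (he V (hV.trans inf_le_left))
  have hc := (L.chart hL h1 α V (hV.trans inf_le_right)).bijective.comp hb
  convert hc using 1
  funext c
  simp only [Function.comp_apply, map_sum, LocData.chart_smul, LocData.res_chart, resB_tmul,
    Sec.res_res]

/-- The Poisson bundle glued from strict local data. -/
def LocData.gluedBundle [Module.Finite k B] (L : LocData E ε 𝒰) (hL : L.IsStrict)
    (h1 : ∀ α V h x, L.trans α α V h x = x) (h𝒰 : ⨆ α, 𝒰 α = ⊤) :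
    PoissonBundle (P.baseChange B) where
  M := L.glued
  isSheaf := L.isSheaf_glued
  locallyFree := LocData.isLocallyFree_glued hL h1 h𝒰
  conn := L.gluedConn hL
  conn_mul V r s x := LocData.at_ext fun α => by
    simp only [LocData.at_add, LocData.at_smul, LocData.at_gluedConn, map_mul,
      (L.isConn α).extConn_mul]
  conn_smul V r s x := LocData.at_ext fun α => by
    simp only [LocData.at_add, LocData.at_smul, LocData.at_gluedConn,
      (L.isConn α).extConn_smul, (P.baseChange B).res_br]
  flat V r s x := LocData.at_ext fun α => by
    simp only [LocData.at_add, LocData.at_gluedConn, (P.baseChange B).res_br]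
    exact extConn_flat (hL.flat α (V ⊓ 𝒰 α) inf_le_right) _ _ _
  res_conn {W V} h r x := LocData.at_ext fun α => by
    rw [LocData.at_res, LocData.at_gluedConn, LocData.at_gluedConn, LocData.at_res,
      (L.isConn α).extConn_res, Fn.res_res, Fn.res_res]

lemma LocData.chart_symm_conn (hL : L.IsStrict) (h1 : ∀ α V h x, L.trans α α V h x = x) (α : ι)
    (h : V ≤ 𝒰 α) (r : Fn (baseChange R B) V) (y : Sec L.glued V) :
    (L.chart hL h1 α V h).symm (L.gluedConn hL V r y) =
      extConn (L.conn α V h) r ((L.chart hL h1 α V h).symm y) := by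
  rw [LocData.chart_symm, LocData.chart_symm, LocData.at_gluedConn, (L.isConn α).extConn_res,
    Fn.res_res, Fn.res_self]

/-- Strict local data come from a deformation. -/
theorem LocData.exists_deformation [Module.Finite k B] (hL : L.IsStrict)
    (h1 : ∀ α V h x, L.trans α α V h x = x) (h𝒰 : ⨆ α, 𝒰 α = ⊤) :
    ∃ (D : Deformation E ε) (φ : ∀ α, LocalTriv D (𝒰 α)),
      (∀ α V h f x, (D.locData φ).conn α V h f x = L.conn α V h f x) ∧
      ∀ α β V h x, (D.locData φ).trans α β V h x = L.trans α β V h x := by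
  have hsymm : ∀ α V h (r : Fn (baseChange R B) V) y, (L.chart hL h1 α V h).symm (r • y) =
      r • (L.chart hL h1 α V h).symm y := fun α V h r y => by
    rw [AddEquiv.symm_apply_eq, LocData.chart_smul, AddEquiv.apply_symm_apply]
  have hres : ∀ α {W V : Opens T} (hWV : W ≤ V) (h : V ≤ 𝒰 α) (x : Sec L.glued V),
      (L.chart hL h1 α W (hWV.trans h)).symm (Sec.res hWV x) =
        resB B hWV ((L.chart hL h1 α V h).symm x) := fun α W V hWV h x => by
    rw [AddEquiv.symm_apply_eq, ← LocData.res_chart hL h1 α hWV h, AddEquiv.apply_symm_apply]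
  have htrans : ∀ α β V (hα : V ≤ 𝒰 α) (hβ : V ≤ 𝒰 β) (x : Sec L.glued V),
      (L.chart hL h1 α V hα).symm x =
        L.trans α β V (le_inf hα hβ) ((L.chart hL h1 β V hβ).symm x) := fun α β V hα hβ x => by
    rw [AddEquiv.symm_apply_eq, LocData.chart_trans hL h1 α β hα hβ, AddEquiv.apply_symm_apply]
  have hker : ∀ α V h (x : Sec L.glued V),
      slice ε.toLinearMap ((L.chart hL h1 α V h).symm x) = 0 →
        x ∈ RingHom.ker (specialize (R := R) ε V) •
          (⊤ : Submodule (Fn (baseChange R B) V) (Sec L.glued V)) := fun α V h x hx => by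
    have := mem_smul_top_of_map (L.chart hL h1 α V h).toAddMonoidHom
      (fun r y => LocData.chart_smul hL h1 α h r y) (mem_smul_top_of_slice_eq_zero ε _ hx)
    rwa [AddEquiv.coe_toAddMonoidHom, AddEquiv.apply_symm_apply] at this
  -- In each chart the restriction to the closed fibre is `ε ⊗ id`. These maps agree on overlaps
  -- because the transition functions induce the identity on `F`.
  obtain ⟨ρ, hρ⟩ := exists_restriction (E' := L.gluedBundle hL h1 h𝒰) (E := E)
    (φ := specialize ε) (res_specialize ε) h𝒰
    (fun α V h x => slice ε.toLinearMap ((L.chart hL h1 α V h).symm x))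
    (fun α V h x y => (congrArg _ (map_add (L.chart hL h1 α V h).symm x y)).trans (map_add _ _ _))
    (fun α V h r x => (congrArg _ (hsymm α V h r x)).trans (slice_smul ε r _))
    (fun α W V hWV h x => (res_slice _ hWV _).trans (congrArg _ (hres α hWV h x).symm))
    (fun α V h r x => (congrArg _ (LocData.chart_symm_conn hL h1 α h r x)).trans
      ((L.isConn α).extConn_slice h r _))
    (fun α β V hα hβ x => (congrArg _ (htrans α β V hα hβ x)).trans
      ((L.isHom α β).hom_slice V (le_inf hα hβ) _))
    (fun α V h m => ⟨L.chart hL h1 α V h (1 ⊗ₜ m),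
      (congrArg _ ((L.chart hL h1 α V h).symm_apply_apply _)).trans (slice_one_tmul m)⟩)
    hker
  let D : Deformation E ε := ⟨L.gluedBundle hL h1 h𝒰, ρ⟩
  let φ : ∀ α, LocalTriv D (𝒰 α) := fun α =>
    { equiv := L.chart hL h1 α
      equiv_smul := fun V h a b f m => by
        rw [← tm_smul_tmul]
        exact LocData.chart_smul hL h1 α h _ _
      res_equiv := fun hWV h a m => LocData.res_chart hL h1 α hWV h _
      restr_equiv := fun V h a m => by
        refine (hρ α V h _).trans ?_
        exact (congrArg _ ((L.chart hL h1 α V h).symm_apply_apply _)).trans (slice_tmul _ _ _) }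
  refine ⟨D, φ, fun α V h f x => ?_, fun α β V h x => ?_⟩
  · change (L.chart hL h1 α V h).symm (L.gluedConn hL V (tm 1 f) (L.chart hL h1 α V h x)) = _
    rw [LocData.chart_symm_conn, AddEquiv.symm_apply_apply, extConn_tm, one_smul]
  · have hα := h.trans inf_le_left
    have hβ := h.trans inf_le_right
    change (L.chart hL h1 α V hα).symm (L.chart hL h1 β V hβ x) = _
    rw [AddEquiv.symm_apply_eq, LocData.chart_trans hL h1 α β hα hβ]

end GluedBundle

/-! ### Liftings of deformations and the obstruction class -/

section Obstruction

lemma HH.mk_eq_mk_iff {k : Type u} [CommRing k] {T : TopCat.{u}} {R : AlgPresheaf k T}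
    {P : PoissonStructure R} {E : PoissonBundle P} {ι : Type u} {𝒰 : ι → Opens T} {n : ℤ}
    {c c' : cocycles E 𝒰 n} : HH.mk E 𝒰 c = HH.mk E 𝒰 c' ↔
      ∃ b ∈ total E 𝒰 (n - 1), dTotal E 𝒰 b = (c : Cochains E 𝒰) - c' := by
  rw [eq_comm]
  refine (QuotientAddGroup.eq (s := (coboundaries E 𝒰 n).addSubgroupOf (cocycles E 𝒰 n))).trans ?_
  rw [AddSubgroup.mem_addSubgroupOf, neg_add_eq_sub]
  rfl

lemma HH.mk_eq_zero_iff {k : Type u} [CommRing k] {T : TopCat.{u}} {R : AlgPresheaf k T}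
    {P : PoissonStructure R} {E : PoissonBundle P} {ι : Type u} {𝒰 : ι → Opens T} {n : ℤ}
    {c : cocycles E 𝒰 n} : HH.mk E 𝒰 c = 0 ↔
      ∃ b ∈ total E 𝒰 (n - 1), dTotal E 𝒰 b = (c : Cochains E 𝒰) := by
  have := HH.mk_eq_mk_iff (E := E) (𝒰 := 𝒰) (c := c) (c' := 0)
  rw [ZeroMemClass.coe_zero, sub_zero] at this
  exact this

variable {k : Type u} [Field k] {T : TopCat.{u}} {R : AlgPresheaf k T} {P : PoissonStructure R}
  {A B : Type u} [CommRing A] [Algebra k A] [CommRing B] [Algebra k B] {ι : Type u}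
  {E : PoissonBundle P} {ε : A →ₐ[k] k} {𝒰 : ι → Opens T} {D : Deformation E ε}
  {μ : B →ₐ[k] A} {t : B}

/-- The cocycle condition makes `F_αα` idempotent. The image of `F_αα - 1` lies in `t ⊗ F`, where
`F_αα` acts as the identity, so `F_αα x - x = F_αα (F_αα x - x) = 0`. -/
lemma LocData.IsStrict.trans_self {ε : B →ₐ[k] k} {L : LocData E ε 𝒰} (hL : L.IsStrict)
    (hμ : IsSmall μ ε t) (h : ∀ α V h x,
      LinearMap.rTensor (Sec E.M V) μ.toLinearMap (L.trans α α V h x) =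
        LinearMap.rTensor (Sec E.M V) μ.toLinearMap x) (α : ι) (V : Opens T) (hV : V ≤ 𝒰 α ⊓ 𝒰 α)
    (x : B ⊗[k] Sec E.M V) : L.trans α α V hV x = x := by
  obtain ⟨m, hm⟩ := exists_tmul_of_rTensor_eq_zero μ hμ.surj hμ.ne_zero hμ.ker
    (L.trans α α V hV x - x) (by rw [map_sub, h, sub_self])
  have hα := hV.trans inf_le_left
  have h2 := (L.isHom α α).apply_tmul hμ hV m
  rw [← hm, map_sub, hL.cocycle α α α V hα hα hα, sub_self, eq_comm] at h2
  exact sub_eq_zero.mp h2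

/-- A deformation over `B` whose local data lift those of `D` is a lifting of `D`. -/
lemma Lifting.nonempty (hμ : Function.Surjective μ) (h𝒰 : ⨆ α, 𝒰 α = ⊤)
    (D' : Deformation E (ε.comp μ)) (φ : ∀ α, LocalTriv D (𝒰 α)) (φ' : ∀ α, LocalTriv D' (𝒰 α))
    (hconn : ∀ α V h f x, LinearMap.rTensor (Sec E.M V) μ.toLinearMap ((φ' α).conn V h f x) =
      (φ α).conn V h f (LinearMap.rTensor (Sec E.M V) μ.toLinearMap x))
    (htrans : ∀ α β V hα hβ x,
      LinearMap.rTensor (Sec E.M V) μ.toLinearMap ((φ' α).change (φ' β) V hα hβ x) =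
        (φ α).change (φ β) V hα hβ (LinearMap.rTensor (Sec E.M V) μ.toLinearMap x)) :
    Nonempty (Lifting μ D) := by
  have hsymm : ∀ α V h (r : Fn (baseChange R B) V) y, ((φ' α).equiv V h).symm (r • y) =
      r • ((φ' α).equiv V h).symm y := fun α V h r y => by
    rw [AddEquiv.symm_apply_eq, (φ' α).equiv_fn_smul, AddEquiv.apply_symm_apply]
  obtain ⟨ρ, hρ⟩ := exists_restriction (E' := D'.bundle) (E := D.bundle)
    (φ := reduce μ) (res_reduce μ) h𝒰
    (fun α V h x => (φ α).equiv V h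
      (LinearMap.rTensor (Sec E.M V) μ.toLinearMap (((φ' α).equiv V h).symm x)))
    (fun α V h x y => by simp only [map_add])
    (fun α V h r x => by rw [hsymm, rTensor_smul, (φ α).equiv_fn_smul])
    (fun α W V hWV h x => by
      have : ((φ' α).equiv W (hWV.trans h)).symm (Sec.res hWV x) =
          resB B hWV (((φ' α).equiv V h).symm x) := by
        rw [AddEquiv.symm_apply_eq, ← (φ' α).res_equiv_apply hWV h, AddEquiv.apply_symm_apply]
      rw [(φ α).res_equiv_apply hWV h, resB_rTensor, this])
    -- Both connections are linear over the coefficients, so it suffices to treat functions `1 ⊗ f`.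
    (fun α V h r x => by
      induction r using Fn.induction with
      | h0 => simp only [map_zero, LinearMap.zero_apply]
      | ha r s hr hs => simp only [map_add, LinearMap.add_apply, hr, hs]
      | ht b f =>
        have h1 : ((φ' α).equiv V h).symm (D'.bundle.conn V (tm 1 f) x) =
            (φ' α).conn V h f (((φ' α).equiv V h).symm x) := by
          rw [AddEquiv.symm_apply_eq, (φ' α).equiv_conn, AddEquiv.apply_symm_apply]
        have h2 : D'.bundle.conn V (tm b f) x =
            (algebraMap B (Fn (baseChange R B) V) b) • D'.bundle.conn V (tm 1 f) x := by
          rw [tm_eq_smul, map_smul, LinearMap.smul_apply, algebraMap_smul]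
        have h3 : ∀ y, D.bundle.conn V (tm (μ b) f) y =
            (algebraMap A (Fn (baseChange R A) V) (μ b)) • D.bundle.conn V (tm 1 f) y := fun y => by
          rw [tm_eq_smul, map_smul, LinearMap.smul_apply, algebraMap_smul]
        rw [h2, hsymm, h1, algebraMap_smul, rTensor_algHom_smul, hconn, (φ α).equiv_base_smul,
          (φ α).equiv_conn, reduce_tm, h3, algebraMap_smul])
    (fun α β V hα hβ x => by
      have : ((φ' α).equiv V hα).symm x =
          (φ' α).change (φ' β) V hα hβ (((φ' β).equiv V hβ).symm x) := by
        rw [AddEquiv.symm_apply_eq, (φ' α).equiv_change, AddEquiv.apply_symm_apply]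
      rw [this, htrans, (φ α).equiv_change])
    (fun α V h => ((φ α).equiv V h).surjective.comp
      ((LinearMap.rTensor_surjective _ hμ).comp ((φ' α).equiv V h).symm.surjective))
    (fun α V h x hx => by
      rw [map_eq_zero_iff _ ((φ α).equiv V h).injective] at hx
      have := mem_smul_top_of_map ((φ' α).equiv V h).toAddMonoidHom
        (fun r y => (φ' α).equiv_fn_smul V h r y) (mem_smul_top_of_rTensor_eq_zero μ hμ _ hx)
      rwa [AddEquiv.coe_toAddMonoidHom, AddEquiv.apply_symm_apply] at this)
  refine ⟨⟨D', ρ, fun U m => ?_⟩⟩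
  refine (isSheafOn_sec E.isSheaf).eq_of_cover (V := 𝒰) (h𝒰 ▸ le_top) fun α W hW hα => ?_
  rw [D.restr.res_hom, ρ.res_hom, D'.restr.res_hom, hρ α W hα, (φ α).restr_equiv_apply,
    slice_rTensor, ← (φ' α).restr_equiv_apply W hα, AddEquiv.apply_symm_apply]

/-- The trivialization of `D` induced by a trivialization of a lifting. -/
lemma Lifting.exists_localTriv [Module.Finite k A] (hε : ∀ a, ε a = 0 → IsNilpotent a)
    (Λ : Lifting μ D) {U : Opens T} (φ' : LocalTriv Λ.deformation U) :
    ∃ φ : LocalTriv D U, ∀ V h x,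
      φ.equiv V h (LinearMap.rTensor (Sec E.M V) μ.toLinearMap x) =
        Λ.restr.hom V (φ'.equiv V h x) := by
  -- The trivialization of the lifting, restricted to `1 ⊗ F` and reduced to `D`, is a splitting of
  -- the restriction of `D` to `F`. A splitting already gives a trivialization.
  have hσ : IsLinMap (R := R) (incl A) fun V h (m : Sec E.M V) =>
      Λ.restr.hom V (φ'.equiv V h (1 ⊗ₜ m)) :=
    { add := fun V h m n => by rw [TensorProduct.tmul_add, map_add, map_add]
      smul := fun V h f m => by
        have : (1 : B) ⊗ₜ[k] (f • m) = (tm 1 f : Fn (baseChange R B) V) • (1 ⊗ₜ m) := by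
          rw [tm_smul_tmul, one_mul]
        rw [this, φ'.equiv_fn_smul, Λ.restr.hom_smul, reduce_tm, map_one, incl_apply]
      res := fun hWV h m => by
        rw [Λ.restr.res_hom, φ'.res_equiv] }
  have hσε : ∀ V h (m : Sec E.M V),
      D.restr.hom V (Λ.restr.hom V (φ'.equiv V h (1 ⊗ₜ m))) = m := fun V h m => by
    rw [Λ.restr_comp, φ'.restr_equiv, map_one, one_smul]
  refine ⟨D.localTrivOfSplitting hε hσ hσε, fun V h x => ?_⟩
  rw [Deformation.localTrivOfSplitting_equiv]
  induction x using tensor_induction with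
  | h0 => simp only [map_zero]
  | ha x y hx hy => simp only [map_add, hx, hy]
  | ht b m =>
    have : b ⊗ₜ[k] m = (tm b 1 : Fn (baseChange R B) V) • (1 ⊗ₜ m) := by
      rw [tm_smul_tmul, mul_one, one_smul]
    rw [LinearMap.rTensor_tmul, splitMap_tmul, this, φ'.equiv_fn_smul, Λ.restr.hom_smul, reduce_tm]
    rfl

/-- The class is that of the defect of one fixed local lift; any other local lift has a cohomologous
defect. It vanishes exactly if some local lift is strict, and strict lifts of the local data
correspond to liftings of `D`. -/
theorem exists_obstruction [CharZero k] [Module.Finite k A] [Module.Finite k B]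
    (hε : ∀ a, ε a = 0 → IsNilpotent a) (hμ : IsSmall μ (ε.comp μ) t) (h𝒰 : ⨆ α, 𝒰 α = ⊤)
    (hD : Nonempty (∀ α, LocalTriv D (𝒰 α)))
    (hD' : ∀ D' : Deformation E (ε.comp μ), Nonempty (∀ α, LocalTriv D' (𝒰 α))) :
    ∃ o : HH E 𝒰 2,
      (Nonempty (LocalLift μ D 𝒰) ∧ ∀ L : LocalLift μ D 𝒰, ∃ c : cocycles E 𝒰 2,
        L.IsDefect t c ∧ o = HH.mk E 𝒰 c) ∧ (o = 0 ↔ Nonempty (Lifting μ D)) := by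
  obtain ⟨φ⟩ := hD
  obtain ⟨L₀⟩ := LocalLift.nonempty hμ.surj φ
  obtain ⟨c₀, hc₀, hL₀⟩ := L₀.isStrictMod.exists_isDefect hμ
  refine ⟨HH.mk E 𝒰 ⟨c₀, hL₀.mem_cocycles hμ hc₀⟩, ⟨⟨L₀⟩, fun L => ?_⟩, ?_⟩
  · obtain ⟨c, hc, hL⟩ := L.isStrictMod.exists_isDefect hμ
    exact ⟨⟨c, hL.mem_cocycles hμ hc⟩, LocalLift.isDefect hL,
      HH.mk_eq_mk_iff.mpr (L₀.exists_dTotal_eq hμ L hc₀ hc hL₀ hL)⟩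
  · rw [HH.mk_eq_zero_iff]
    constructor
    · rintro ⟨b, hb, hbc⟩
      have ht : (ε.comp μ) t = 0 := by
        rw [AlgHom.comp_apply, hμ.map_eq_zero, map_zero]
      -- If the defect is `db`, the perturbation by `b` removes it without changing the reduction to
      -- `A`. The perturbed data then glue to a deformation that lifts `D`.
      have hg := L₀.toLocData.isGauge_perturb hμ ht hb
      have hs := hg.isStrict L₀.isStrictMod hμ hb hc₀ hL₀ hbc
      have hconn : ∀ α V h f x, LinearMap.rTensor (Sec E.M V) μ.toLinearMap
          ((L₀.toLocData.perturb hμ ht hb).conn α V h f x) = (L₀.triv α).conn V h f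
            (LinearMap.rTensor (Sec E.M V) μ.toLinearMap x) := fun α V h f x =>
        (hg.rTensor_conn hμ α V h f x).trans (L₀.rTensor_conn α V h f x)
      have htrans : ∀ α β V hα hβ x, LinearMap.rTensor (Sec E.M V) μ.toLinearMap
          ((L₀.toLocData.perturb hμ ht hb).trans α β V (le_inf hα hβ) x) =
            (L₀.triv α).change (L₀.triv β) V hα hβ
              (LinearMap.rTensor (Sec E.M V) μ.toLinearMap x) := fun α β V hα hβ x =>
        (hg.rTensor_trans hμ α β V _ x).trans (L₀.rTensor_trans α β V hα hβ x)
      obtain ⟨D', φ', h1, h2⟩ := LocData.exists_deformation hs (hs.trans_self hμ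
        fun α V h x => (htrans α α V (h.trans inf_le_left) (h.trans inf_le_left) x).trans
          (((L₀.triv α).equiv V _).symm_apply_apply _)) h𝒰
      exact Lifting.nonempty hμ.surj h𝒰 D' L₀.triv φ'
        (fun α V h f x => (congrArg _ (h1 α V h f x)).trans (hconn α V h f x))
        (fun α β V hα hβ x => (congrArg _ (h2 α β V (le_inf hα hβ) x)).trans
          (htrans α β V hα hβ x))
    · rintro ⟨Λ⟩
      obtain ⟨φ'⟩ := hD' Λ.deformation
      choose ψ hψ using fun α => Λ.exists_localTriv hε (φ' α)
      -- The local data of a given lifting form a local lift with respect to the induced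
      -- trivializations `ψ` of `D`. Its defect is zero, so the defect of `L₀` is a coboundary.
      let L := LocalLift.ofLocData ψ (Λ.deformation.locData φ')
        (fun α V h f x => by
          refine ((ψ α).equiv V h).injective ?_
          rw [hψ]
          refine Eq.trans ?_ ((ψ α).equiv_conn V h f _).symm
          refine (congrArg _ ((φ' α).equiv_conn V h f x)).trans ?_
          rw [Λ.restr.hom_conn, reduce_tm, map_one, hψ])
        (fun α β V h x => by
          refine ((ψ α).equiv V (h.trans inf_le_left)).injective ?_
          rw [hψ]
          refine Eq.trans ?_ ((ψ α).equiv_change (ψ β) V _ (h.trans inf_le_right) _).symm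
          refine (congrArg _ ((φ' α).equiv_change (φ' β) V _ (h.trans inf_le_right) x)).trans ?_
          rw [hψ])
      have hL : L.toLocData.IsDefect t 0 := (Λ.deformation.isStrict_locData φ').isDefect t
      obtain ⟨b, hb, hbc⟩ := L₀.exists_dTotal_eq hμ L hc₀ (zero_mem _) hL₀ hL
      exact ⟨b, hb, hbc.trans (sub_zero _)⟩

end Obstruction

/-! ### First-order deformations -/

section FirstOrder

variable {k : Type u} [Field k] {T : TopCat.{u}} {R : AlgPresheaf k T} {P : PoissonStructure R}
  {A B : Type u} [CommRing A] [Algebra k A] [CommRing B] [Algebra k B] {ι : Type u}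
  {E : PoissonBundle P} {𝒰 : ι → Opens T} {t : B}

lemma LocData.IsGauge.congr {ε : B →ₐ[k] k} {L₁ L₂ L : LocData E ε 𝒰} {b : Cochains E 𝒰}
    (hconn : ∀ α V h f x, L₂.conn α V h f x = L₁.conn α V h f x)
    (htrans : ∀ α β V h x, L₂.trans α β V h x = L₁.trans α β V h x)
    (hb : L₁.IsGauge L (fun _ _ _ => 1) t b) : L₂.IsGauge L (fun _ _ _ => 1) t b := by
  refine ⟨fun s V h f x => ?_, fun s V h x => ?_⟩
  · rw [← hb.conn s V h f x]
    exact congrArg (· - _) (hconn _ V _ f x)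
  · rw [← hb.trans s V h x]
    exact congrArg (· - _) (htrans _ _ V _ x)

section Iso

variable {ε : A →ₐ[k] k} {D D' : Deformation E ε}

/-- Transport of a trivialization along an isomorphism of deformations. -/
lemma Deformation.IsIso.exists_locData_eq (h : D.IsIso D') (φ : ∀ α, LocalTriv D (𝒰 α)) :
    ∃ ψ : ∀ α, LocalTriv D' (𝒰 α),
      (∀ α V h f x, (D'.locData ψ).conn α V h f x = (D.locData φ).conn α V h f x) ∧
      ∀ α β V h x, (D'.locData ψ).trans α β V h x = (D.locData φ).trans α β V h x := by
  obtain ⟨e, he1, he2⟩ := h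
  have hr : ∀ U (m : Sec D'.bundle.M U),
      (e.hom.app (op U)).hom ((e.inv.app (op U)).hom m) = m := fun U m =>
    congr(($(e.inv_hom_id).app (op U)).hom m)
  have hl : ∀ U (m : Sec D.bundle.M U),
      (e.inv.app (op U)).hom ((e.hom.app (op U)).hom m) = m := fun U m =>
    congr(($(e.hom_inv_id).app (op U)).hom m)
  let eq : ∀ U, Sec D.bundle.M U ≃+ Sec D'.bundle.M U := fun U =>
    { toFun := fun m => (e.hom.app (op U)).hom m
      invFun := fun m => (e.inv.app (op U)).hom m
      left_inv := hl U
      right_inv := hr U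
      map_add' := fun m n => (e.hom.app (op U)).hom.map_add m n }
  have heq : ∀ U (r : Fn (baseChange R A) U) m, eq U (r • m) = r • eq U m := fun U r m =>
    (e.hom.app (op U)).hom.map_smul r m
  have hres : ∀ {V U : Opens T} (h : V ≤ U) m, Sec.res h (eq U m) = eq V (Sec.res h m) :=
    fun {V U} h m => (PresheafOfModules.naturality_apply e.hom (homOfLE h).op m).symm
  let ψ : ∀ α, LocalTriv D' (𝒰 α) := fun α =>
    { equiv := fun V h => ((φ α).equiv V h).trans (eq V)
      equiv_smul := fun V h a b f m => by
        simp only [AddEquiv.trans_apply, (φ α).equiv_smul, heq]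
      res_equiv := fun hWV h a m => by
        simp only [AddEquiv.trans_apply, hres, (φ α).res_equiv]
      restr_equiv := fun V h a m => (he2 V _).trans ((φ α).restr_equiv V h a m) }
  refine ⟨ψ, fun α V h f x => ?_, fun α β V h x => ?_⟩
  · refine ((ψ α).equiv V h).injective ?_
    refine ((ψ α).equiv_conn V h f x).trans ?_
    change D'.bundle.conn V (tm 1 f) (eq V ((φ α).equiv V h x)) =
      eq V ((φ α).equiv V h ((φ α).conn V h f x))
    rw [(φ α).equiv_conn]
    exact (he1 V _ _).symm
  · have hα := h.trans inf_le_left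
    have hβ := h.trans inf_le_right
    refine ((ψ α).equiv V hα).injective ?_
    refine ((ψ α).equiv_change (ψ β) V hα hβ x).trans ?_
    change eq V ((φ β).equiv V hβ x) = eq V ((φ α).equiv V hα ((φ α).change (φ β) V hα hβ x))
    rw [(φ α).equiv_change]

/-- Deformations whose local data are intertwined by bijections are isomorphic. -/
lemma Deformation.isIso_of_locData (h𝒰 : ⨆ α, 𝒰 α = ⊤) (φ : ∀ α, LocalTriv D (𝒰 α))
    (φ' : ∀ α, LocalTriv D' (𝒰 α)) {θ : ∀ α V, V ≤ 𝒰 α → Module.End A (A ⊗[k] Sec E.M V)}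
    (hθ : ∀ α, IsHomOn E ε (θ α)) (hbij : ∀ α V h, Function.Bijective (θ α V h))
    (hconn : ∀ α V h f x, (φ α).conn V h f (θ α V h x) = θ α V h ((φ' α).conn V h f x))
    (htrans : ∀ α β V hα hβ x, (φ α).change (φ β) V hα hβ (θ β V hβ x) =
      θ α V hα ((φ' α).change (φ' β) V hα hβ x)) : D'.IsIso D := by
  have hS := isSheafOn_sec D.bundle.isSheaf
  have hS' := isSheafOn_sec D'.bundle.isSheaf
  have hle : ∀ U : Opens T, U ≤ ⨆ α, 𝒰 α := fun U => h𝒰 ▸ le_top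
  -- In the chart `α` the isomorphism is `θ α` read through the trivializations; the relation
  -- between `θ` and the transition functions is the agreement on overlaps.
  obtain ⟨τ, hτ, hτσ⟩ := hS.exists_glued_map (r := fun _ _ h => Sec.res h)
    (G := Sec D'.bundle.M) (fun h h' x => Sec.res_res _ h h' x) (U := ⊤) (𝒰 := 𝒰) h𝒰.ge
    (fun α V h x => (φ α).equiv V h (θ α V h (((φ' α).equiv V h).symm x)))
    (fun α W V hWV h x => by
      have : ((φ' α).equiv W (hWV.trans h)).symm (Sec.res hWV x) =
          resB A hWV (((φ' α).equiv V h).symm x) := by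
        rw [AddEquiv.symm_apply_eq, ← (φ' α).res_equiv_apply hWV h, AddEquiv.apply_symm_apply]
      rw [(φ α).res_equiv_apply hWV h, (hθ α).hom_res, this])
    (fun α β V hα hβ x => by
      have : ((φ' α).equiv V hα).symm x =
          (φ' α).change (φ' β) V hα hβ (((φ' β).equiv V hβ).symm x) := by
        rw [AddEquiv.symm_apply_eq, (φ' α).equiv_change, AddEquiv.apply_symm_apply]
      rw [this, ← htrans, (φ α).equiv_change])
  have hbijτ : ∀ U, Function.Bijective (τ U le_top) := fun U =>
    hS'.bijective_of_locally hS τ hτ (fun x hx => by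
      obtain ⟨α, hα⟩ := exists_mem_of_le_iSup (hle ⊤) hx
      refine ⟨𝒰 α, hα, fun V hV hVα => ?_⟩
      have : τ V hV = fun x => (φ α).equiv V hVα (θ α V hVα (((φ' α).equiv V hVα).symm x)) :=
        funext fun x => hτσ α V hVα hV x
      rw [this]
      exact ((φ α).equiv V hVα).bijective.comp
        ((hbij α V hVα).comp ((φ' α).equiv V hVα).symm.bijective)) U le_top
  have hsymm : ∀ α V h (r : Fn (baseChange R A) V) y, ((φ' α).equiv V h).symm (r • y) =
      r • ((φ' α).equiv V h).symm y := fun α V h r y => by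
    rw [AddEquiv.symm_apply_eq, (φ' α).equiv_fn_smul, AddEquiv.apply_symm_apply]
  have hadd : ∀ U x y, τ U le_top (x + y) = τ U le_top x + τ U le_top y := fun U x y =>
    hS.eq_of_cover (hle U) fun α W hW hα => by
      rw [map_add, hτ, hτ, hτ, map_add, hτσ α W hα, hτσ α W hα, hτσ α W hα]
      simp only [map_add]
  have hsmul : ∀ U (r : Fn (baseChange R A) U) x, τ U le_top (r • x) = r • τ U le_top x :=
    fun U r x => hS.eq_of_cover (hle U) fun α W hW hα => by
      rw [Sec.res_smul, hτ, hτ, Sec.res_smul, hτσ α W hα, hτσ α W hα, hsymm, (hθ α).hom_smul,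
        (φ α).equiv_fn_smul]
  have hcc : ∀ U (r : Fn (baseChange R A) U) x, τ U le_top (D'.bundle.conn U r x) =
      D.bundle.conn U r (τ U le_top x) := fun U r x => by
    refine hS.eq_of_cover (hle U) fun α W hW hα => ?_
    rw [D.bundle.res_conn, hτ, hτ, D'.bundle.res_conn, hτσ α W hα, hτσ α W hα]
    generalize Fn.res hW r = r
    generalize Sec.res hW x = x
    induction r using Fn.induction with
    | h0 => simp only [map_zero, LinearMap.zero_apply]
    | ha r s hr hs => simp only [map_add, LinearMap.add_apply, hr, hs]
    | ht a f =>
      have h1 : ((φ' α).equiv W hα).symm (D'.bundle.conn W (tm 1 f) x) =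
          (φ' α).conn W hα f (((φ' α).equiv W hα).symm x) := by
        rw [AddEquiv.symm_apply_eq, (φ' α).equiv_conn, AddEquiv.apply_symm_apply]
      have h2 : D'.bundle.conn W (tm a f) x =
          (algebraMap A (Fn (baseChange R A) W) a) • D'.bundle.conn W (tm 1 f) x := by
        rw [tm_eq_smul, map_smul, LinearMap.smul_apply, algebraMap_smul]
      have h3 : ∀ y, D.bundle.conn W (tm a f) y =
          (algebraMap A (Fn (baseChange R A) W) a) • D.bundle.conn W (tm 1 f) y := fun y => by
        rw [tm_eq_smul, map_smul, LinearMap.smul_apply, algebraMap_smul]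
      rw [h2, hsymm, h1, (hθ α).hom_smul, ← hconn, (φ α).equiv_fn_smul, (φ α).equiv_conn, h3]
  obtain ⟨e, he⟩ := exists_iso_of_bijective (fun U => τ U le_top) hadd hsmul
    (fun h x => hτ h le_top x) hbijτ
  refine ⟨e, fun U f m => ?_, fun U m => ?_⟩
  · exact (he U _).trans ((hcc U f m).trans (congrArg _ (he U m).symm))
  · refine (congrArg (D.restr.hom U) (he U m)).trans ?_
    refine (isSheafOn_sec E.isSheaf).eq_of_cover (hle U) fun α W hW hα => ?_
    rw [D.restr.res_hom, D'.restr.res_hom, hτ, hτσ α W hα, (φ α).restr_equiv_apply,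
      (hθ α).hom_slice, ← (φ' α).restr_equiv_apply W hα, AddEquiv.apply_symm_apply]

end Iso

variable {ε : B →ₐ[k] k}

/-- For a first-order deformation the small extension is `B → k`, with `ε` in the role of `μ`.
Agreement modulo `t` is then agreement of slices, which holds for any two lifts of `∇` or of the
identity. -/
lemma rTensor_eq_one_tmul {M : PMod R} {V : Opens T} (x : B ⊗[k] Sec M V) :
    LinearMap.rTensor (Sec M V) ε.toLinearMap x = 1 ⊗ₜ slice ε.toLinearMap x := by
  induction x using tensor_induction with
  | h0 => simp only [map_zero, TensorProduct.tmul_zero]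
  | ha x y hx hy => simp only [map_add, hx, hy, TensorProduct.tmul_add]
  | ht b m =>
    rw [LinearMap.rTensor_tmul, slice_tmul, ← TensorProduct.smul_tmul, smul_eq_mul, mul_one]

/-- The cochain that measures the difference between local data and the constant local data. -/
lemma LocData.exists_isGauge_const (hμ : IsSmall ε ε t) (L : LocData E ε 𝒰) :
    ∃ b : Cochains E 𝒰, b ∈ total E 𝒰 1 ∧
      L.IsGauge (LocData.const E ε 𝒰) (fun _ _ _ => 1) t b := by
  refine LocData.exists_isGauge hμ (fun _ => IsHomOn.one) (fun α V h f x => ?_)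
    (fun α β V hα hβ x => ?_)
  · rw [rTensor_eq_one_tmul, rTensor_eq_one_tmul, Module.End.one_apply, Module.End.one_apply,
      (L.isConn α).conn_slice, ((LocData.const E ε 𝒰).isConn α).conn_slice]
  · rw [rTensor_eq_one_tmul, rTensor_eq_one_tmul, Module.End.one_apply, Module.End.one_apply,
      (L.isHom α β).hom_slice, ((LocData.const E ε 𝒰).isHom α β).hom_slice]

/-- The data `L` and the constant data are both strict, so their defects vanish and so does their
difference `db`. -/
lemma LocData.IsGauge.mem_cocycles (hμ : IsSmall ε ε t) {L : LocData E ε 𝒰} (hL : L.IsStrict)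
    {b : Cochains E 𝒰} (hb : b ∈ total E 𝒰 1)
    (hg : L.IsGauge (LocData.const E ε 𝒰) (fun _ _ _ => 1) t b) : b ∈ cocycles E 𝒰 1 :=
  ⟨hb, (hg.dTotal_eq (hL.isDefect t) (LocData.isStrict_const.isDefect t)
    (fun _ => IsHomOn.one) hμ hb (zero_mem _) (zero_mem _)).trans (sub_self _)⟩

/-- Two trivializations of a first-order deformation give cohomologous cocycles. -/
lemma Deformation.exists_dTotal_eq (hμ : IsSmall ε ε t) {D : Deformation E ε}
    (φ φ' : ∀ α, LocalTriv D (𝒰 α)) {b b' : Cochains E 𝒰} (hb : b ∈ total E 𝒰 1)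
    (hb' : b' ∈ total E 𝒰 1)
    (hg : (D.locData φ).IsGauge (LocData.const E ε 𝒰) (fun _ _ _ => 1) t b)
    (hg' : (D.locData φ').IsGauge (LocData.const E ε 𝒰) (fun _ _ _ => 1) t b') :
    ∃ H ∈ total E 𝒰 0, dTotal E 𝒰 H = b - b' := by
  have hθ : ∀ α, IsHomOn E ε fun V (h : V ≤ 𝒰 α) => (φ α).change (φ' α) V h h := fun α =>
    (φ α).isHomOn_change (φ' α) le_rfl le_rfl
  -- The change of trivialization induces the identity on `F`, so it has the form `1 + t H`. The
  -- components of `H` form the `0`-cochain whose differential compares the cocycles.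
  have hH : ∀ s : Fin 1 → ι, _ := fun s =>
    ((hθ (s 0)).restrict (inter_le 𝒰 s 0)).exists_polyvector hμ IsHomOn.one
      (fun V h x => by
        rw [rTensor_eq_one_tmul, rTensor_eq_one_tmul,
          ((hθ (s 0)).restrict (inter_le 𝒰 s 0)).hom_slice V h, Module.End.one_apply])
  choose H hH1 hH2 using hH
  have hH3 : cochainZero H ∈ total E 𝒰 0 := cochainZero_mem hH1
  have hθH : ∀ (s : Fin 1 → ι) (V : Opens T) (h : V ≤ inter 𝒰 s) (x : B ⊗[k] Sec E.M V),
      (φ (s 0)).change (φ' (s 0)) V (h.trans (inter_le 𝒰 s 0)) (h.trans (inter_le 𝒰 s 0)) x =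
        x + t ⊗ₜ cochainZero H 0 0 s ⟨V, h⟩ ![] (slice ε.toLinearMap x) := fun s V h x =>
    sub_eq_iff_eq_add'.mp (hH2 s V h x)
  refine ⟨cochainZero H, hH3, ?_⟩
  funext p q
  by_cases hpq : (p + q : ℤ) = 1
  swap
  · rw [dTotal_eq_zero hH3 p q hpq, Pi.sub_apply, Pi.sub_apply, hb.2 p q hpq, hb'.2 p q hpq,
      sub_zero]
  funext s ⟨V, (h : V ≤ inter 𝒰 s)⟩ f m
  refine tmul_injective (M := E.M) (V := V) hμ.ne_zero ?_
  change t ⊗ₜ dTotal E 𝒰 _ p q s ⟨V, h⟩ f m = t ⊗ₜ ((b - b') p q s ⟨V, h⟩ f m : Sec E.M V)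
  obtain ⟨rfl, rfl⟩ | ⟨rfl, rfl⟩ : p = 1 ∧ q = 0 ∨ p = 0 ∧ q = 1 := by omega
  · obtain ⟨f0, rfl⟩ : ∃ f0, f = ![f0] := ⟨_, eq_vec_one f⟩
    have := hg.conn_sub hg' hμ (θ := fun α V h => (φ α).change (φ' α) V h h) hθH s V h f0 (1 ⊗ₜ m)
    rw [D.locData_conn_change, sub_self, slice_one_tmul] at this
    rw [eq_comm, ← sub_eq_zero, ← neg_eq_zero, neg_sub, ← TensorProduct.tmul_sub]
    exact this.symm
  · obtain rfl : f = ![] := eq_vec_zero f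
    have := hg.trans_sub hg' hμ (θ := fun α V h => (φ α).change (φ' α) V h h) hθH s V h (1 ⊗ₜ m)
    rw [slice_one_tmul] at this
    replace this := (sub_eq_zero.mpr (D.locData_trans_change φ φ' (s 0) (s 1) V _ _ _)).symm.trans this
    rw [eq_comm, ← sub_eq_zero, ← TensorProduct.tmul_sub]
    exact this.symm

/-- The endomorphism is the identity plus a map into `t ⊗ F`, on which it acts as the identity. It
is therefore unipotent, with an explicit inverse. -/
lemma bijective_of_forall_sub (hμ : IsSmall ε ε t) {U V : Opens T} (h : V ≤ U)
    {θ : ∀ V, V ≤ U → Module.End B (B ⊗[k] Sec E.M V)} (hθ : IsHomOn E ε θ) :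
    Function.Bijective (θ V h) := by
  have key : ∀ x, ∃ m : Sec E.M V, θ V h x - x = t ⊗ₜ m := fun x =>
    exists_tmul_of_rTensor_eq_zero ε hμ.surj hμ.ne_zero hμ.ker _ (by
      rw [map_sub, rTensor_eq_one_tmul, rTensor_eq_one_tmul, hθ.hom_slice, sub_self])
  refine ⟨(injective_iff_map_eq_zero _).mpr fun x hx => ?_, fun y => ?_⟩
  · obtain ⟨m, hm⟩ := key x
    have h1 : x = t ⊗ₜ (-m) := by rw [TensorProduct.tmul_neg, ← hm, hx, zero_sub, neg_neg]
    rw [h1, hθ.apply_tmul hμ, ← h1] at hx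
    exact hx
  · obtain ⟨m, hm⟩ := key y
    refine ⟨y - t ⊗ₜ m, ?_⟩
    rw [map_sub, hθ.apply_tmul hμ, ← hm, sub_sub_cancel]

/-- First-order deformations with cohomologous cocycles are isomorphic. -/
lemma Deformation.isIso_of_dTotal_eq (hμ : IsSmall ε ε t) (h𝒰 : ⨆ α, 𝒰 α = ⊤)
    {D D' : Deformation E ε} (φ : ∀ α, LocalTriv D (𝒰 α)) (φ' : ∀ α, LocalTriv D' (𝒰 α))
    {b b' H : Cochains E 𝒰}
    (hg : (D.locData φ).IsGauge (LocData.const E ε 𝒰) (fun _ _ _ => 1) t b)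
    (hg' : (D'.locData φ').IsGauge (LocData.const E ε 𝒰) (fun _ _ _ => 1) t b')
    (hH : H ∈ total E 𝒰 0) (h : dTotal E 𝒰 H = b - b') : D'.IsIso D := by
  have hHα : ∀ α, IsPolyvector (Op.restrict (le_inter_const α) (H 0 0 fun _ => α)) := fun α =>
    IsPolyvector.restrict (le_inter_const α) (hH.1 0 0 fun _ => α)
  let θ : ∀ α V, V ≤ 𝒰 α → Module.End B (B ⊗[k] Sec E.M V) := fun α V h =>
    1 + polyOp hμ.mul (hHα α) V h ![]
  have hθ : ∀ α, IsHomOn E ε (θ α) := fun α => isHomOn_one_add hμ hμ.map_eq_zero (hHα α)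
  have hθH : ∀ (s : Fin 1 → ι) (V : Opens T) (h : V ≤ inter 𝒰 s) (x : B ⊗[k] Sec E.M V),
      θ (s 0) V (h.trans (inter_le 𝒰 s 0)) x =
        x + t ⊗ₜ H 0 0 s ⟨V, h⟩ ![] (slice ε.toLinearMap x) := fun s V h x => by
    obtain ⟨α, rfl⟩ : ∃ α, s = fun _ => α := ⟨s 0, funext fun i => by rw [Subsingleton.elim i 0]⟩
    rfl
  refine Deformation.isIso_of_locData h𝒰 φ φ' hθ
    (fun α V h => bijective_of_forall_sub hμ h (hθ α)) (fun α V hV f x => ?_)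
    (fun α β V hα hβ x => ?_)
  · have := hg.conn_sub hg' hμ hθH (fun _ => α) V (hV.trans (le_inter_const α)) f x
    rw [h, sub_self] at this
    exact sub_eq_zero.mp (this.trans (TensorProduct.tmul_zero _ _))
  · have := hg.trans_sub hg' hμ hθH ![α, β] V ((le_inf hα hβ).trans (le_inter_pair α β)) x
    rw [h, sub_self] at this
    exact sub_eq_zero.mp (this.trans (TensorProduct.tmul_zero _ _))

/-- Every cocycle comes from a first-order deformation. -/
lemma exists_deformation_of_cocycle [CharZero k] [Module.Finite k B] (hμ : IsSmall ε ε t)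
    (h𝒰 : ⨆ α, 𝒰 α = ⊤) (c : cocycles E 𝒰 1) :
    ∃ (D : Deformation E ε) (φ : ∀ α, LocalTriv D (𝒰 α)),
      (D.locData φ).IsGauge (LocData.const E ε 𝒰) (fun _ _ _ => 1) t c := by
  -- A perturbation by `b` has cochain `-b` when compared with the constant data in the direction
  -- used for `κ`, so the constant data are perturbed by `-c`.
  have hc : -(c : Cochains E 𝒰) ∈ total E 𝒰 1 := neg_mem c.2.1
  have hg := (LocData.const E ε 𝒰).isGauge_perturb hμ hμ.map_eq_zero hc
  have hs := hg.isStrict (LocData.isStrict_const.isStrictMod ε) hμ hc (zero_mem _)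
    (LocData.isStrict_const.isDefect t) (by
      rw [map_neg, neg_eq_zero]
      exact c.2.2)
  obtain ⟨D, φ, h1, h2⟩ := LocData.exists_deformation hs (hs.trans_self hμ fun α V h x =>
    hg.rTensor_trans hμ α α V h x) h𝒰
  refine ⟨D, φ, LocData.IsGauge.congr h1 h2 ?_⟩
  have := hg.symm_one
  rwa [neg_neg] at this

/-- Each trivialized deformation is compared with the constant data. The class of the resulting
cocycle depends only on the isomorphism class; cohomologous cocycles give isomorphic deformations,
and every cocycle is realized. -/
theorem exists_classification [CharZero k] [Module.Finite k B] (hμ : IsSmall ε ε t)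
    (h𝒰 : ⨆ α, 𝒰 α = ⊤)
    (hD : ∀ D : Deformation E ε, Nonempty (∀ α, LocalTriv D (𝒰 α))) :
    ∃ κ : Def E ε ≃ HH E 𝒰 1, ∀ (D : Deformation E ε) (φ : ∀ α, LocalTriv D (𝒰 α)),
      ∃ c : cocycles E 𝒰 1,
        (D.locData φ).IsGauge (LocData.const E ε 𝒰) (fun _ _ _ => 1) t c ∧
          κ D.cls = HH.mk E 𝒰 c := by
  have hex : ∀ (D : Deformation E ε) (φ : ∀ α, LocalTriv D (𝒰 α)), ∃ c : cocycles E 𝒰 1,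
      (D.locData φ).IsGauge (LocData.const E ε 𝒰) (fun _ _ _ => 1) t c := fun D φ => by
    obtain ⟨b, hb, hg⟩ := (D.locData φ).exists_isGauge_const hμ
    exact ⟨⟨b, hg.mem_cocycles hμ (D.isStrict_locData φ) hb⟩, hg⟩
  choose c hc using hex
  let ψ : ∀ D : Deformation E ε, ∀ α, LocalTriv D (𝒰 α) := fun D => (hD D).some
  -- Transporting the trivializations along the isomorphism reduces to two trivializations of a
  -- single deformation. The case `D = D'` shows that the class does not depend on the
  -- trivializations.
  have key : ∀ (D D' : Deformation E ε), D.IsIso D' →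
      ∀ (φ : ∀ α, LocalTriv D (𝒰 α)) (φ' : ∀ α, LocalTriv D' (𝒰 α)),
        HH.mk E 𝒰 (c D φ) = HH.mk E 𝒰 (c D' φ') := fun D D' h φ φ' => by
    obtain ⟨φ₁, h1, h2⟩ := h.exists_locData_eq φ
    exact HH.mk_eq_mk_iff.mpr (Deformation.exists_dTotal_eq hμ φ₁ φ' (c D φ).2.1 (c D' φ').2.1
      (LocData.IsGauge.congr h1 h2 (hc D φ)) (hc D' φ'))
  let κ : Def E ε → HH E 𝒰 1 := Quotient.lift (s := Deformation.setoid E ε)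
    (fun D => HH.mk E 𝒰 (c D (ψ D))) fun D D' h => key D D' h _ _
  have hκ : ∀ D φ, κ (Deformation.cls D) = HH.mk E 𝒰 (c D φ) := fun D φ =>
    key D D ((Deformation.setoid E ε).refl D) _ _
  refine ⟨Equiv.ofBijective κ ⟨?_, ?_⟩, fun D φ => ⟨c D φ, hc D φ, hκ D φ⟩⟩
  · intro x y hxy
    induction x using Quotient.inductionOn with | h D => ?_
    induction y using Quotient.inductionOn with | h D' => ?_
    obtain ⟨H, hH, h⟩ := HH.mk_eq_mk_iff.mp hxy
    exact Quotient.sound ((Deformation.setoid E ε).symm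
      (Deformation.isIso_of_dTotal_eq hμ h𝒰 (ψ D) (ψ D') (hc D (ψ D)) (hc D' (ψ D')) hH h))
  · intro y
    obtain ⟨z, rfl⟩ := QuotientAddGroup.mk_surjective y
    obtain ⟨D, φ, hg⟩ := exists_deformation_of_cocycle hμ h𝒰 z
    refine ⟨D.cls, (hκ D φ).trans ?_⟩
    exact HH.mk_eq_mk_iff.mpr (Deformation.exists_dTotal_eq hμ φ φ (c D φ).2.1 z.2.1 (hc D φ) hg)

end FirstOrder

/-! ### Small extensions of Artinian algebras and deformations on schemes -/

section Small

variable {k : Type u} [Field k]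

/-- Every `b` is congruent to the scalar `ε (μ b)` modulo the maximal ideal, which annihilates `t`.
Hence `B` acts on `t` through scalars, and the ideal `(t)` is the line `k t`. -/
lemma IsSmallExtension.isSmall {A B : Type u} [CommRing A] [Algebra k A] [CommRing B]
    [IsLocalRing B] [Algebra k B] {ε : A →ₐ[k] k} {μ : B →ₐ[k] A} {t : B}
    (h : IsSmallExtension μ t) (hB : RingHom.ker (ε.comp μ) = IsLocalRing.maximalIdeal B) :
    IsSmall μ (ε.comp μ) t := by
  have hmul : ∀ b, t * b = ε.comp μ b • t := fun b => by
    have hb : b - algebraMap k B (ε.comp μ b) ∈ IsLocalRing.maximalIdeal B := by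
      rw [← hB, RingHom.mem_ker, map_sub, AlgHom.commutes]
      exact sub_self _
    have := h.mul_eq_zero _ hb
    rwa [mul_sub, sub_eq_zero, mul_comm t (algebraMap _ _ _), ← Algebra.smul_def] at this
  have hker : ∀ b, μ b = 0 ↔ b ∈ Ideal.span {t} := fun b => h.ker ▸ Iff.rfl
  refine ⟨h.surjective, h.ne_zero, fun b hb => ?_, hmul, (hker t).mpr ?_⟩
  · obtain ⟨y, rfl⟩ := Ideal.mem_span_singleton'.mp ((hker b).mp hb)
    exact ⟨ε.comp μ y, by rw [mul_comm, hmul]⟩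
  · exact Ideal.mem_span_singleton_self t

open scoped DualNumber in
lemma isSmall_eps : IsSmall (TrivSqZeroExt.fstHom k k k) (TrivSqZeroExt.fstHom k k k)
    (DualNumber.eps : k[ε]) where
  surj c := ⟨TrivSqZeroExt.inl c, rfl⟩
  ne_zero h := one_ne_zero (congrArg TrivSqZeroExt.snd h)
  ker b hb := ⟨b.snd, TrivSqZeroExt.ext (by simpa using hb) (by simp)⟩
  mul b := TrivSqZeroExt.ext (by simp) (by simp)
  map_eq_zero := rfl

lemma isNilpotent_of_fst_eq_zero (a : TrivSqZeroExt k k) (ha : TrivSqZeroExt.fstHom k k k a = 0) :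
    IsNilpotent a := by
  have : TrivSqZeroExt.fst a = 0 := ha
  exact ⟨2, TrivSqZeroExt.ext (by simp [pow_two, this]) (by simp [pow_two, this])⟩

variable {T : TopCat.{u}} {R : AlgPresheaf k T} {P : PoissonStructure R} {E : PoissonBundle P}
  {ι : Type u} {𝒰 : ι → Opens T}

open scoped DualNumber in
lemma LocData.IsGauge.isFirstOrderCochain {D : Deformation E (TrivSqZeroExt.fstHom k k k)}
    {φ : ∀ α, LocalTriv D (𝒰 α)} {c : Cochains E 𝒰}
    (h : (D.locData φ).IsGauge (LocData.const E _ 𝒰) (fun _ _ _ => 1) (DualNumber.eps : k[ε]) c) :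
    IsFirstOrderCochain D φ c where
  conn s V hV f m := by
    refine ((φ (s 0)).equiv_conn V (hV.trans (inter_le 𝒰 s 0)) f _).symm.trans (congrArg _ ?_)
    have := sub_eq_iff_eq_add'.mp (h.conn s V hV f (1 ⊗ₜ m))
    rw [slice_one_tmul] at this
    exact this
  trans s V hV m := by
    refine ((φ (s 0)).equiv_change (φ (s 1)) V (hV.trans (inter_le 𝒰 s 0))
      (hV.trans (inter_le 𝒰 s 1)) _).symm.trans (congrArg _ ?_)
    have := sub_eq_iff_eq_add'.mp (h.trans s V hV (1 ⊗ₜ m))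
    rw [slice_one_tmul] at this
    exact this

end Small

lemma Deformation.nonempty_localTriv_of_isAffineOpen {k : Type u} [Field k] {X : Scheme.{u}}
    {p : X ⟶ Spec (CommRingCat.of k)} {P : PoissonStructure (structureSheaf p)}
    {E : PoissonBundle P} {ι : Type u} {𝒰 : ι → X.Opens} (h : ∀ α, IsAffineOpen (𝒰 α))
    {A : Type u} [CommRing A] [Algebra k A] [Module.Finite k A] {ε : A →ₐ[k] k}
    (hε : ∀ a, ε a = 0 → IsNilpotent a) (D : Deformation E ε) :
    Nonempty (∀ α, LocalTriv D (𝒰 α)) :=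
  ⟨fun α => (D.nonempty_localTriv hε (isLoc_affineBasis p (h α))).some⟩

end PoissonBundles

end

/-! ### The main theorem -/

theorem mainTheorem9 {k : Type u} [Field k] [IsAlgClosed k] [CharZero k]
    (X : Scheme.{u}) (p : X ⟶ Spec (CommRingCat.of k))
    [IsIntegral X] [IsSeparated p] [QuasiCompact p] [Smooth p]
    (P : PoissonBundles.PoissonStructure (PoissonBundles.structureSheaf p))
    (E : PoissonBundles.PoissonBundle P)
    {ι : Type u} (𝒰 : ι → X.Opens) (h_affine : ∀ α, IsAffineOpen (𝒰 α)) (h_cover : ⨆ α, 𝒰 α = ⊤) :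
    (∃ κ : PoissonBundles.Def E (TrivSqZeroExt.fstHom k k k) ≃ PoissonBundles.HH E 𝒰 1,
      ∀ D : PoissonBundles.Deformation E (TrivSqZeroExt.fstHom k k k),
        Nonempty (∀ α, PoissonBundles.LocalTriv D (𝒰 α)) ∧
        ∀ φ : ∀ α, PoissonBundles.LocalTriv D (𝒰 α),
          ∃ c : PoissonBundles.cocycles E 𝒰 1,
            PoissonBundles.IsFirstOrderCochain D φ c ∧ κ D.cls = PoissonBundles.HH.mk E 𝒰 c) ∧
    ∀ (A : Type u) [CommRing A] [IsLocalRing A] [IsArtinianRing A] [Algebra k A] (ε : A →ₐ[k] k)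
      (D : PoissonBundles.Deformation E ε)
      (B : Type u) [CommRing B] [IsLocalRing B] [IsArtinianRing B] [Algebra k B]
      (μ : B →ₐ[k] A) (t : B), PoissonBundles.IsSmallExtension μ t →
      ∃ o : PoissonBundles.HH E 𝒰 2,
        (Nonempty (PoissonBundles.LocalLift μ D 𝒰) ∧
          ∀ L : PoissonBundles.LocalLift μ D 𝒰, ∃ c : PoissonBundles.cocycles E 𝒰 2,
            L.IsDefect t c ∧ o = PoissonBundles.HH.mk E 𝒰 c) ∧
        (o = 0 ↔ Nonempty (PoissonBundles.Lifting μ D)) := by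
  refine ⟨?_, fun A _ _ _ _ ε D B _ _ _ _ μ t ht => ?_⟩
  · have : Module.Finite k (TrivSqZeroExt k k) := inferInstanceAs (Module.Finite k (k × k))
    have htriv := fun D : PoissonBundles.Deformation E (TrivSqZeroExt.fstHom k k k) =>
      D.nonempty_localTriv_of_isAffineOpen h_affine PoissonBundles.isNilpotent_of_fst_eq_zero
    obtain ⟨κ, hκ⟩ := PoissonBundles.exists_classification PoissonBundles.isSmall_eps h_cover htriv
    refine ⟨κ, fun D => ⟨htriv D, fun φ => ?_⟩⟩
    obtain ⟨c, hc, hκc⟩ := hκ D φ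
    exact ⟨c, hc.isFirstOrderCochain, hκc⟩
  -- Both `A` and `B` are finite dimensional over `k`, as the sheaf property of `F ⊗ A` and `F ⊗ B`
  -- requires. The residue map of `B` is `ε.comp μ`.
  · have := PoissonBundles.finite_of_isArtinianRing ε
    have := PoissonBundles.finite_of_isArtinianRing (ε.comp μ)
    exact PoissonBundles.exists_obstruction (PoissonBundles.isNilpotent_of_eq_zero ε)
      (ht.isSmall (PoissonBundles.ker_eq_maximalIdeal (ε.comp μ))) h_cover
      (D.nonempty_localTriv_of_isAffineOpen h_affine (PoissonBundles.isNilpotent_of_eq_zero ε))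
      fun D' => D'.nonempty_localTriv_of_isAffineOpen h_affine
        (PoissonBundles.isNilpotent_of_eq_zero (ε.comp μ))
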